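/- Let $F$ be a field and let $G,H$ be smooth affine group schemes over $F$. For a smooth affine group scheme $K$ over $F$, a (left) $K$-torsor over an $F$-scheme $S$ is a morphism $p\colon P\to S$ of $F$-schemes with an action $\rho\colon K\times P\to P$ such that $(\rho,\mathrm{pr}_2)\colon K\times P\to P\times_S P$ is an isomorphism and such that $P$ is equivariantly isomorphic to the trivial torsor after base change along some étale covering of $S$; right torsors are defined analogously. Let $[K\backslash\mathrm{pt}]$ denote the classifying stack: its objects over an $F$-scheme $S$ are the left $K$-torsors over $S$, its morphisms are the cartesian squares with equivariant upper arrow, and morphisms of stacks are functors over the category of $F$-schemes. Let $K_l$ be the trivial left $K$-torsor over $\operatorname{Spec}F$. An $(H,G)$-bitorsor is an $F$-scheme $P$ with commuting actions of $H$ from the left and of $G$ from the right which make it a left $H$-torsor and a right $G$-torsor over $\operatorname{Spec}F$. (a) There is an equivalence between the groupoid of invertible morphisms of stacks $[G\backslash\mathrm{pt}]\to[H\backslash\mathrm{pt}]$ and natural transformations (over the category of $F$-schemes) between them, and the groupoid of $(H,G)$-bitorsors and biequivariant isomorphisms. It sends $\Phi$, naturally in $\Phi$, to the left $H$-torsor $\Phi(G_l)$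 over $\operatorname{Spec}F$ with the right $G$-action obtained by applying $\Phi$ to the right translations of $G_l$. A quasi-inverse sends a bitorsor $P$ to the functor $\Phi_P=P\times_{/G}(-)$, where for a left $G$-torsor $X$ over $S$ the balanced product $P\times_{/G}X$ is the quotient of $P\times X$ by the free action $g\cdot(p,x)=(pg^{-1},gx)$ of $G$, regarded as a left $H$-torsor over $S$. (b) The following are equivalent: 1. There is an equivalence of stacks $[G\backslash\mathrm{pt}]\simeq[H\backslash\mathrm{pt}]$. 2. There is an $(H,G)$-bitorsor. 3. $G$ and $H$ are strongly inner forms of each other, i.e. $H$ is a strongly inner form of $G$ and $G$ is a strongly inner form of $H$. Here a group scheme $G'$ over $F$ is called a strongly inner form of $G$ if it is a form of $G$, that is, there are group isomorphisms $\varphi_i\colon G'|_{U_i}\cong G|_{U_i}$ on some étale covering $(U_i\to\operatorname{Spec}F)_i$, and the class of the cocycle $(\varphi_i\circ\varphi_j^{-1})_{i,j}$ in $\mathrm H^1_{\text{ét}}(F,\mathrm{Aut}(G))$ lies in the image of the map $\mathrm H^1_{\text{ét}}(F,G)\to\mathrm H^1_{\text{ét}}(F,\mathrm{Aut}(G))$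 induced by conjugation. -/

import Mathlib

open CategoryTheory MonoidalCategory CartesianMonoidalCategory MonObj

namespace StrongInner

universe v u

section Pointwise

variable {C : Type u} [Category.{v} C] [CartesianMonoidalCategory C]

/-- A left action `act : G × P ⟶ P` of a group object, the axioms being stated on generalised
points: `lift g x ≫ act` is the point `g • x`. -/
structure IsAction {G P : C} [GrpObj G] (act : G ⊗ P ⟶ P) : Prop where
  one_act : ∀ {T : C} (x : T ⟶ P), lift (1 : T ⟶ G) x ≫ act = x
  mul_act : ∀ {T : C} (g h : T ⟶ G) (x : T ⟶ P),
    lift (g * h) x ≫ act = lift g (lift h x ≫ act) ≫ act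

/-- A right action `act : P × G ⟶ P` of a group object; `lift x g ≫ act` is the point `x • g`. -/
structure IsRightAction {G P : C} [GrpObj G] (act : P ⊗ G ⟶ P) : Prop where
  act_one : ∀ {T : C} (x : T ⟶ P), lift x (1 : T ⟶ G) ≫ act = x
  act_mul : ∀ {T : C} (x : T ⟶ P) (g h : T ⟶ G),
    lift x (g * h) ≫ act = lift (lift x g ≫ act) h ≫ act

/-- An isomorphism `G_T ≅ H_T` of group objects over `T`, for group objects `G`, `H` of `C`.
The morphism `hom : G × T ⟶ H` is the first component of the `T`-morphism
`G × T ⟶ H × T`, `(x, t) ↦ (hom (x, t), t)`, and likewise for `inv`. -/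
structure GrpIsoOver (G H : C) [GrpObj G] [GrpObj H] (T : C) where
  hom : G ⊗ T ⟶ H
  inv : H ⊗ T ⟶ G
  hom_inv : lift hom (snd G T) ≫ inv = fst G T
  inv_hom : lift inv (snd H T) ≫ hom = fst H T
  map_mul : ∀ {Z : C} (x y : Z ⟶ G) (t : Z ⟶ T),
    lift (x * y) t ≫ hom = (lift x t ≫ hom) * (lift y t ≫ hom)

namespace GrpIsoOver

variable {G H K : C} [GrpObj G] [GrpObj H] [GrpObj K] {T T' T'' : C}

lemma hom_inv_apply (e : GrpIsoOver G H T) {Z : C} (x : Z ⟶ G) (t : Z ⟶ T) :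
    lift (lift x t ≫ e.hom) t ≫ e.inv = x := by
  have h := lift x t ≫= e.hom_inv
  simpa [comp_lift_assoc] using h

lemma inv_hom_apply (e : GrpIsoOver G H T) {Z : C} (x : Z ⟶ H) (t : Z ⟶ T) :
    lift (lift x t ≫ e.inv) t ≫ e.hom = x := by
  have h := lift x t ≫= e.inv_hom
  simpa [comp_lift_assoc] using h

@[ext]
lemma ext {e e' : GrpIsoOver G H T} (h : e.hom = e'.hom) : e = e' := by
  have hi : e.inv = e'.inv := by
    have h1 := e'.hom_inv_apply (lift (fst H T) (snd H T) ≫ e.inv) (snd H T)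
    rw [← h, e.inv_hom_apply] at h1
    simpa using h1.symm
  cases e; cases e'; simp only at h hi; subst h; subst hi; rfl

/-- The identity of `G_T`. -/
def refl (G T : C) [GrpObj G] : GrpIsoOver G G T where
  hom := fst G T
  inv := fst G T
  hom_inv := by simp
  inv_hom := by simp
  map_mul x y t := by simp

/-- The inverse isomorphism. -/
def symm (e : GrpIsoOver G H T) : GrpIsoOver H G T where
  hom := e.inv
  inv := e.hom
  hom_inv := e.inv_hom
  inv_hom := e.hom_inv
  map_mul x y t := by
    have h := e.map_mul (lift x t ≫ e.inv) (lift y t ≫ e.inv) t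
    rw [inv_hom_apply, inv_hom_apply] at h
    rw [← h, hom_inv_apply]

/-- The composite `f ∘ e`. -/
def trans (e : GrpIsoOver G H T) (f : GrpIsoOver H K T) : GrpIsoOver G K T where
  hom := lift e.hom (snd G T) ≫ f.hom
  inv := lift f.inv (snd K T) ≫ e.inv
  hom_inv := by
    have h := f.hom_inv_apply e.hom (snd G T)
    rw [comp_lift_assoc, lift_snd, h, e.hom_inv]
  inv_hom := by
    have h := e.inv_hom_apply f.inv (snd K T)
    rw [comp_lift_assoc, lift_snd, h, f.inv_hom]
  map_mul x y t := by
    simp only [comp_lift_assoc, lift_snd, e.map_mul, f.map_mul]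

/-- The base change of an isomorphism along `f : T' ⟶ T`. -/
def pullback (e : GrpIsoOver G H T) (f : T' ⟶ T) : GrpIsoOver G H T' where
  hom := lift (fst G T') (snd G T' ≫ f) ≫ e.hom
  inv := lift (fst H T') (snd H T' ≫ f) ≫ e.inv
  hom_inv := by
    have h := e.hom_inv_apply (fst G T') (snd G T' ≫ f)
    simpa [comp_lift_assoc] using h
  inv_hom := by
    have h := e.inv_hom_apply (fst H T') (snd H T' ≫ f)
    simpa [comp_lift_assoc] using h
  map_mul x y t := by simp [comp_lift_assoc, e.map_mul]

lemma pullback_trans (e : GrpIsoOver G H T) (e' : GrpIsoOver H K T) (f : T' ⟶ T) :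
    (e.trans e').pullback f = (e.pullback f).trans (e'.pullback f) := by
  ext
  simp [pullback, trans, comp_lift_assoc]

lemma pullback_symm (e : GrpIsoOver G H T) (f : T' ⟶ T) :
    e.symm.pullback f = (e.pullback f).symm := rfl

lemma pullback_id (e : GrpIsoOver G H T) : e.pullback (𝟙 T) = e := by
  ext
  simp [pullback]

lemma pullback_comp (e : GrpIsoOver G H T) (f : T' ⟶ T) (g : T'' ⟶ T') :
    e.pullback (g ≫ f) = (e.pullback f).pullback g := by
  ext
  simp [pullback, comp_lift_assoc]

lemma trans_assoc {L : C} [GrpObj L] (e : GrpIsoOver G H T) (e' : GrpIsoOver H K T)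
    (e'' : GrpIsoOver K L T) : (e.trans e').trans e'' = e.trans (e'.trans e'') := by
  ext
  simp [trans, comp_lift_assoc]

lemma refl_trans (e : GrpIsoOver G H T) : (refl G T).trans e = e := by
  ext
  simp [trans, refl]

lemma trans_refl (e : GrpIsoOver G H T) : e.trans (refl H T) = e := by
  ext
  simp [trans, refl]

lemma self_trans_symm (e : GrpIsoOver G H T) : e.trans e.symm = refl G T := by
  ext
  simp [trans, refl, symm, e.hom_inv]

lemma symm_trans_self (e : GrpIsoOver G H T) : e.symm.trans e = refl H T := by
  ext
  simp [trans, refl, symm, e.inv_hom]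

/-- `Aut(G)(T) = Aut_T(G_T)`, the product `a * b` being the composite `a ∘ b`. -/
instance : Group (GrpIsoOver G G T) where
  mul a b := b.trans a
  one := refl G T
  inv a := a.symm
  mul_assoc a b c := (trans_assoc c b a).symm
  one_mul a := trans_refl a
  mul_one a := refl_trans a
  inv_mul_cancel a := self_trans_symm a

lemma mul_eq (a b : GrpIsoOver G G T) : a * b = b.trans a := rfl

/-- Conjugation `c_h = h (-) h⁻¹` on `G_T` by a point `h ∈ G(T)`. -/
def conj (h : T ⟶ G) : GrpIsoOver G G T where
  hom := (snd G T ≫ h) * fst G T * (snd G T ≫ h)⁻¹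
  inv := (snd G T ≫ h)⁻¹ * fst G T * (snd G T ≫ h)
  hom_inv := by simp [comp_mul, GrpObj.comp_inv, _root_.mul_assoc]
  inv_hom := by simp [comp_mul, GrpObj.comp_inv, _root_.mul_assoc]
  map_mul x y t := by simp [comp_mul, GrpObj.comp_inv, _root_.mul_assoc]

lemma pullback_conj (h : T ⟶ G) (f : T' ⟶ T) : (conj h).pullback f = conj (f ≫ h) := by
  ext
  simp [conj, pullback, comp_mul, GrpObj.comp_inv]

end GrpIsoOver

/-- The presheaf of groups `Aut(G)`, `T ↦ Aut_T(G_T)`. -/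
def autPresheaf (G : C) [GrpObj G] : Cᵒᵖ ⥤ GrpCat.{v} where
  obj T := GrpCat.of (GrpIsoOver G G T.unop)
  map f := GrpCat.ofHom
    { toFun := fun a => a.pullback f.unop
      map_one' := by
        apply GrpIsoOver.ext
        change lift _ _ ≫ fst _ _ = fst _ _
        simp
      map_mul' := fun a b => GrpIsoOver.pullback_trans b a f.unop }
  map_id T := by
    exact GrpCat.hom_ext (MonoidHom.ext fun a => a.pullback_id)
  map_comp f g := by
    exact GrpCat.hom_ext (MonoidHom.ext fun a => a.pullback_comp f.unop g.unop)

/-- The conjugation homomorphism `G ⟶ Aut(G)`, `h ↦ c_h`. -/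
def conjHom (G : C) [GrpObj G] : yonedaGrpObj G ⟶ autPresheaf G where
  app T := GrpCat.ofHom
    { toFun := fun h => GrpIsoOver.conj h
      map_one' := by
        apply GrpIsoOver.ext
        change _ = fst _ _
        simp [GrpIsoOver.conj]
      map_mul' := fun a b => by
        apply GrpIsoOver.ext
        rw [GrpIsoOver.mul_eq]
        simp [GrpIsoOver.conj, GrpIsoOver.trans, comp_mul, GrpObj.comp_inv, _root_.mul_assoc] }
  naturality T T' f :=
    GrpCat.hom_ext (MonoidHom.ext fun h => (GrpIsoOver.pullback_conj h f.unop).symm)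

end Pointwise

noncomputable section Cohomology

open AlgebraicGeometry PresheafOfGroups Opposite

/-- The category of schemes over the field `F`. -/
abbrev Sch (F : Type u) [Field F] := Over (Spec (CommRingCat.of F))

/-- An étale covering `(U i ⟶ Spec F)` of `Spec F`: a jointly surjective family of étale
morphisms. -/
structure EtaleCovering (F : Type u) [Field F] where
  I : Type u
  U : I → Sch F
  etale : ∀ i, Etale (U i).hom
  surjective : ∀ x : Spec (CommRingCat.of F), ∃ (i : I) (y : (U i).left), (U i).hom y = x

/-- A refinement `𝒱 ⟶ 𝒰` of étale coverings. -/
structure EtaleCovering.Refinement {F : Type u} [Field F] (𝒱 𝒰 : EtaleCovering F) where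
  idx : 𝒱.I → 𝒰.I
  map : ∀ i, 𝒱.U i ⟶ 𝒰.U (idx i)

/-- A Čech 1-cocycle with values in a presheaf of groups `A`, on some étale covering of `Spec F`. -/
structure EtaleCocycle {F : Type u} [Field F] (A : (Sch F)ᵒᵖ ⥤ GrpCat.{u}) where
  cov : EtaleCovering F
  cocycle : OneCocycle A cov.U

/-- The restriction of a 1-cocycle along a refinement of coverings. -/
def restrictCocycle {F : Type u} [Field F] {A : (Sch F)ᵒᵖ ⥤ GrpCat.{u}} {𝒱 𝒰 : EtaleCovering F}
    (z : OneCocycle A 𝒰.U) (r : 𝒱.Refinement 𝒰) : OneCocycle A 𝒱.U where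
  ev i j _ a b := z.ev (r.idx i) (r.idx j) (a ≫ r.map i) (b ≫ r.map j)
  ev_precomp i j _ _ φ a b := by simp
  ev_trans i j k _ a b c := z.ev_trans _ _ _ _ _ _

/-- Two Čech cocycles are identified if they become cohomologous on a common refinement. -/
def EtaleCocycle.Rel {F : Type u} [Field F] {A : (Sch F)ᵒᵖ ⥤ GrpCat.{u}}
    (z z' : EtaleCocycle A) : Prop :=
  ∃ (𝒱 : EtaleCovering F) (r : 𝒱.Refinement z.cov) (r' : 𝒱.Refinement z'.cov),
    (restrictCocycle z.cocycle r).IsCohomologous (restrictCocycle z'.cocycle r')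

/-- The nonabelian étale cohomology set `H¹_ét(F, A)`, the colimit of the Čech cohomology sets over
all étale coverings of `Spec F`. -/
def H1et {F : Type u} [Field F] (A : (Sch F)ᵒᵖ ⥤ GrpCat.{u}) : Type (u + 1) :=
  Quot (EtaleCocycle.Rel (A := A))

/-- The image of a 1-cocycle under a morphism of presheaves of groups. -/
def mapCocycle {F : Type u} [Field F] {A B : (Sch F)ᵒᵖ ⥤ GrpCat.{u}} (φ : A ⟶ B)
    {I : Type u} {U : I → Sch F} (z : OneCocycle A U) : OneCocycle B U where
  ev i j T a b := φ.app (op T) (z.ev i j a b)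
  ev_precomp i j T T' f a b := by
    rw [← z.ev_precomp i j f a b]
    exact (ConcreteCategory.congr_hom (φ.naturality f.op) (z.ev i j a b)).symm
  ev_trans i j k T a b c := by rw [← map_mul, z.ev_trans]

/-- The map `H¹_ét(F, A) ⟶ H¹_ét(F, B)` induced by a morphism `A ⟶ B`. -/
def H1et.map {F : Type u} [Field F] {A B : (Sch F)ᵒᵖ ⥤ GrpCat.{u}} (φ : A ⟶ B) :
    H1et A → H1et B :=
  Quot.map (fun z => ⟨z.cov, mapCocycle φ z.cocycle⟩) (by
    rintro z z' ⟨𝒱, r, r', α, h⟩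
    refine ⟨𝒱, r, r', fun i => φ.app (op (𝒱.U i)) (α i), fun i j T a b => ?_⟩
    have e := congrArg (φ.app (op T)) (h i j a b)
    rw [map_mul, map_mul] at e
    have ha := ConcreteCategory.congr_hom (φ.naturality a.op) (α i)
    have hb := ConcreteCategory.congr_hom (φ.naturality b.op) (α j)
    refine Eq.trans (congrArg (· * _) ha.symm) (Eq.trans e (congrArg (_ * ·) hb)))

/-- The cocycle `φ_i ∘ φ_j⁻¹ ∈ Aut(G)(U_i ×_F U_j)` attached to local isomorphisms
`φ_i : G'|_{U_i} ≅ G|_{U_i}`. -/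
def formCocycle {F : Type u} [Field F] {G G' : Sch F} [GrpObj G] [GrpObj G'] {I : Type u}
    {U : I → Sch F} (φ : ∀ i, GrpIsoOver G' G (U i)) : OneCocycle (autPresheaf G) U where
  ev i j _ a b := ((φ j).pullback b).symm.trans ((φ i).pullback a)
  ev_precomp i j T T' f a b := by
    change GrpIsoOver.pullback _ f = _
    rw [GrpIsoOver.pullback_trans, GrpIsoOver.pullback_symm, ← GrpIsoOver.pullback_comp,
      ← GrpIsoOver.pullback_comp]
  ev_trans i j k T a b c := by
    change GrpIsoOver.trans _ _ = _
    rw [GrpIsoOver.trans_assoc, ← GrpIsoOver.trans_assoc _ _ ((φ i).pullback a),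
      GrpIsoOver.self_trans_symm, GrpIsoOver.refl_trans]

/-- `G'` is a form of `G` (étale-locally isomorphic to `G`), and `c ∈ H¹_ét(F, Aut(G))` is the
cohomology class that corresponds to this form. -/
def IsFormWithClass {F : Type u} [Field F] (G G' : Sch F) [GrpObj G] [GrpObj G']
    (c : H1et (autPresheaf G)) : Prop :=
  ∃ (𝒰 : EtaleCovering F) (φ : ∀ i, GrpIsoOver G' G (𝒰.U i)),
    c = Quot.mk _ ⟨𝒰, formCocycle φ⟩

/-- `G'` is a strongly inner form of `G`: a form of `G` whose class lies in the image of the map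
`H¹_ét(F, G) ⟶ H¹_ét(F, Aut(G))` induced by conjugation. -/
def IsStronglyInnerForm {F : Type u} [Field F] (G G' : Sch F) [GrpObj G] [GrpObj G'] : Prop :=
  ∃ c : H1et (autPresheaf G), IsFormWithClass G G' c ∧ c ∈ Set.range (H1et.map (conjHom G))

end Cohomology

noncomputable section Stacks

open AlgebraicGeometry Limits

variable {F : Type u} [Field F]

/-- `p : P ⟶ S` with the left action `act` of `G` is an (étale) `G`-torsor over `S`: the map
`(act, pr₂) : G × P ⟶ P ×_S P` is an isomorphism and, for some étale covering `c : S' ⟶ S`,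
the base change of `P` to `S'` is `G`-equivariantly isomorphic to `G × S'`. -/
structure IsTorsor {G P S : Sch F} [GrpObj G] (act : G ⊗ P ⟶ P) (p : P ⟶ S) : Prop where
  isAction : IsAction act
  isPullback : IsPullback act (snd G P) p p
  locallyTrivial : ∃ (S' : Sch F) (c : S' ⟶ S) (t : G ⊗ S' ⟶ P),
    Etale c.left ∧ Surjective c.left ∧ IsPullback t (snd G S') p c ∧
      ∀ {T : Sch F} (g h : T ⟶ G) (s : T ⟶ S'),
        lift (g * h) s ≫ t = lift g (lift h s ≫ t) ≫ act

/-- `p : P ⟶ S` with the right action `act` of `G` is an (étale) right `G`-torsor over `S`. -/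
structure IsRightTorsor {G P S : Sch F} [GrpObj G] (act : P ⊗ G ⟶ P) (p : P ⟶ S) : Prop where
  isRightAction : IsRightAction act
  isPullback : IsPullback act (fst P G) p p
  locallyTrivial : ∃ (S' : Sch F) (c : S' ⟶ S) (t : S' ⊗ G ⟶ P),
    Etale c.left ∧ Surjective c.left ∧ IsPullback t (fst S' G) p c ∧
      ∀ {T : Sch F} (s : T ⟶ S') (g h : T ⟶ G),
        lift s (g * h) ≫ t = lift (lift s g ≫ t) h ≫ act

/-- An object of the classifying stack `[G\pt]`: an `F`-scheme `S` with a left `G`-torsor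
`P ⟶ S`. -/
structure Torsor (G : Sch F) [GrpObj G] where
  base : Sch F
  total : Sch F
  proj : total ⟶ base
  act : G ⊗ total ⟶ total
  isTorsor : IsTorsor act proj

namespace Torsor

variable {G : Sch F} [GrpObj G]

/-- A morphism of `[G\pt]`: a cartesian square with `G`-equivariant upper arrow. -/
@[ext]
structure Hom (X Y : Torsor G) where
  base : X.base ⟶ Y.base
  total : X.total ⟶ Y.total
  isPullback : IsPullback total X.proj Y.proj base
  equivariant : X.act ≫ total = (G ◁ total) ≫ Y.act

instance : Category (Torsor G) where
  Hom := Hom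
  id X := ⟨𝟙 _, 𝟙 _, IsPullback.of_horiz_isIso ⟨by simp⟩, by simp⟩
  comp f g := ⟨f.base ≫ g.base, f.total ≫ g.total, f.isPullback.paste_horiz g.isPullback, by
    rw [← Category.assoc, f.equivariant, Category.assoc, g.equivariant]
    simp⟩

/-- The action of `G` on `G × T` by left multiplication on the first factor. -/
def trivialAct (G T : Sch F) [GrpObj G] : G ⊗ (G ⊗ T) ⟶ G ⊗ T :=
  lift (fst G (G ⊗ T) * (snd G (G ⊗ T) ≫ fst G T)) (snd G (G ⊗ T) ≫ snd G T)

lemma lift_trivialAct {T Z : Sch F} (g x : Z ⟶ G) (t : Z ⟶ T) :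
    lift g (lift x t) ≫ trivialAct G T = lift (g * x) t := by
  simp [trivialAct, comp_mul]

lemma isTorsor_trivialAct (G T : Sch F) [GrpObj G] : IsTorsor (trivialAct G T) (snd G T) where
  isAction :=
    { one_act := fun {Z} x => by
        obtain ⟨a, t, rfl⟩ : ∃ a t, x = lift a t := ⟨x ≫ fst _ _, x ≫ snd _ _, by simp⟩
        rw [lift_trivialAct, _root_.one_mul]
      mul_act := fun {Z} g h x => by
        obtain ⟨a, t, rfl⟩ : ∃ a t, x = lift a t := ⟨x ≫ fst _ _, x ≫ snd _ _, by simp⟩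
        rw [lift_trivialAct, lift_trivialAct, lift_trivialAct, _root_.mul_assoc] }
  isPullback := by
    refine ⟨⟨by simp [trivialAct]⟩, ⟨PullbackCone.IsLimit.mk _
      (fun s => lift ((s.fst ≫ fst G T) * (s.snd ≫ fst G T)⁻¹) s.snd) (fun s => ?_)
      (fun s => by simp) (fun s m h₁ h₂ => ?_)⟩⟩
    · have hs := s.condition
      ext1
      · simp [trivialAct, comp_mul]
      · simp [trivialAct, hs]
    · ext1
      · have := congrArg (· ≫ fst G T) h₁
        simp only [trivialAct, Category.assoc, lift_fst, comp_mul] at this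
        rw [← this, ← h₂]
        simp
      · simpa using h₂
  locallyTrivial := by
    refine ⟨T, 𝟙 T, 𝟙 _, ?_, ?_, IsPullback.of_horiz_isIso ⟨by simp⟩, fun g h s => ?_⟩
    · rw [Over.id_left]; infer_instance
    · rw [Over.id_left]; infer_instance
    · rw [Category.comp_id, Category.comp_id, lift_trivialAct]

/-- The trivial left `G`-torsor `G × T` over `T`; for the final object `T = Spec F` this
is `G_l`. -/
def trivial (G T : Sch F) [GrpObj G] : Torsor G :=
  ⟨T, G ⊗ T, snd G T, trivialAct G T, isTorsor_trivialAct G T⟩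

/-- The morphism `G × T ⟶ G × Spec F`, `(x, t) ↦ x * g(t)`. -/
def translateMap {T : Sch F} (g : T ⟶ G) : G ⊗ T ⟶ G ⊗ 𝟙_ (Sch F) :=
  lift (fst G T * (snd G T ≫ g)) (toUnit _)

lemma isPullback_translateMap {T : Sch F} (g : T ⟶ G) :
    IsPullback (translateMap g) (snd G T) (snd G (𝟙_ (Sch F))) (toUnit T) := by
  refine ⟨⟨toUnit_unique _ _⟩, ⟨PullbackCone.IsLimit.mk _
    (fun s => lift ((s.fst ≫ fst G _) * (s.snd ≫ g)⁻¹) s.snd) (fun s => ?_)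
    (fun s => lift_snd _ _) (fun s m h₁ h₂ => ?_)⟩⟩
  · ext1
    · simp [translateMap, comp_mul]
    · exact toUnit_unique _ _
  · ext1
    · have := congrArg (· ≫ fst G _) h₁
      simp only [translateMap, Category.assoc, lift_fst, comp_mul] at this
      rw [← this, ← h₂]
      simp
    · simpa using h₂

lemma trivialAct_translateMap {T : Sch F} (g : T ⟶ G) :
    trivialAct G T ≫ translateMap g = (G ◁ translateMap g) ≫ trivialAct G (𝟙_ (Sch F)) := by
  ext1
  · simp [trivialAct, translateMap, comp_mul, _root_.mul_assoc]
  · exact toUnit_unique _ _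

/-- For `g ∈ G(T)`, right translation by `g` as a morphism from the trivial torsor over `T` to the
trivial torsor over `Spec F`: `(x, t) ↦ x * g(t)`. For `g = 1` this is the canonical morphism which
identifies `G × T` with the restriction of `G_l` to `T`. -/
def translate {T : Sch F} (g : T ⟶ G) : trivial G T ⟶ trivial G (𝟙_ (Sch F)) where
  base := toUnit T
  total := translateMap g
  isPullback := isPullback_translateMap g
  equivariant := trivialAct_translateMap g

end Torsor

/-- The classifying stack `[G\pt]` of `G`, as a category over the category of `F`-schemes. -/
def classifyingStack (G : Sch F) [GrpObj G] : BasedCategory.{u, u + 1} (Sch F) where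
  obj := Torsor G
  p :=
    { obj := fun X => X.base
      map := fun {X Y} (f : Torsor.Hom X Y) => f.base }

/-- A morphism of categories over `Sch F` (in particular, of stacks) is an equivalence if it has a
quasi-inverse over `Sch F`. -/
def IsStackEquivalence {𝒳 𝒴 : BasedCategory.{u, u + 1} (Sch F)} (Φ : BasedFunctor 𝒳 𝒴) : Prop :=
  ∃ Ψ : BasedFunctor 𝒴 𝒳,
    Nonempty (Φ.comp Ψ ≅ BasedFunctor.id 𝒳) ∧ Nonempty (Ψ.comp Φ ≅ BasedFunctor.id 𝒴)

/-- The groupoid of invertible morphisms of stacks `𝒳 ⟶ 𝒴`, with the natural transformations over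
`Sch F` between them. -/
abbrev InvertibleMorphisms (𝒳 𝒴 : BasedCategory.{u, u + 1} (Sch F)) :=
  ObjectProperty.FullSubcategory (fun Φ : BasedFunctor 𝒳 𝒴 => IsStackEquivalence Φ)

/-- An `(H, G)`-bitorsor over `Spec F`: an `F`-scheme which is a left `H`-torsor and a right
`G`-torsor for commuting actions. -/
structure Bitorsor (H G : Sch F) [GrpObj H] [GrpObj G] where
  carrier : Sch F
  left : H ⊗ carrier ⟶ carrier
  right : carrier ⊗ G ⟶ carrier
  isTorsor : IsTorsor left (toUnit carrier)
  isRightTorsor : IsRightTorsor right (toUnit carrier)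
  comm : ∀ {T : Sch F} (h : T ⟶ H) (x : T ⟶ carrier) (g : T ⟶ G),
    lift (lift h x ≫ left) g ≫ right = lift h (lift x g ≫ right) ≫ left

namespace Bitorsor

variable {H G : Sch F} [GrpObj H] [GrpObj G]

/-- An isomorphism of bitorsors: an isomorphism of schemes which is equivariant on both sides. -/
@[ext]
structure Hom (P Q : Bitorsor H G) where
  iso : P.carrier ≅ Q.carrier
  left_equivariant : P.left ≫ iso.hom = (H ◁ iso.hom) ≫ Q.left
  right_equivariant : P.right ≫ iso.hom = (iso.hom ▷ G) ≫ Q.right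

/-- The category (a groupoid) of `(H, G)`-bitorsors over `F` and isomorphisms between them. -/
instance : Category (Bitorsor H G) where
  Hom := Hom
  id P := ⟨Iso.refl _, by simp, by simp⟩
  comp f g := ⟨f.iso ≪≫ g.iso, by
    rw [Iso.trans_hom, ← Category.assoc, f.left_equivariant, Category.assoc, g.left_equivariant]
    simp, by
    rw [Iso.trans_hom, ← Category.assoc, f.right_equivariant, Category.assoc, g.right_equivariant]
    simp⟩
  id_comp _ := Hom.ext (Iso.refl_trans _)
  comp_id _ := Hom.ext (Iso.trans_refl _)
  assoc _ _ _ := Hom.ext (Iso.trans_assoc _ _ _)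

/-- The left action `g • (p, x) = (p g⁻¹, g x)` of `G` on `P × X`, for a bitorsor `P` and a left
`G`-torsor `X`. -/
def diagonalAct (P : Bitorsor H G) (X : Torsor G) :
    G ⊗ (P.carrier ⊗ X.total) ⟶ P.carrier ⊗ X.total :=
  lift
    (lift (snd G (P.carrier ⊗ X.total) ≫ fst P.carrier X.total)
      (fst G (P.carrier ⊗ X.total))⁻¹ ≫ P.right)
    (lift (fst G (P.carrier ⊗ X.total))
      (snd G (P.carrier ⊗ X.total) ≫ snd P.carrier X.total) ≫ X.act)

/-- The `H`-torsor `Y`, over the same base as the `G`-torsor `X`, is the balanced product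
`P ×_{/G} X = G \ (P × X)`, with quotient morphism `q : P × X ⟶ Y`: the morphism `q` is a `G`-torsor
for the diagonal action `(p, x) ↦ (p g⁻¹, g x)`, and the `H`-action and the projection to the
base are induced by those of `P` and `X`. -/
structure IsBalancedProduct (P : Bitorsor H G) (X : Torsor G) (Y : Torsor H)
    (hb : Y.base = X.base) (q : P.carrier ⊗ X.total ⟶ Y.total) : Prop where
  quotient : IsTorsor (P.diagonalAct X) q
  proj : q ≫ Y.proj ≫ eqToHom hb = snd P.carrier X.total ≫ X.proj
  equivariant : (P.left ▷ X.total) ≫ q = (α_ H P.carrier X.total).hom ≫ (H ◁ q) ≫ Y.act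

end Bitorsor

variable {G H : Sch F} [GrpObj G] [GrpObj H]

/-- The functor `E` is given by `Φ ↦ Φ(G_l)`, naturally in `Φ`. Here `Φ(G_l)` carries its left
`H`-action and the right `G`-action induced by functoriality from the right translations of `G_l`:
a point `g ∈ G(T)` acts on `Φ(G_l)|_T`, which is identified with `Φ(G × T)` by
`Φ (translate 1)`, through the image under `Φ` of the right translation by `g`. -/
structure EvaluationAtTrivialTorsor
    (E : InvertibleMorphisms (classifyingStack G) (classifyingStack H) ⥤ Bitorsor H G) where
  iso : ∀ Φ, (E.obj Φ).carrier ≅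
    Torsor.total (Φ.obj.obj (Torsor.trivial G (𝟙_ (Sch F))) : Torsor H)
  left_equivariant : ∀ Φ, (E.obj Φ).left ≫ (iso Φ).hom =
    (H ◁ (iso Φ).hom) ≫ Torsor.act (Φ.obj.obj (Torsor.trivial G (𝟙_ (Sch F))) : Torsor H)
  right_action : ∀ Φ {T : Sch F} (g : T ⟶ G),
    lift (Torsor.Hom.total (Φ.obj.map (Torsor.translate (1 : T ⟶ G))) ≫ (iso Φ).inv)
        (Torsor.proj (Φ.obj.obj (Torsor.trivial G T) : Torsor H) ≫
          eqToHom (Φ.obj.w_obj (Torsor.trivial G T)) ≫ g) ≫ (E.obj Φ).right =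
      Torsor.Hom.total (Φ.obj.map (Torsor.translate g)) ≫ (iso Φ).inv
  naturality : ∀ {Φ Φ'} (f : Φ ⟶ Φ'), (E.map f).iso.hom ≫ (iso Φ').hom =
    (iso Φ).hom ≫ Torsor.Hom.total (f.hom.app (Torsor.trivial G (𝟙_ (Sch F))))

/-- The functor `Q` is given by `P ↦ P ×_{/G} (-)`, naturally in `P` and in the `G`-torsor that is
inserted. -/
structure BalancedProductFunctor
    (Q : Bitorsor H G ⥤ InvertibleMorphisms (classifyingStack G) (classifyingStack H)) where
  quot : ∀ (P : Bitorsor H G) (X : Torsor G),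
    P.carrier ⊗ X.total ⟶ Torsor.total ((Q.obj P).obj.obj X : Torsor H)
  isBalancedProduct : ∀ (P : Bitorsor H G) (X : Torsor G),
    P.IsBalancedProduct X ((Q.obj P).obj.obj X) ((Q.obj P).obj.w_obj X) (quot P X)
  naturality_right : ∀ (P : Bitorsor H G) {X X' : Torsor G} (f : X ⟶ X'),
    (P.carrier ◁ f.total) ≫ quot P X' =
      quot P X ≫ Torsor.Hom.total ((Q.obj P).obj.map f)
  naturality_left : ∀ {P P' : Bitorsor H G} (f : P ⟶ P') (X : Torsor G),
    (f.iso.hom ▷ X.total) ≫ quot P' X =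
      quot P X ≫ Torsor.Hom.total ((Q.map f).hom.app X)

end Stacks

end StrongInner

/-!
A morphism of stacks `Φ : [G\pt] ⟶ [H\pt]` is determined by its value `P = Φ(G_l)` at the trivial
torsor. Indeed, a point `x` of a `G`-torsor `X` is the same as a morphism `g ↦ g x` from the trivial
torsor to `X`, and applying `Φ` to it gives a morphism from `P` to `Φ(X)`. Together these form a
pairing `P × X ⟶ Φ(X)` (`StackMap.pair`), which is balanced for the right action of `G` on `P` that
comes from right translations, and which is a quotient by the diagonal action of `G`
(`StackMap.isTorsor_pairing`). Hence natural transformations are determined by their value at `G_l`,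
and every biequivariant isomorphism of the values descends along the pairings to a natural
transformation (`StackMap.exists_nat`). If `Φ` is fully faithful, then `P` is a right `G`-torsor: two
points of `P` differ by a unique automorphism of the trivial torsor, that is, by a right translation.
So `evaluation` is a fully faithful functor to bitorsors.

It is essentially surjective because of the balanced product functors `Φ_P`. The existence of
`P ×_{/G} X` (`Bitorsor.exists_isBalancedProduct`) is a matter of descent. Over an affine étale
covering `U` of the point there is a section `σ` of `P`, with `σ(v) = σ(u) ρ(u, v)` for a cocycle `ρ`,
and the balanced product is the twist of `X` by `ρ` (`exists_twist`): the quotient of `U × X` in which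
`(v, x)` is identified with `(u, ρ(u, v) x)`. Since `X` is affine over its base, this descent is
effective (`exists_isDescent`): over an affine open subscheme of the base it is descent of algebras
along the ring of functions of `U`, which is flat over the field, and the results are glued. That `X`
is affine over its base uses descent of affineness (`isAffineHom_descendsAlong`). The functor attached
to the opposite bitorsor is a quasi-inverse of `Φ_P`, through the isomorphism `x ↦ [p, [p, x]]`, which
does not depend on `p` (`Bitorsor.exists_iso_comp`), and `p ↦ [p, 1]` identifies `P` with `Φ_P(G_l)`.

For strongly inner forms, a section `σ` of a bitorsor over `U` yields the isomorphism `φ` from `H` to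
`G` over `U` with `h σ = σ φ(h)`, and `φ_u` and `φ_v` differ by conjugation with the cocycle `ρ(u, v)`
of `σ`. This says that the class of `H` is the image of the class of `ρ`. Conversely, a strongly inner
form provides such `ρ` and `φ` on a single covering (`isStronglyInnerForm_iff`), because the spectrum
of a field is a point and because equality in the cohomology set can be absorbed in the local
isomorphisms; the twist of `G` by `ρ` is then a bitorsor, with `G` acting by right multiplication and
`H` by left multiplication through `φ`. Only one of the two strongly inner relations is needed for
this, and the other one follows with the opposite bitorsor.

Schemes are handled through their generalised points throughout, and properties of points are checked
after passing to an étale covering (`HasLocalSections`).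
-/

namespace StrongInner

universe v u

/-! ### Étale coverings -/

section Coverings

open AlgebraicGeometry Limits

variable {F : Type u} [Field F]

/-- A covering for the étale topology: a single étale surjective morphism of `F`-schemes. -/
structure IsCov {T' T : Sch F} (c : T' ⟶ T) : Prop where
  etale : Etale c.left
  surjective : Surjective c.left

namespace IsCov

lemma of_isIso {T' T : Sch F} (c : T' ⟶ T) [IsIso c] : IsCov c := by
  have : IsIso c.left := inferInstanceAs (IsIso ((Over.forget _).map c))
  exact ⟨inferInstance, inferInstance⟩

lemma comp {T'' T' T : Sch F} {d : T'' ⟶ T'} {c : T' ⟶ T} (hd : IsCov d) (hc : IsCov c) :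
    IsCov (d ≫ c) := by
  have := hd.1; have := hd.2; have := hc.1; have := hc.2
  constructor <;> rw [Over.comp_left] <;> infer_instance

lemma of_isPullback {P X Y Z : Sch F} {fst : P ⟶ X} {snd : P ⟶ Y} {f : X ⟶ Z} {c : Y ⟶ Z}
    (h : IsPullback fst snd f c) (hc : IsCov c) : IsCov fst := by
  have h' : IsPullback fst.left snd.left f.left c.left := h.map (Over.forget _)
  exact ⟨MorphismProperty.of_isPullback h'.flip hc.1, MorphismProperty.of_isPullback h'.flip hc.2⟩

lemma pullback_fst {X Y Z : Sch F} (f : X ⟶ Z) {c : Y ⟶ Z} (hc : IsCov c) :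
    IsCov (pullback.fst f c) :=
  hc.of_isPullback (IsPullback.of_hasPullback f c)

/-- The product `T × U ⟶ T` with a covering `U` of the point. -/
lemma fst {U : Sch F} (hU : IsCov (toUnit U)) (T : Sch F) : IsCov (fst T U) := by
  refine of_isPullback (f := toUnit T) (c := toUnit U) (snd := snd T U) ?_ hU
  refine ⟨⟨toUnit_unique _ _⟩, ⟨PullbackCone.IsLimit.mk _ (fun s => lift s.fst s.snd)
    (fun s => by simp) (fun s => by simp) (fun s m h₁ h₂ => ?_)⟩⟩
  ext1 <;> simp [h₁, h₂]

lemma epi {T' T : Sch F} {c : T' ⟶ T} (hc : IsCov c) : Epi c := by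
  have := hc.1; have := hc.2
  exact (Over.forget _).epi_of_epi_map (inferInstanceAs (Epi c.left))

lemma hom_ext {T' T Z : Sch F} {c : T' ⟶ T} (hc : IsCov c) {f g : T ⟶ Z}
    (h : c ≫ f = c ≫ g) : f = g := by
  have := hc.epi
  exact (cancel_epi c).mp h

/-- Morphisms descend along coverings. -/
lemma exists_desc {T' T Z : Sch F} {c : T' ⟶ T} (hc : IsCov c) (f : T' ⟶ Z)
    (hf : ∀ {W : Sch F} (a b : W ⟶ T'), a ≫ c = b ≫ c → a ≫ f = b ≫ f) :
    ∃ g : T ⟶ Z, c ≫ g = f := by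
  have := hc.1; have := hc.2
  have key : ∀ {W : Scheme.{u}} (a b : W ⟶ T'.left), a ≫ c.left = b ≫ c.left →
      a ≫ f.left = b ≫ f.left := by
    intro W a b hab
    have hw : b ≫ T'.hom = a ≫ T'.hom := by
      rw [← Over.w c, ← Category.assoc, ← hab, Category.assoc]
    have := hf (W := Over.mk (a ≫ T'.hom)) (Over.homMk a rfl) (Over.homMk b hw)
      (by ext1; exact hab)
    exact congrArg (·.left) this
  refine ⟨Over.homMk (EffectiveEpi.desc c.left f.left key) ?_, ?_⟩
  · rw [← cancel_epi c.left, EffectiveEpi.fac_assoc, Over.w, Over.w]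
  · ext1
    exact EffectiveEpi.fac c.left f.left key

end IsCov

/-- A commutative square is cartesian if the induced map into the fibre product is injective on
points and locally surjective. -/
lemma isPullback_of_locally {P X Y Z : Sch F} {p : P ⟶ X} {q : P ⟶ Y} {f : X ⟶ Z} {g : Y ⟶ Z}
    (w : p ≫ f = q ≫ g)
    (inj : ∀ {T : Sch F} (a b : T ⟶ P), a ≫ p = b ≫ p → a ≫ q = b ≫ q → a = b)
    (surj : ∀ {T : Sch F} (x : T ⟶ X) (y : T ⟶ Y), x ≫ f = y ≫ g →
      ∃ (T' : Sch F) (c : T' ⟶ T) (a : T' ⟶ P), IsCov c ∧ a ≫ p = c ≫ x ∧ a ≫ q = c ≫ y) :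
    IsPullback p q f g := by
  have key : ∀ {T : Sch F} (x : T ⟶ X) (y : T ⟶ Y), x ≫ f = y ≫ g →
      ∃ a : T ⟶ P, a ≫ p = x ∧ a ≫ q = y := by
    intro T x y h
    obtain ⟨T', c, a, hc, h₁, h₂⟩ := surj x y h
    obtain ⟨b, hb⟩ := hc.exists_desc a fun s t hst =>
      inj _ _ (by simp [h₁, reassoc_of% hst]) (by simp [h₂, reassoc_of% hst])
    exact ⟨b, hc.hom_ext (by rw [reassoc_of% hb, h₁]), hc.hom_ext (by rw [reassoc_of% hb, h₂])⟩
  refine ⟨⟨w⟩, ⟨PullbackCone.IsLimit.mk _ (fun s => (key s.fst s.snd s.condition).choose)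
    (fun s => (key s.fst s.snd s.condition).choose_spec.1)
    (fun s => (key s.fst s.snd s.condition).choose_spec.2) (fun s m h₁ h₂ => ?_)⟩⟩
  refine inj _ _ ?_ ?_
  · rw [h₁, (key s.fst s.snd s.condition).choose_spec.1]
  · rw [h₂, (key s.fst s.snd s.condition).choose_spec.2]

/-- An affine open neighbourhood of any point of an étale `F`-scheme covers the point `Spec F`. -/
lemma exists_affine_cov {U : Sch F} [Etale U.hom] (x : U.left) :
    ∃ (V : Sch F) (_ : V ⟶ U), IsAffine V.left ∧ IsCov (toUnit V) := by
  obtain ⟨_, ⟨W, hW, rfl⟩, hxW, -⟩ := U.left.isBasis_affineOpens.exists_subset_of_mem_open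
    (Set.mem_univ x) isOpen_univ
  refine ⟨Over.mk (Scheme.Opens.ι W ≫ U.hom), Over.homMk (Scheme.Opens.ι W) rfl, hW, ?_, ?_⟩
  · change Etale (toUnit (Over.mk (Scheme.Opens.ι W ≫ U.hom))).left
    rw [Over.toUnit_left]
    dsimp
    infer_instance
  · rw [Over.toUnit_left]
    refine ⟨fun y => ⟨⟨x, hxW⟩, ?_⟩⟩
    exact Subsingleton.elim (α := PrimeSpectrum F) _ _

lemma IsCov.exists_affine {U : Sch F} (hU : IsCov (toUnit U)) :
    ∃ (V : Sch F) (_ : V ⟶ U), IsAffine V.left ∧ IsCov (toUnit V) := by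
  have h := hU.1
  rw [Over.toUnit_left] at h
  obtain ⟨x, -⟩ := hU.2.1 (⊥ : PrimeSpectrum F)
  exact exists_affine_cov x

end Coverings

/-! ### Affineness is local for the étale topology -/

section AffineDescent
open AlgebraicGeometry Limits MorphismProperty

/-- Surjectivity, as a property of morphisms of schemes. -/
abbrev surjProp : MorphismProperty Scheme.{u} := @Surjective

/-- Flatness, as a property of morphisms of schemes. -/
abbrev flatProp : MorphismProperty Scheme.{u} := @Flat

/-- Quasi-compactness, as a property of morphisms of schemes. -/
abbrev qcProp : MorphismProperty Scheme.{u} := @QuasiCompact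

/-- Affineness, as a property of morphisms of schemes. -/
abbrev affineProp : MorphismProperty Scheme.{u} := @IsAffineHom

/-- Being locally of finite presentation, as a property of morphisms of schemes. -/
abbrev lfpProp : MorphismProperty Scheme.{u} := @LocallyOfFinitePresentation

instance : IsZariskiLocalAtTarget qcProp.{u} :=
  @HasAffineProperty.instIsZariskiLocalAtTarget qcProp (fun X _ _ _ ↦ CompactSpace X) (by
    exact instHasAffinePropertyQuasiCompactCompactSpaceCarrierCarrierCommRingCat)

instance : IsZariskiLocalAtTarget affineProp.{u} :=
  @HasAffineProperty.instIsZariskiLocalAtTarget affineProp (fun X _ _ _ ↦ IsAffine X) (by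
    exact instHasAffinePropertyIsAffineHomIsAffine)

/-- Quasi-compactness descends along faithfully flat quasi-compact morphisms, because a space with a
surjection from a compact space is compact. -/
instance quasiCompact_descendsAlong :
    DescendsAlong qcProp.{u} (surjProp ⊓ flatProp ⊓ qcProp) := by
  refine IsZariskiLocalAtTarget.descendsAlong_inf_quasiCompact _ _ ?_ ?_
  · intro X Y f hf
    exact ⟨hf.2, IsLocalIso.le_of_isZariskiLocalAtSource flatProp _ _ _ hf.1⟩
  intro R S Y φ g ⟨_, _⟩ h
  have : CompactSpace (pullback (Spec.map φ) g : Scheme) :=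
    (quasiCompact_iff_compactSpace (pullback.fst (Spec.map φ) g)).mp h
  have : Surjective (pullback.snd (Spec.map φ) g) := inferInstance
  rw [show qcProp g ↔ QuasiCompact g from Iff.rfl, quasiCompact_iff_compactSpace]
  exact Function.Surjective.compactSpace (pullback.snd (Spec.map φ) g).continuous
    (pullback.snd (Spec.map φ) g).surjective

instance quasiSeparated_descendsAlong :
    DescendsAlong (MorphismProperty.diagonal qcProp.{u}) (surjProp ⊓ flatProp ⊓ qcProp) :=
  inferInstance

/-- Affineness descends along faithfully flat quasi-compact morphisms: for affine bases, the canonical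
morphism from the source to the spectrum of its global sections becomes an isomorphism after the base
change, because global sections commute with flat base change. -/
instance isAffineHom_descendsAlong :
    DescendsAlong affineProp.{u} (surjProp ⊓ flatProp ⊓ qcProp) := by
  refine IsZariskiLocalAtTarget.descendsAlong_inf_quasiCompact _ _ ?_ ?_
  · intro X Y f hf
    exact ⟨hf.2, IsLocalIso.le_of_isZariskiLocalAtSource flatProp _ _ _ hf.1⟩
  intro R S Y φ g ⟨h₁, h₂⟩ h
  have hQ : (surjProp ⊓ flatProp ⊓ qcProp) (Spec.map φ) :=
    ⟨⟨h₁, h₂⟩, inferInstance⟩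
  have : IsAffineHom (pullback.fst (Spec.map φ) g) := h
  have : QuasiCompact g := of_pullback_fst_of_descendsAlong (P := qcProp) hQ
    (show QuasiCompact (pullback.fst (Spec.map φ) g) from inferInstance)
  have : QuasiSeparated g := (quasiSeparated_iff g).mpr <| of_pullback_fst_of_descendsAlong
    (P := MorphismProperty.diagonal qcProp) hQ
    ((quasiSeparated_iff (pullback.fst (Spec.map φ) g)).mp inferInstance)
  have : CompactSpace Y := (quasiCompact_iff_compactSpace g).mp inferInstance
  have : QuasiSeparatedSpace Y := (quasiSeparated_iff_quasiSeparatedSpace g).mp inferInstance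
  have : IsAffine (pullback (Spec.map φ) g) := isAffine_of_isAffineHom (pullback.fst (Spec.map φ) g)
  have sq : IsPullback (pullback.snd (Spec.map φ) g) (pullback.fst (Spec.map φ) g) g (Spec.map φ) :=
    (IsPullback.of_hasPullback _ _).flip
  have po := (isIso_pushoutSection_iff sq (US := ⊤) (UT := ⊤) (UX := ⊤) (UY := ⊤) le_rfl le_rfl
    (by simp)).mp (isIso_pushoutSection_of_isQuasiSeparated_of_flat_right _ _ _ _
      (isAffineOpen_top _) (isAffineOpen_top _) isCompact_univ isQuasiSeparated_univ)
  have pb : IsPullback (Spec.map (pullback.fst (Spec.map φ) g).appTop)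
      (Spec.map (pullback.snd (Spec.map φ) g).appTop) (Spec.map (Spec.map φ).appTop)
      (Spec.map g.appTop) := by
    simpa [Scheme.Hom.appTop, Scheme.Hom.app_eq_appLE] using po.op.map Scheme.Spec
  have sq' := sq.flip.paste_horiz (IsPullback.of_horiz_isIso
    ⟨(Scheme.toSpecΓ_naturality (Spec.map φ)).symm⟩)
  rw [Scheme.toSpecΓ_naturality, Scheme.toSpecΓ_naturality] at sq'
  have sq'' := IsPullback.of_right sq' (Scheme.toSpecΓ_naturality _).symm pb
  -- `sq''` exhibits the isomorphism `toSpecΓ` of the affine pullback as a base change of `Y.toSpecΓ`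
  have : IsIso Y.toSpecΓ := by
    have hQ' : (surjProp ⊓ flatProp ⊓ qcProp)
        (Spec.map (pullback.snd (Spec.map φ) g).appTop) := by
      refine MorphismProperty.of_isPullback pb ?_
      have e : Spec.map (Spec.map φ).appTop =
          inv (Scheme.toSpecΓ _) ≫ Spec.map φ ≫ Scheme.toSpecΓ _ := by
        rw [Scheme.toSpecΓ_naturality, IsIso.inv_hom_id_assoc]
      rw [e]
      exact ⟨⟨inferInstance, inferInstance⟩, inferInstance⟩
    exact MorphismProperty.of_isPullback_of_descendsAlong
      (P := MorphismProperty.isomorphisms Scheme.{u}) sq'' hQ'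
      (show IsIso (Scheme.toSpecΓ _) from inferInstance)
  have : IsAffine Y := ⟨this⟩
  infer_instance

/-- Affineness of a morphism may be checked after base change along a covering. -/
lemma IsCov.isAffineHom {F : Type u} [Field F] {P X Y Z : Sch F} {p : P ⟶ X} {q : P ⟶ Y}
    {f : X ⟶ Z} {c : Y ⟶ Z} (h : IsPullback p q f c) (hc : IsCov c) (hq : IsAffineHom q.left) :
    IsAffineHom f.left := by
  have h' : IsPullback p.left q.left f.left c.left := h.map (Over.forget _)
  have := hc.1; have := hc.2
  exact MorphismProperty.of_isPullback_of_descendsAlong (P := affineProp)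
    (Q := surjProp ⊓ flatProp ⊓ lfpProp) h'.flip
    ⟨⟨inferInstance, inferInstance⟩, inferInstance⟩ hq

end AffineDescent

/-! ### Descent data relative to a covering of the point -/

section Twist

section Abstract

variable {C : Type u} [Category.{v} C] [CartesianMonoidalCategory C]

/-- Two morphisms from a product agree if they agree on pairs of generalised points. -/
lemma hom_ext_point₂ {X Y Z : C} {f g : X ⊗ Y ⟶ Z}
    (h : ∀ {T : C} (x : T ⟶ X) (y : T ⟶ Y), lift x y ≫ f = lift x y ≫ g) : f = g := by
  simpa using h (fst X Y) (snd X Y)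

/-- Two morphisms from a triple product agree if they agree on triples of generalised points. -/
lemma hom_ext_point₃ {X Y Z W : C} {f g : X ⊗ (Y ⊗ Z) ⟶ W}
    (h : ∀ {T : C} (x : T ⟶ X) (y : T ⟶ Y) (z : T ⟶ Z),
      lift x (lift y z) ≫ f = lift x (lift y z) ≫ g) : f = g :=
  hom_ext_point₂ fun x y => by simpa using h x (y ≫ fst _ _) (y ≫ snd _ _)

/-- A descent datum on `U × X` relative to `U ⟶ pt`: the point `lift u (lift v x) ≫ act` is the
transport of `x` from the fibre over `v` to the fibre over `u`. -/
structure IsTransport {U X : C} (θ : U ⊗ (U ⊗ X) ⟶ X) : Prop where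
  self : ∀ {T : C} (u : T ⟶ U) (x : T ⟶ X), lift u (lift u x) ≫ θ = x
  comp : ∀ {T : C} (u v w : T ⟶ U) (x : T ⟶ X),
    lift u (lift v (lift v (lift w x) ≫ θ)) ≫ θ = lift u (lift w x) ≫ θ

/-- `π : U × X ⟶ Y` exhibits `Y` as the object obtained from `X` by descent along the transport `θ`:
`π (v, x) = π (u, θ (u, v, x))`, and `(u, x) ↦ (π (u, x), u)` is an isomorphism from `U × X` to
`Y × U`. -/
structure IsDescent {U X Y : C} (θ : U ⊗ (U ⊗ X) ⟶ X) (π : U ⊗ X ⟶ Y) : Prop where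
  transport : ∀ {T : C} (u v : T ⟶ U) (x : T ⟶ X),
    lift u (lift u (lift v x) ≫ θ) ≫ π = lift v x ≫ π
  isPullback : IsPullback π (fst U X) (toUnit Y) (toUnit U)

lemma isPullback_toUnit_of_isIso {U W Y : C} {π : W ⟶ Y} {p : W ⟶ U} [h : IsIso (lift p π)] :
    IsPullback π p (toUnit Y) (toUnit U) := by
  refine ⟨⟨toUnit_unique _ _⟩, ⟨Limits.PullbackCone.IsLimit.mk _
    (fun s => lift s.snd s.fst ≫ inv (lift p π)) (fun s => ?_) (fun s => ?_)
    (fun s m h₁ h₂ => ?_)⟩⟩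
  · have : inv (lift p π) ≫ π = snd U Y := by rw [IsIso.inv_comp_eq, lift_snd]
    rw [Category.assoc, this, lift_snd]
  · have : inv (lift p π) ≫ p = fst U Y := by rw [IsIso.inv_comp_eq, lift_fst]
    rw [Category.assoc, this, lift_fst]
  · rw [IsIso.eq_comp_inv, comp_lift, h₁, h₂]

/-- The first projection and the transported projection of `U × U × X` have the split coequalizer
`U × X` after a further product with `U`; hence a coequalizer `π` that is preserved by this product
is a solution of the descent problem. -/
lemma IsTransport.isDescent {U X Y : C} {θ : U ⊗ (U ⊗ X) ⟶ X} (h : IsTransport θ)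
    {π : U ⊗ X ⟶ Y} (w : snd U (U ⊗ X) ≫ π = lift (fst U (U ⊗ X)) θ ≫ π)
    [Epi (U ◁ π)]
    (hdesc : ∀ {Z : C} (f : U ⊗ (U ⊗ X) ⟶ Z),
      (U ◁ snd U (U ⊗ X)) ≫ f = (U ◁ lift (fst U (U ⊗ X)) θ) ≫ f → ∃ g, (U ◁ π) ≫ g = f) :
    IsDescent θ π := by
  have tr : ∀ {T : C} (u v : T ⟶ U) (x : T ⟶ X),
      lift u (lift u (lift v x) ≫ θ) ≫ π = lift v x ≫ π := by
    intro T u v x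
    have := lift u (lift v x) ≫= w
    simpa [comp_lift_assoc] using this.symm
  obtain ⟨g, hg⟩ := hdesc (lift (fst U (U ⊗ X)) θ) (by
    refine hom_ext_point₃ fun u v y => ?_
    obtain ⟨w, x, rfl⟩ : ∃ w x, y = lift w x := ⟨y ≫ fst _ _, y ≫ snd _ _, by simp⟩
    simp [h.comp u v w x])
  have : IsIso (lift (fst U X) π) := by
    refine ⟨g, ?_, ?_⟩
    · have e : lift (fst U X) π = lift (fst U X) (𝟙 _) ≫ (U ◁ π) := by simp
      rw [e, Category.assoc, hg]
      ext1
      · simp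
      · have := h.self (fst U X) (snd U X)
        simpa using this
    · rw [← cancel_epi (U ◁ π), reassoc_of% hg]
      ext1
      · simp
      · have := tr (fst U (U ⊗ X)) (snd U (U ⊗ X) ≫ fst U X) (snd U (U ⊗ X) ≫ snd U X)
        simpa [comp_lift_assoc] using this
  exact ⟨tr, isPullback_toUnit_of_isIso⟩

end Abstract
end Twist

/-! ### Effective descent for affine schemes -/

section Affine
open AlgebraicGeometry Limits Opposite

/-- Over a base whose algebras are flat, every transport between affine schemes is solved by the
equalizer of the two coaction maps, because products with `U` preserve this equalizer. -/
lemma exists_isDescent_commAlgCat {F : Type u} [CommRing F]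
    [∀ L : CommAlgCat.{u} F, Module.Flat F L] {U X : (CommAlgCat.{u} F)ᵒᵖ}
    {θ : U ⊗ (U ⊗ X) ⟶ X} (h : IsTransport θ) :
    ∃ (Y : (CommAlgCat.{u} F)ᵒᵖ) (π : U ⊗ X ⟶ Y), IsDescent θ π := by
  let d₀ : (U ⊗ X).unop ⟶ (U ⊗ (U ⊗ X)).unop := (snd U (U ⊗ X)).unop
  let d₁ : (U ⊗ X).unop ⟶ (U ⊗ (U ⊗ X)).unop := (lift (fst U (U ⊗ X)) θ).unop
  let E := AlgHom.equalizer d₀.hom d₁.hom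
  let π : U ⊗ X ⟶ op (CommAlgCat.of F E) := Quiver.Hom.op (CommAlgCat.ofHom E.val)
  have hπ (x : TensorProduct F U.unop E) : (U ◁ π).unop.hom x =
    (AlgHom.tensorEqualizerEquiv F U.unop d₀.hom d₁.hom x).1 := by
    exact (AlgHom.coe_tensorEqualizer F U.unop d₀.hom d₁.hom x).symm
  refine ⟨_, π, ?_⟩
  have : Epi (U ◁ π) := by
    have : Mono (U ◁ π).unop := by
      refine ConcreteCategory.mono_of_injective _ fun x y hxy => ?_
      refine (AlgHom.tensorEqualizerEquiv F U.unop d₀.hom d₁.hom).injective ?_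
      apply Subtype.ext
      rw [← hπ, ← hπ]
      exact hxy
    exact inferInstanceAs (Epi (U ◁ π).unop.op)
  refine h.isDescent ?_ ?_
  · apply Quiver.Hom.unop_inj
    apply CommAlgCat.hom_ext
    ext x
    exact x.2
  · intro Z f hf
    have hf' (z : Z.unop) :
        Algebra.TensorProduct.map (AlgHom.id F U.unop) d₀.hom (f.unop.hom z) =
          Algebra.TensorProduct.map (AlgHom.id F U.unop) d₁.hom (f.unop.hom z) :=
      ConcreteCategory.congr_hom (congrArg Quiver.Hom.unop hf) z
    let e := AlgHom.tensorEqualizerEquiv F U.unop d₀.hom d₁.hom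
    let k : Z.unop →ₐ[F] AlgHom.equalizer (Algebra.TensorProduct.map (AlgHom.id F U.unop) d₀.hom)
      (Algebra.TensorProduct.map (AlgHom.id F U.unop) d₁.hom) :=
      AlgHom.codRestrict f.unop.hom _ hf'
    refine ⟨Quiver.Hom.op (CommAlgCat.ofHom (e.symm.toAlgHom.comp k)), ?_⟩
    apply Quiver.Hom.unop_inj
    apply CommAlgCat.hom_ext
    ext z
    refine (hπ (e.symm (k z))).trans ?_
    rw [AlgEquiv.apply_symm_apply]
    rfl

lemma map_tensor_hom_ext {C : Type*} [Category* C] [CartesianMonoidalCategory C]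
    {D : Type*} [Category* D] [CartesianMonoidalCategory D] (Φ : C ⥤ D) [Φ.Monoidal] {A B : C}
    {T : D} {f g : T ⟶ Φ.obj (A ⊗ B)} (h₁ : f ≫ Φ.map (fst A B) = g ≫ Φ.map (fst A B))
    (h₂ : f ≫ Φ.map (snd A B) = g ≫ Φ.map (snd A B)) : f = g := by
  rw [← cancel_mono (Functor.OplaxMonoidal.δ Φ A B)]
  ext1
  · simpa using h₁
  · simpa using h₂

/-- Descent data and their solutions are transported along fully faithful monoidal functors. -/
lemma exists_isDescent_of_functor {C : Type*} [Category* C] [CartesianMonoidalCategory C]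
    {D : Type*} [Category* D] [CartesianMonoidalCategory D] (Φ : C ⥤ D) [Φ.Monoidal] [Φ.Full]
    [Φ.Faithful] [PreservesLimitsOfShape WalkingCospan Φ]
    (hC : ∀ {U X : C} (θ : U ⊗ (U ⊗ X) ⟶ X), IsTransport θ → ∃ (Y : C) (π : U ⊗ X ⟶ Y),
      IsDescent θ π) {U X : D} (hU : Φ.essImage U) (hX : Φ.essImage X)
    {θ : U ⊗ (U ⊗ X) ⟶ X} (h : IsTransport θ) :
    ∃ (Y : C) (π : U ⊗ X ⟶ Φ.obj Y), IsDescent θ π := by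
  obtain ⟨U', ⟨eU⟩⟩ := hU
  obtain ⟨X', ⟨eX⟩⟩ := hX
  let θ' : U' ⊗ (U' ⊗ X') ⟶ X' := Φ.preimage
    (lift (Φ.map (fst _ _) ≫ eU.hom) (lift (Φ.map (snd _ _) ≫ Φ.map (fst _ _) ≫ eU.hom)
      (Φ.map (snd _ _) ≫ Φ.map (snd _ _) ≫ eX.hom)) ≫ θ ≫ eX.inv)
  have hθ {T : D} (t : T ⟶ Φ.obj (U' ⊗ (U' ⊗ X'))) : t ≫ Φ.map θ' =
      lift (t ≫ Φ.map (fst _ _) ≫ eU.hom) (lift (t ≫ Φ.map (snd _ _) ≫ Φ.map (fst _ _) ≫ eU.hom)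
      (t ≫ Φ.map (snd _ _) ≫ Φ.map (snd _ _) ≫ eX.hom)) ≫ θ ≫ eX.inv := by
    simp only [θ', Functor.map_preimage, comp_lift_assoc, comp_lift]
  have hθ' {T : C} (u v : T ⟶ U') (x : T ⟶ X') : Φ.map (lift u (lift v x) ≫ θ') =
      lift (Φ.map u ≫ eU.hom) (lift (Φ.map v ≫ eU.hom) (Φ.map x ≫ eX.hom)) ≫ θ ≫ eX.inv := by
    rw [Functor.map_comp, hθ]
    simp only [← Functor.map_comp_assoc, lift_fst, lift_snd, lift_snd_assoc]
  have h' : IsTransport θ' := by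
    constructor
    · intro T u x
      apply Φ.map_injective
      rw [hθ', ← Category.assoc, h.self, Category.assoc, Iso.hom_inv_id, Category.comp_id]
    · intro T u v w x
      apply Φ.map_injective
      rw [hθ', hθ', hθ']
      simp only [Category.assoc, Iso.inv_hom_id, Category.comp_id]
      rw [← Category.assoc, h.comp, Category.assoc]
  obtain ⟨Y, π, hπ⟩ := hC θ' h'
  let e : U ⊗ X ⟶ Φ.obj (U' ⊗ X') := lift (fst _ _ ≫ eU.inv) (snd _ _ ≫ eX.inv) ≫
    Functor.LaxMonoidal.μ Φ U' X'
  have he : e ≫ Φ.map (fst _ _) = fst _ _ ≫ eU.inv := by simp [e]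
  have he' : e ≫ Φ.map (snd _ _) = snd _ _ ≫ eX.inv := by simp [e]
  have : IsIso e := by
    have : e = (eU.inv ⊗ₘ eX.inv) ≫ (Functor.Monoidal.μIso Φ U' X').hom := by
      simp only [e, Functor.Monoidal.μIso_hom]
      congr 1
      ext1 <;> simp
    rw [this]
    infer_instance
  let m : U ⊗ (U ⊗ X) ⟶ Φ.obj (U' ⊗ (U' ⊗ X')) := lift (fst _ _ ≫ eU.inv) (snd _ _ ≫ e) ≫
    Functor.LaxMonoidal.μ Φ U' (U' ⊗ X')
  have hm : m ≫ Φ.map (fst _ _) = fst _ _ ≫ eU.inv := by simp [m]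
  have hm' : m ≫ Φ.map (snd _ _) = snd _ _ ≫ e := by simp [m]
  clear_value m e
  have hmd : m ≫ Φ.map (lift (fst _ _) θ') = lift (fst _ _) θ ≫ e := by
    refine map_tensor_hom_ext Φ ?_ ?_
    · rw [Category.assoc, Category.assoc, ← Functor.map_comp, lift_fst, hm, he, lift_fst_assoc]
    · rw [Category.assoc, Category.assoc, ← Functor.map_comp, lift_snd, hθ, he', lift_snd_assoc,
        reassoc_of% hm, reassoc_of% hm', reassoc_of% he,
        reassoc_of% hm', reassoc_of% he']
      simp
  -- `e` and `m` identify `U × X` and `U × U × X` with images under `Φ`;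
  -- the two projections agree by `hmd`
  refine ⟨Y, e ≫ Φ.map π, ?_, ?_⟩
  · have key : lift (fst U' (U' ⊗ X')) θ' ≫ π = snd _ _ ≫ π := by
      refine hom_ext_point₃ fun u v x => ?_
      simpa [comp_lift_assoc] using hπ.transport u v x
    have key' : lift (fst _ _) θ ≫ e ≫ Φ.map π = snd _ _ ≫ e ≫ Φ.map π := by
      rw [← reassoc_of% hmd, ← Functor.map_comp, key, Functor.map_comp, reassoc_of% hm']
    intro T u v x
    simpa [comp_lift_assoc] using lift u (lift v x) ≫= key'
  · refine (hπ.isPullback.map Φ).of_iso (asIso e).symm (Iso.refl _) eU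
      (Functor.Monoidal.εIso Φ).symm ?_ ?_ ?_ ?_
    · simp
    · simp [reassoc_of% he]
    · exact toUnit_unique _ _
    · exact toUnit_unique _ _

lemma exists_isDescent_algSpec {R : CommRingCat.{u}} [∀ L : CommAlgCat.{u} R, Module.Flat R L]
    {U X : Over (Spec R)} [IsAffine U.left] [IsAffine X.left] {θ : U ⊗ (U ⊗ X) ⟶ X}
    (h : IsTransport θ) : ∃ (Y : Over (Spec R)) (π : U ⊗ X ⟶ Y), IsDescent θ π := by
  obtain ⟨Y, π, h⟩ := exists_isDescent_of_functor (algSpec R)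
    (fun θ hθ => exists_isDescent_commAlgCat hθ)
    (essImage_algSpec.mpr inferInstance) (essImage_algSpec.mpr inferInstance) h
  exact ⟨_, π, h⟩

/-- Descent of affine schemes along an affine covering of the point is effective. -/
lemma exists_isDescent_of_isAffine {F : Type u} [Field F] {U X : Sch F} [IsAffine U.left]
    [IsAffine X.left] {θ : U ⊗ (U ⊗ X) ⟶ X} (h : IsTransport θ) :
    ∃ (Y : Sch F) (π : U ⊗ X ⟶ Y), IsDescent θ π := by
  have (L : CommAlgCat.{u} (CommRingCat.of F)) : Module.Flat (CommRingCat.of F) L :=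
    inferInstanceAs (Module.Flat F L)
  exact exists_isDescent_algSpec h

end Affine

/-! ### Gluing along affine open subschemes of a base -/

section ZariskiGluing
open AlgebraicGeometry Limits Opposite Scheme
variable {F : Type u} [Field F]

/-- An affine open subscheme of `S`, as a scheme over `F`. -/
noncomputable def affineOpen {S : Sch F} (V : S.left.AffineZariskiSite) : Sch F :=
  Over.mk (V.toOpens.ι ≫ S.hom)

/-- The inclusion of an affine open subscheme. -/
noncomputable def affineOpenι {S : Sch F} (V : S.left.AffineZariskiSite) : affineOpen V ⟶ S :=
  Over.homMk V.toOpens.ι rfl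

/-- The inclusion of one affine open subscheme in another. -/
noncomputable def affineOpenMap {S : Sch F} {V W : S.left.AffineZariskiSite} (h : V ⟶ W) :
    affineOpen V ⟶ affineOpen W :=
  Over.homMk (S.left.homOfLE (AffineZariskiSite.toOpens_mono h.le)) (by simp [affineOpen])

lemma affineOpenMap_ι {S : Sch F} {V W : S.left.AffineZariskiSite} (h : V ⟶ W) :
    affineOpenMap h ≫ affineOpenι W = affineOpenι V := by
  ext1
  exact S.left.homOfLE_ι (AffineZariskiSite.toOpens_mono h.le)

instance {S : Sch F} (V : S.left.AffineZariskiSite) : IsAffine (affineOpen V).left := V.2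

instance {S : Sch F} (V : S.left.AffineZariskiSite) : Mono (affineOpenι V) := by
  have : Mono (affineOpenι V).left := inferInstanceAs (Mono V.toOpens.ι)
  exact Over.mono_of_mono_left _

/-- Morphisms from `T` can be glued along the covering of `T` by the inverse images of the affine
open subschemes of `S`. -/
lemma exists_zariski_glue {S T Z : Sch F} (s : T ⟶ S) {TV : S.left.AffineZariskiSite → Sch F}
    {t : ∀ V, TV V ⟶ T} {t' : ∀ V, TV V ⟶ affineOpen V}
    (sq : ∀ V, IsPullback (t V) (t' V) s (affineOpenι V)) (g : ∀ V, TV V ⟶ Z)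
    (hg : ∀ {V W : S.left.AffineZariskiSite} (_ : V ⟶ W) {R : Sch F} (a : R ⟶ TV V)
      (b : R ⟶ TV W), a ≫ t V = b ≫ t W → a ≫ g V = b ≫ g W) :
    ∃ z : T ⟶ Z, ∀ V, t V ≫ z = g V := by
  let 𝒰 := (AffineZariskiSite.directedCover S.left).pullback₁ s.left
  have hex (V : 𝒰.I₀) : ∃ e : 𝒰.X V ≅ (TV V).left, e.hom ≫ (t V).left = 𝒰.f V := by
    have sq' : IsPullback (t V).left (t' V).left s.left (AffineZariskiSite.toOpens V).ι :=
      (sq V).map (Over.forget _)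
    exact ⟨sq'.isoPullback.symm, sq'.isoPullback_inv_fst⟩
  choose e he using hex
  have he' (V : 𝒰.I₀) {R : Scheme.{u}} (k : T.left ⟶ R) :
      (e V).hom ≫ (t V).left ≫ k = 𝒰.f V ≫ k := by
    rw [← he, Category.assoc]
  have compat {V W : 𝒰.I₀} (h : V ⟶ W) :
      Cover.trans 𝒰 h ≫ (e W).hom ≫ (g W).left = (e V).hom ≫ (g V).left := by
    let a : Over.mk (𝒰.f V ≫ T.hom) ⟶ TV V := Over.homMk (e V).hom (by
      rw [← Over.w (t V), he']; rfl)
    let b : Over.mk (𝒰.f V ≫ T.hom) ⟶ TV W := Over.homMk (Cover.trans 𝒰 h ≫ (e W).hom) (by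
      rw [← Over.w (t W), Category.assoc, he', ← Category.assoc, Cover.trans_map]; rfl)
    have := hg h a b (by
      ext1
      change (e V).hom ≫ (t V).left = (Cover.trans 𝒰 h ≫ (e W).hom) ≫ (t W).left
      rw [he, Category.assoc, he, Cover.trans_map])
    exact ((congrArg (·.left) this).trans (Category.assoc _ _ _)).symm
  have w (V : 𝒰.I₀) : ((e V).hom ≫ (g V).left) ≫ Z.hom = 𝒰.f V ≫ T.hom := by
    rw [Category.assoc, Over.w, ← he', Over.w]
  refine ⟨OpenCover.glueMorphismsOverOfLocallyDirected 𝒰 (fun V => _) compat w,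
    fun (V : 𝒰.I₀) => ?_⟩
  ext1
  rw [← cancel_epi (e V).hom, Over.comp_left, he']
  exact OpenCover.map_glueMorphismsOverOfLocallyDirected_left 𝒰 _ compat w V

/-- Morphisms agree if they agree over the affine open subschemes of `S`. -/
lemma zariski_hom_ext {S T Z : Sch F} (s : T ⟶ S) {f g : T ⟶ Z}
    (h : ∀ (V : S.left.AffineZariskiSite) {R : Sch F} (t : R ⟶ T) (t' : R ⟶ affineOpen V),
      t ≫ s = t' ≫ affineOpenι V → t ≫ f = t ≫ g) : f = g := by
  let 𝒰 := (AffineZariskiSite.directedCover S.left).pullback₁ s.left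
  ext1
  refine Cover.hom_ext 𝒰 _ _ fun V => ?_
  let t : Over.mk (𝒰.f V ≫ T.hom) ⟶ T := Over.homMk (𝒰.f V) rfl
  have hw : 𝒰.f V ≫ s.left = pullback.snd s.left V.toOpens.ι ≫ V.toOpens.ι := pullback.condition
  let t' : Over.mk (𝒰.f V ≫ T.hom) ⟶ affineOpen V :=
    Over.homMk (pullback.snd s.left V.toOpens.ι) (by
      have := hw =≫ S.hom
      rw [Category.assoc, Over.w] at this
      exact this.symm)
  exact congrArg (·.left) (h V t t' (by ext1; exact hw))

/-- The properties of the glued scheme, detached from its construction as a colimit. -/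
lemma _root_.AlgebraicGeometry.Scheme.Cover.RelativeGluingData.exists_glued {S : Scheme.{u}}
    {𝒰 : S.OpenCover} [Category.{u} 𝒰.I₀] [𝒰.LocallyDirected] [Small.{u} 𝒰.I₀]
    [Quiver.IsThin 𝒰.I₀] (D : 𝒰.RelativeGluingData) :
    ∃ (Z : Scheme.{u}) (q : Z ⟶ S) (j : ∀ V, D.functor.obj V ⟶ Z),
      (∀ V, IsPullback (D.natTrans.app V) (j V) (𝒰.f V) q) ∧
        ∀ {V W} (h : V ⟶ W), D.functor.map h ≫ j W = j V :=
  ⟨D.glued, D.toBase, fun V => colimit.ι D.functor V, D.isPullback_natTrans_ι_toBase,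
    fun h => colimit.w D.functor h⟩

/-- Schemes over the affine open subschemes of `S` can be glued. -/
lemma exists_zariski_glue_obj {S : Sch F} (Y : S.left.AffineZariskiSite → Sch F)
    (p : ∀ V, Y V ⟶ affineOpen V) (n : ∀ {V W : S.left.AffineZariskiSite} (_ : V ⟶ W), Y V ⟶ Y W)
    (n_id : ∀ V, n (𝟙 V) = 𝟙 (Y V))
    (n_comp : ∀ {V W W'} (h : V ⟶ W) (h' : W ⟶ W'), n (h ≫ h') = n h ≫ n h')
    (sq : ∀ {V W} (h : V ⟶ W), IsPullback (n h) (p V) (p W) (affineOpenMap h)) :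
    ∃ (Z : Sch F) (q : Z ⟶ S) (j : ∀ V, Y V ⟶ Z),
      (∀ V, IsPullback (j V) (p V) q (affineOpenι V)) ∧
        ∀ {V W} (h : V ⟶ W), n h ≫ j W = j V := by
  let D : (AffineZariskiSite.directedCover S.left).RelativeGluingData :=
    { functor :=
        { obj V := (Y V).left
          map h := (n h).left
          map_id V := by rw [n_id]; rfl
          map_comp h h' := by rw [n_comp]; rfl }
      natTrans :=
        { app V := (p V).left
          naturality V W h := congrArg (·.left) (sq h).w }
      equifibered V W h := (sq h).map (Over.forget _) }
  obtain ⟨Z, q, j, hj, hj'⟩ := D.exists_glued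
  have hw (V) : (p V).left ≫ V.toOpens.ι = j V ≫ q := (hj V).w
  let j' (V) : Y V ⟶ Over.mk (q ≫ S.hom) := Over.homMk (j V) (by
    rw [← Over.w (p V)]
    have := hw V =≫ S.hom
    rw [Category.assoc] at this
    exact this.symm.trans (Category.assoc (p V).left V.toOpens.ι S.hom))
  refine ⟨Over.mk (q ≫ S.hom), Over.homMk q rfl, j', fun V => ?_, fun {V W} h => ?_⟩
  · exact IsPullback.of_map (Over.forget _) (by ext1; exact (hw V).symm) (hj V).flip
  · ext1
    exact hj' h

end ZariskiGluing

/-! ### Effective descent for schemes affine over a base -/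

section EffectiveDescent
open AlgebraicGeometry Limits Opposite
variable {F : Type u} [Field F]

namespace IsDescent

variable {U X Y : Sch F} {θ : U ⊗ (U ⊗ X) ⟶ X} {π : U ⊗ X ⟶ Y}

lemma inj (h : IsDescent θ π) {T : Sch F} {u : T ⟶ U} {x y : T ⟶ X}
    (e : lift u x ≫ π = lift u y ≫ π) : x = y := by
  have := h.isPullback.hom_ext e (by simp)
  simpa using this =≫ snd U X

lemma exists_lift (h : IsDescent θ π) {T : Sch F} (u : T ⟶ U) (y : T ⟶ Y) :
    ∃ x : T ⟶ X, lift u x ≫ π = y := by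
  obtain ⟨z, h₁, h₂⟩ := h.isPullback.exists_lift y u (toUnit_unique _ _)
  refine ⟨z ≫ snd U X, ?_⟩
  rw [← h₂, ← comp_lift, lift_fst_snd, Category.comp_id, h₁]

lemma eq_transport (h : IsDescent θ π) {T : Sch F} {u v : T ⟶ U} {x y : T ⟶ X}
    (e : lift u x ≫ π = lift v y ≫ π) : x = lift u (lift v y) ≫ θ :=
  h.inj (u := u) (by rw [h.transport, e])

lemma isCov (h : IsDescent θ π) (hU : IsCov (toUnit U)) : IsCov π :=
  hU.of_isPullback h.isPullback

lemma exists_desc (h : IsDescent θ π) (hU : IsCov (toUnit U)) {Z : Sch F} (f : U ⊗ X ⟶ Z)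
    (hf : ∀ {T : Sch F} (u v : T ⟶ U) (x : T ⟶ X),
      lift u (lift u (lift v x) ≫ θ) ≫ f = lift v x ≫ f) : ∃ g : Y ⟶ Z, π ≫ g = f := by
  refine (h.isCov hU).exists_desc f fun {W} a b hab => ?_
  obtain ⟨u, x, rfl⟩ : ∃ u x, a = lift u x := ⟨a ≫ fst _ _, a ≫ snd _ _, by simp⟩
  obtain ⟨v, y, rfl⟩ : ∃ u x, b = lift u x := ⟨b ≫ fst _ _, b ≫ snd _ _, by simp⟩
  rw [h.eq_transport hab, hf]

lemma hom_ext (h : IsDescent θ π) (hU : IsCov (toUnit U)) {Z : Sch F} {f g : Y ⟶ Z}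
    (e : π ≫ f = π ≫ g) : f = g :=
  (h.isCov hU).hom_ext e

end IsDescent

lemma mono_of_isPullback {C : Type*} [Category* C] {A B D E : C} {a : A ⟶ B} {b : A ⟶ D}
    {c : B ⟶ E} {d : D ⟶ E} (h : IsPullback a b c d) [Mono d] : Mono a :=
  ⟨fun s t e => h.hom_ext e (by
    rw [← cancel_mono d, Category.assoc, Category.assoc, ← h.w, reassoc_of% e])⟩

lemma isPullback_whiskerLeft_snd {C : Type*} [Category* C] [CartesianMonoidalCategory C] (U : C)
    {X Y : C} (f : X ⟶ Y) : IsPullback (U ◁ f) (snd U X) (snd U Y) f := by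
  refine ⟨⟨by simp⟩, ⟨PullbackCone.IsLimit.mk _ (fun s => lift (s.fst ≫ fst U Y) s.snd)
    (fun s => ?_) (fun s => by simp) (fun s m h₁ h₂ => ?_)⟩⟩
  · ext1
    · simp
    · simpa using s.condition.symm
  · ext1
    · simpa using h₁ =≫ fst U Y
    · simpa using h₂

/-- Descent is compatible with base change: a cartesian square of objects with transport descends
to a cartesian square. -/
lemma IsDescent.isPullback_map {U X₁ X₂ S₁ S₂ Y₁ Y₂ : Sch F} (hU : IsCov (toUnit U))
    {θ₁ : U ⊗ (U ⊗ X₁) ⟶ X₁} {θ₂ : U ⊗ (U ⊗ X₂) ⟶ X₂} {π₁ : U ⊗ X₁ ⟶ Y₁} {π₂ : U ⊗ X₂ ⟶ Y₂}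
    (h₁ : IsDescent θ₁ π₁) (h₂ : IsDescent θ₂ π₂) {m : X₁ ⟶ X₂} {f₁ : X₁ ⟶ S₁} {f₂ : X₂ ⟶ S₂}
    {i : S₁ ⟶ S₂} (sq : IsPullback m f₁ f₂ i) {n : Y₁ ⟶ Y₂} {p₁ : Y₁ ⟶ S₁} {p₂ : Y₂ ⟶ S₂}
    (hn : π₁ ≫ n = (U ◁ m) ≫ π₂) (hp₁ : π₁ ≫ p₁ = snd _ _ ≫ f₁) (hp₂ : π₂ ≫ p₂ = snd _ _ ≫ f₂) :
    IsPullback n p₁ p₂ i := by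
  have hn' {T : Sch F} (u : T ⟶ U) (x : T ⟶ X₁) : lift u x ≫ π₁ ≫ n = lift u (x ≫ m) ≫ π₂ := by
    rw [hn, lift_whiskerLeft_assoc]
  have hp' {T : Sch F} (u : T ⟶ U) (x : T ⟶ X₁) : lift u x ≫ π₁ ≫ p₁ = x ≫ f₁ := by
    rw [hp₁, lift_snd_assoc]
  have hp₂' {T : Sch F} (u : T ⟶ U) (x : T ⟶ X₂) : lift u x ≫ π₂ ≫ p₂ = x ≫ f₂ := by
    rw [hp₂, lift_snd_assoc]
  refine isPullback_of_locally ?_ ?_ ?_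
  · refine h₁.hom_ext hU ?_
    rw [reassoc_of% hn, hp₂, whiskerLeft_snd_assoc, reassoc_of% hp₁, sq.w]
  · intro T a b e₁ e₂
    refine (hU.fst T).hom_ext ?_
    obtain ⟨x, hx⟩ := h₁.exists_lift (snd T U) (fst T U ≫ a)
    obtain ⟨y, hy⟩ := h₁.exists_lift (snd T U) (fst T U ≫ b)
    rw [← hx, ← hy]
    congr 2
    refine sq.hom_ext (h₂.inj (u := snd T U) ?_) ?_
    · rw [← hn', ← hn', reassoc_of% hx, reassoc_of% hy, e₁]
    · rw [← hp' (snd T U), ← hp' (snd T U), reassoc_of% hx, reassoc_of% hy, e₂]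
  · intro T y s e
    obtain ⟨x, hx⟩ := h₂.exists_lift (snd T U) (fst T U ≫ y)
    obtain ⟨z, hz₁, hz₂⟩ := sq.exists_lift x (fst T U ≫ s) (by
      rw [← hp₂' (snd T U), reassoc_of% hx, e, Category.assoc])
    refine ⟨_, fst T U, lift (snd T U) z ≫ π₁, hU.fst T, ?_, ?_⟩
    · rw [Category.assoc, hn', hz₁, hx]
    · rw [Category.assoc, hp', hz₂]

/-- Descent of schemes `X` affine over a base `S` along an affine covering of the point, for a
transport over `S`, is effective: the descended schemes exist over the affine open subschemes of
`S`, and they can be glued. -/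
theorem exists_isDescent {U X S : Sch F} [IsAffine U.left] (hU : IsCov (toUnit U)) (f : X ⟶ S)
    [IsAffineHom f.left] {θ : U ⊗ (U ⊗ X) ⟶ X} (h : IsTransport θ)
    (hθ : θ ≫ f = snd _ _ ≫ snd _ _ ≫ f) :
    ∃ (Y : Sch F) (π : U ⊗ X ⟶ Y) (p : Y ⟶ S), IsDescent θ π ∧ π ≫ p = snd U X ≫ f := by
  have hθ' {T : Sch F} (u v : T ⟶ U) (x : T ⟶ X) : lift u (lift v x) ≫ θ ≫ f = x ≫ f := by
    rw [hθ, lift_snd_assoc, lift_snd_assoc]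
  let I := S.left.AffineZariskiSite
  let XV (V : I) : Sch F := pullback f (affineOpenι V)
  let j (V : I) : XV V ⟶ X := pullback.fst _ _
  let fV (V : I) : XV V ⟶ affineOpen V := pullback.snd _ _
  have sq (V : I) : IsPullback (j V) (fV V) f (affineOpenι V) := IsPullback.of_hasPullback _ _
  clear_value j fV XV
  have hXV (V : I) : IsAffine (XV V).left := by
    have h' : IsPullback (j V).left (fV V).left f.left (affineOpenι V).left :=
      (sq V).map (Over.forget _)
    have : IsAffineHom (fV V).left := MorphismProperty.of_isPullback h' inferInstance
    exact isAffine_of_isAffineHom (fV V).left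
  -- the transport restricts to the parts `XV V` over the affine open subschemes, which are affine
  have hex (V : I) : ∃ θV : U ⊗ (U ⊗ XV V) ⟶ XV V,
      θV ≫ j V = (U ◁ (U ◁ j V)) ≫ θ ∧ θV ≫ fV V = snd _ _ ≫ snd _ _ ≫ fV V :=
    (sq V).exists_lift _ _ (by
      rw [Category.assoc, hθ, Category.assoc, Category.assoc, ← (sq V).w]; simp)
  choose θV hθj hθf using hex
  have hθj' (V : I) {T : Sch F} (u v : T ⟶ U) (x : T ⟶ XV V) :
      lift u (lift v x) ≫ θV V ≫ j V = lift u (lift v (x ≫ j V)) ≫ θ := by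
    rw [hθj, lift_whiskerLeft_assoc, lift_whiskerLeft]
  have hθf' (V : I) {T : Sch F} (u v : T ⟶ U) (x : T ⟶ XV V) :
      lift u (lift v x) ≫ θV V ≫ fV V = x ≫ fV V := by
    rw [hθf, lift_snd_assoc, lift_snd_assoc]
  have hθV (V : I) : IsTransport (θV V) := by
    constructor
    · intro T u x
      refine (sq V).hom_ext ?_ ?_
      · rw [Category.assoc, hθj', h.self]
      · rw [Category.assoc, hθf']
    · intro T u v w x
      refine (sq V).hom_ext ?_ ?_
      · rw [Category.assoc, hθj', Category.assoc, hθj', Category.assoc, hθj', h.comp]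
      · rw [Category.assoc, hθf', Category.assoc, hθf', Category.assoc, hθf']
  choose Y π hπ using fun V => exists_isDescent_of_isAffine (hθV V)
  have hp (V : I) : ∃ p : Y V ⟶ affineOpen V, π V ≫ p = snd _ _ ≫ fV V :=
    (hπ V).exists_desc hU _ fun u v x => by
      rw [lift_snd_assoc, lift_snd_assoc, Category.assoc, hθf']
  choose p hp using hp
  -- the inclusions `m` of these parts are compatible with the transports, hence descend to `n`
  have hm {V W : I} (k : V ⟶ W) : ∃ m : XV V ⟶ XV W, m ≫ j W = j V ∧
      m ≫ fV W = fV V ≫ affineOpenMap k :=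
    (sq W).exists_lift _ _ (by rw [Category.assoc, affineOpenMap_ι, (sq V).w])
  choose m hmj hmf using @hm
  have sqm {V W : I} (k : V ⟶ W) : IsPullback (m k) (fV V) (fV W) (affineOpenMap k) := by
    refine IsPullback.of_right ?_ (hmf k) (sq W)
    rw [hmj, affineOpenMap_ι]
    exact sq V
  have hmθ {V W : I} (k : V ⟶ W) {T : Sch F} (u v : T ⟶ U) (x : T ⟶ XV V) :
      lift u (lift v x) ≫ θV V ≫ m k = lift u (lift v (x ≫ m k)) ≫ θV W := by
    refine (sq W).hom_ext ?_ ?_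
    · rw [Category.assoc, Category.assoc, hmj, hθj', Category.assoc, hθj', Category.assoc, hmj]
    · rw [Category.assoc, Category.assoc, hmf, reassoc_of% (hθf' V), Category.assoc, hθf',
        Category.assoc, hmf]
  have hn {V W : I} (k : V ⟶ W) : ∃ n : Y V ⟶ Y W, π V ≫ n = (U ◁ m k) ≫ π W :=
    (hπ V).exists_desc hU _ fun u v x => by
      rw [lift_whiskerLeft_assoc, lift_whiskerLeft_assoc, Category.assoc, hmθ, (hπ W).transport]
  choose n hn using @hn
  have hm_id (V : I) : m (𝟙 V) = 𝟙 _ := by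
    refine (sq V).hom_ext (by rw [hmj, Category.id_comp]) ?_
    rw [← cancel_mono (affineOpenι V), hmf, Category.assoc, affineOpenMap_ι, Category.id_comp]
  have hm_comp {V W W' : I} (k : V ⟶ W) (k' : W ⟶ W') : m (k ≫ k') = m k ≫ m k' := by
    refine (sq W').hom_ext (by rw [hmj, Category.assoc, hmj, hmj]) ?_
    rw [← cancel_mono (affineOpenι W')]
    simp only [hmf, Category.assoc, affineOpenMap_ι, reassoc_of% (hmf k)]
  obtain ⟨Z, q, jY, sqY, hjY⟩ := exists_zariski_glue_obj Y p (fun k => n k)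
    (fun V => (hπ V).hom_ext hU (by rw [hn, hm_id]; simp))
    (fun k k' => (hπ _).hom_ext hU (by
      rw [hn, hm_comp, reassoc_of% (hn k), hn, whiskerLeft_comp_assoc]))
    (fun k => (hπ _).isPullback_map hU (hπ _) (sqm k) (hn k) (hp _) (hp _))
  have sqUX (V : I) : IsPullback (U ◁ j V) (snd _ _ ≫ fV V) (snd _ _ ≫ f) (affineOpenι V) :=
    IsPullback.paste_vert (isPullback_whiskerLeft_snd U (j V)) (sq V)
  have monoj (V : I) : Mono (U ◁ j V) := mono_of_isPullback (sqUX V)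
  have monoY (V : I) : Mono (jY V) := mono_of_isPullback (sqY V)
  -- the morphisms `π V` glue as well, and the glued morphism `ϖ` solves the descent problem, which
  -- may be checked over each affine open subscheme
  obtain ⟨ϖ, hϖ⟩ := exists_zariski_glue (snd U X ≫ f) sqUX (fun V => π V ≫ jY V) (by
    intro V W k R a b hab
    have : b = a ≫ (U ◁ m k) := by
      rw [← cancel_mono (U ◁ j W), ← hab, Category.assoc, ← whiskerLeft_comp, hmj]
    rw [this, Category.assoc, ← reassoc_of% (hn k), hjY])
  have hϖ' (V : I) {T : Sch F} (u : T ⟶ U) (x : T ⟶ XV V) :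
      lift u (x ≫ j V) ≫ ϖ = lift u x ≫ π V ≫ jY V := by
    rw [← hϖ, lift_whiskerLeft_assoc]
  have hq : ϖ ≫ q = snd U X ≫ f := by
    refine zariski_hom_ext (snd U X ≫ f) fun V R t t' e => ?_
    obtain ⟨w, rfl, hw⟩ := (sqUX V).exists_lift t t' e
    rw [Category.assoc, reassoc_of% (hϖ V), (sqY V).w, reassoc_of% (hp V), reassoc_of% hw, e]
  have hq' {T : Sch F} (u : T ⟶ U) (x : T ⟶ X) : lift u x ≫ ϖ ≫ q = x ≫ f := by
    rw [hq, lift_snd_assoc]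
  refine ⟨Z, ϖ, q, ⟨fun u v x => ?_, isPullback_of_locally (toUnit_unique _ _) ?_ ?_⟩, hq⟩
  · refine zariski_hom_ext (x ≫ f) fun V R t t' e => ?_
    obtain ⟨y, hy, -⟩ := (sq V).exists_lift (t ≫ x) t' (by rw [Category.assoc, e])
    rw [comp_lift_assoc, comp_lift_assoc, comp_lift_assoc, comp_lift, ← hy, ← hθj', hϖ',
      ← Category.assoc (lift _ _) (θV V), hϖ', reassoc_of% ((hπ V).transport (t ≫ u) (t ≫ v) y)]
  · intro T a b e₁ e₂
    obtain ⟨u, x, rfl⟩ : ∃ u x, a = lift u x := ⟨a ≫ fst _ _, a ≫ snd _ _, by simp⟩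
    obtain ⟨v, y, rfl⟩ : ∃ u x, b = lift u x := ⟨b ≫ fst _ _, b ≫ snd _ _, by simp⟩
    obtain rfl : u = v := by simpa using e₂
    have ef : x ≫ f = y ≫ f := by rw [← hq' u, ← hq' u, reassoc_of% e₁]
    congr 1
    refine zariski_hom_ext (x ≫ f) fun V R t t' e => ?_
    obtain ⟨x', hx, -⟩ := (sq V).exists_lift (t ≫ x) t' (by rw [Category.assoc, e])
    obtain ⟨y', hy, -⟩ := (sq V).exists_lift (t ≫ y) t' (by rw [Category.assoc, ← ef, e])
    rw [← hx, ← hy, (hπ V).inj (u := t ≫ u) (x := x') (y := y')]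
    rw [← cancel_mono (jY V), Category.assoc, Category.assoc, ← hϖ', ← hϖ', hx, hy,
      ← comp_lift_assoc, ← comp_lift_assoc, e₁]
  · intro T y u _
    have hY (V : I) : ∃ yV : pullback (y ≫ q) (affineOpenι V) ⟶ Y V,
        yV ≫ jY V = pullback.fst _ _ ≫ y := by
      obtain ⟨yV, h, -⟩ := (sqY V).exists_lift (pullback.fst (y ≫ q) (affineOpenι V) ≫ y)
        (pullback.snd _ _) (by rw [Category.assoc, pullback.condition])
      exact ⟨yV, h⟩
    choose yV hyV using hY
    choose xV hxV using fun V => (hπ V).exists_lift (pullback.fst _ _ ≫ u) (yV V)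
    obtain ⟨x, hx⟩ := exists_zariski_glue (y ≫ q) (fun V => IsPullback.of_hasPullback _ _)
      (fun V => xV V ≫ j V) (by
      intro V W k R a b hab
      have : a ≫ xV V ≫ m k = b ≫ xV W := by
        refine (hπ W).inj (u := b ≫ pullback.fst _ _ ≫ u) ?_
        have h₁ := a ≫= hxV V =≫ n k
        have h₂ := b ≫= hxV W
        rw [Category.assoc, hn, lift_whiskerLeft_assoc, comp_lift_assoc] at h₁
        rw [comp_lift_assoc] at h₂
        rw [h₂, ← reassoc_of% hab, h₁, ← cancel_mono (jY W), Category.assoc, Category.assoc,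
          Category.assoc, hjY, hyV, hyV, reassoc_of% hab]
      rw [← reassoc_of% this, hmj])
    refine ⟨T, 𝟙 T, lift u x, IsCov.of_isIso _, ?_, by simp⟩
    rw [Category.id_comp]
    refine zariski_hom_ext (y ≫ q) fun V R t t' e => ?_
    obtain ⟨w, rfl, -⟩ :=
      (IsPullback.of_hasPullback (y ≫ q) (affineOpenι V)).exists_lift t t' e
    rw [Category.assoc, Category.assoc, comp_lift_assoc, hx, hϖ', reassoc_of% (hxV V), hyV]

end EffectiveDescent

/-! ### Morphisms with local sections -/

section LocalSections

open AlgebraicGeometry Limits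

variable {F : Type u} [Field F]

/-- The morphism `q` has sections locally for the étale topology, that is, it is an epimorphism of
étale sheaves. -/
def HasLocalSections {A B : Sch F} (q : A ⟶ B) : Prop :=
  ∃ (B' : Sch F) (c : B' ⟶ B) (s : B' ⟶ A), IsCov c ∧ s ≫ q = c

lemma IsCov.hasLocalSections {A B : Sch F} {c : A ⟶ B} (hc : IsCov c) : HasLocalSections c :=
  ⟨A, c, 𝟙 A, hc, Category.id_comp c⟩

namespace HasLocalSections

variable {A B Z : Sch F} {q : A ⟶ B}

lemma of_comp_eq (hq : HasLocalSections q) {A' : Sch F} {r : A' ⟶ B} (k : A ⟶ A')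
    (hk : k ≫ r = q) : HasLocalSections r := by
  obtain ⟨B', c, s, hc, hs⟩ := hq
  exact ⟨B', c, s ≫ k, hc, by rw [Category.assoc, hk, hs]⟩

lemma exists_lift (hq : HasLocalSections q) {T : Sch F} (y : T ⟶ B) :
    ∃ (T' : Sch F) (c : T' ⟶ T) (x : T' ⟶ A), IsCov c ∧ x ≫ q = c ≫ y := by
  obtain ⟨B', c, s, hc, hs⟩ := hq
  exact ⟨pullback y c, pullback.fst _ _, pullback.snd _ _ ≫ s, hc.pullback_fst y, by
    rw [Category.assoc, hs, pullback.condition]⟩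

/-- It suffices that points lift locally. -/
lemma of_exists_lift (h : ∀ {T : Sch F} (y : T ⟶ B),
    ∃ (T' : Sch F) (c : T' ⟶ T) (x : T' ⟶ A), IsCov c ∧ x ≫ q = c ≫ y) : HasLocalSections q := by
  obtain ⟨T', c, x, hc, hx⟩ := h (𝟙 B)
  exact ⟨T', c, x, hc, by rw [hx, Category.comp_id]⟩

lemma comp (hq : HasLocalSections q) {r : B ⟶ Z} (hr : HasLocalSections r) :
    HasLocalSections (q ≫ r) := by
  refine of_exists_lift fun {T} y => ?_
  obtain ⟨T', c, x, hc, hx⟩ := hr.exists_lift y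
  obtain ⟨T'', d, z, hd, hz⟩ := hq.exists_lift x
  exact ⟨T'', d ≫ c, z, hd.comp hc, by rw [reassoc_of% hz, hx, Category.assoc]⟩

lemma hom_ext (hq : HasLocalSections q) {f g : B ⟶ Z} (h : q ≫ f = q ≫ g) : f = g := by
  obtain ⟨B', c, s, hc, hs⟩ := hq
  exact hc.hom_ext (by rw [← hs, Category.assoc, h, Category.assoc])

/-- Descent of morphisms along a morphism with local sections. -/
lemma exists_desc (hq : HasLocalSections q) (f : A ⟶ Z)
    (hf : ∀ {T : Sch F} (a b : T ⟶ A), a ≫ q = b ≫ q → a ≫ f = b ≫ f) :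
    ∃ k : B ⟶ Z, q ≫ k = f := by
  obtain ⟨B', c, s, hc, hs⟩ := hq
  obtain ⟨k, hk⟩ := hc.exists_desc (s ≫ f) fun a b hab => by
    have := hf (a ≫ s) (b ≫ s) (by rw [Category.assoc, Category.assoc, hs, hab])
    simpa using this
  refine ⟨k, (hc.pullback_fst q).hom_ext ?_⟩
  rw [pullback.condition_assoc, hk, ← Category.assoc]
  exact hf _ _ (by rw [Category.assoc, hs, pullback.condition])

lemma whiskerLeft (hq : HasLocalSections q) (H : Sch F) : HasLocalSections (H ◁ q) := by
  refine of_exists_lift fun {T} y => ?_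
  obtain ⟨T', c, x, hc, hx⟩ := hq.exists_lift (y ≫ snd H B)
  refine ⟨T', c, lift (c ≫ y ≫ fst H B) x, hc, ?_⟩
  rw [lift_whiskerLeft, hx, ← comp_lift, ← comp_lift]
  simp

lemma snd {U : Sch F} (hU : HasLocalSections (toUnit U)) (T : Sch F) :
    HasLocalSections (snd U T) := by
  refine of_exists_lift fun {R} y => ?_
  obtain ⟨T', c, x, hc, -⟩ := hU.exists_lift (toUnit R)
  exact ⟨T', c, lift x (c ≫ y), hc, lift_snd _ _⟩

end HasLocalSections

end LocalSections

/-! ### Torsors in terms of points -/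

noncomputable section TorsorBasics

open AlgebraicGeometry Limits

variable {F : Type u} [Field F] {G H : Sch F} [GrpObj G] [GrpObj H]

lemma IsAction.inv_act {G P : Sch F} [GrpObj G] {act : G ⊗ P ⟶ P} (h : IsAction act) {T : Sch F}
    (g : T ⟶ G) (x : T ⟶ P) : lift g⁻¹ (lift g x ≫ act) ≫ act = x := by
  rw [← h.mul_act, inv_mul_cancel, h.one_act]

namespace IsTorsor

variable {P S : Sch F} {act : G ⊗ P ⟶ P} {p : P ⟶ S}

lemma act_proj (h : IsTorsor act p) {T : Sch F} (g : T ⟶ G) (x : T ⟶ P) :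
    lift g x ≫ act ≫ p = x ≫ p := by
  rw [h.isPullback.w, lift_snd_assoc]

lemma free (h : IsTorsor act p) {T : Sch F} {g k : T ⟶ G} {x : T ⟶ P}
    (e : lift g x ≫ act = lift k x ≫ act) : g = k := by
  have := h.isPullback.hom_ext e (by simp)
  simpa using this =≫ fst G P

lemma exists_div (h : IsTorsor act p) {T : Sch F} {x y : T ⟶ P} (e : x ≫ p = y ≫ p) :
    ∃ g : T ⟶ G, lift g x ≫ act = y := by
  obtain ⟨z, h₁, h₂⟩ := h.isPullback.exists_lift y x e.symm
  refine ⟨z ≫ fst G P, ?_⟩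
  rw [← h₂, ← comp_lift, lift_fst_snd, Category.comp_id, h₁]

lemma hasLocalSections (h : IsTorsor act p) : HasLocalSections p := by
  obtain ⟨S', c, t, h₁, h₂, h₃, -⟩ := h.locallyTrivial
  exact ⟨S', c, lift 1 (𝟙 S') ≫ t, ⟨h₁, h₂⟩, by rw [Category.assoc, h₃.w, lift_snd_assoc,
    Category.id_comp]⟩

/-- Torsors in terms of points: a torsor is a free action which is locally transitive on the fibres
of a morphism with local sections. -/
lemma of_points (hact : IsAction act)
    (hp : ∀ {T : Sch F} (g : T ⟶ G) (x : T ⟶ P), lift g x ≫ act ≫ p = x ≫ p)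
    (hfree : ∀ {T : Sch F} (g k : T ⟶ G) (x : T ⟶ P), lift g x ≫ act = lift k x ≫ act → g = k)
    (htrans : ∀ {T : Sch F} (x y : T ⟶ P), x ≫ p = y ≫ p →
      ∃ (T' : Sch F) (c : T' ⟶ T) (g : T' ⟶ G), IsCov c ∧ lift g (c ≫ x) ≫ act = c ≫ y)
    (hloc : HasLocalSections p) : IsTorsor act p := by
  have sq : IsPullback act (snd G P) p p := by
    refine isPullback_of_locally (hom_ext_point₂ fun g x => ?_) ?_ ?_
    · rw [hp, lift_snd_assoc]
    · intro T a b e₁ e₂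
      obtain ⟨g, x, rfl⟩ : ∃ u x, a = lift u x := ⟨a ≫ fst _ _, a ≫ snd _ _, by simp⟩
      obtain ⟨k, y, rfl⟩ : ∃ u x, b = lift u x := ⟨b ≫ fst _ _, b ≫ snd _ _, by simp⟩
      obtain rfl : x = y := by simpa using e₂
      rw [hfree g k x e₁]
    · intro T y x e
      obtain ⟨T', c, g, hc, hg⟩ := htrans x y e.symm
      exact ⟨T', c, lift g (c ≫ x), hc, hg, lift_snd _ _⟩
  refine ⟨hact, sq, ?_⟩
  obtain ⟨S', c, s, hc, hs⟩ := hloc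
  refine ⟨S', c, lift (fst G S') (snd G S' ≫ s) ≫ act, hc.1, hc.2, ?_, fun g k s' => ?_⟩
  · refine isPullback_of_locally ?_ ?_ ?_
    · rw [Category.assoc, hp, Category.assoc, hs]
    · intro T a b e₁ e₂
      obtain ⟨g, x, rfl⟩ : ∃ u x, a = lift u x := ⟨a ≫ fst _ _, a ≫ snd _ _, by simp⟩
      obtain ⟨k, y, rfl⟩ : ∃ u x, b = lift u x := ⟨b ≫ fst _ _, b ≫ snd _ _, by simp⟩
      obtain rfl : x = y := by simpa using e₂
      simp only [comp_lift_assoc, lift_fst, lift_snd_assoc] at e₁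
      rw [hfree g k _ e₁]
    · intro T y x e
      obtain ⟨T', d, g, hd, hg⟩ := htrans (x ≫ s) y (by rw [Category.assoc, hs, e])
      exact ⟨T', d, lift g (d ≫ x), hd, by simpa [comp_lift_assoc] using hg, lift_snd _ _⟩
  · simp only [comp_lift_assoc, lift_fst, lift_snd_assoc, hact.mul_act]

/-- The projection of a torsor under an affine group scheme is affine, by descent from the trivial
torsor. -/
lemma isAffineHom [hG : IsAffineHom G.hom] (h : IsTorsor act p) : IsAffineHom p.left := by
  obtain ⟨S', c, t, h₁, h₂, h₃, -⟩ := h.locallyTrivial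
  refine IsCov.isAffineHom h₃ ⟨h₁, h₂⟩ ?_
  rw [Over.snd_left]
  exact MorphismProperty.pullback_snd (P := affineProp) _ _ hG

end IsTorsor

namespace Torsor

lemma lift_act_total {X Y : Torsor G} (f : X ⟶ Y) {T : Sch F} (g : T ⟶ G) (x : T ⟶ X.total) :
    lift g x ≫ X.act ≫ f.total = lift g (x ≫ f.total) ≫ Y.act := by
  have := f.equivariant
  rw [this, lift_whiskerLeft_assoc]

@[simp] lemma id_total (X : Torsor G) : Hom.total (𝟙 X) = 𝟙 X.total := rfl

@[simp] lemma comp_total {X Y Z : Torsor G} (f : X ⟶ Y) (g : Y ⟶ Z) :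
    (f ≫ g).total = f.total ≫ g.total := rfl

/-- A morphism of torsors is determined by the morphism of total spaces. -/
lemma hom_ext {X Y : Torsor G} {f g : X ⟶ Y} (h : f.total = g.total) : f = g := by
  refine Hom.ext (X.isTorsor.hasLocalSections.hom_ext ?_) h
  rw [← f.isPullback.w, ← g.isPullback.w, h]

/-- Every equivariant morphism of torsors over a morphism of bases is a morphism of the classifying
stack, because the square is automatically cartesian. -/
def homMk {X Y : Torsor G} (base : X.base ⟶ Y.base) (total : X.total ⟶ Y.total)
    (w : total ≫ Y.proj = X.proj ≫ base)
    (h : ∀ {T : Sch F} (g : T ⟶ G) (x : T ⟶ X.total),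
      lift g x ≫ X.act ≫ total = lift g (x ≫ total) ≫ Y.act) : X ⟶ Y where
  base := base
  total := total
  isPullback := by
    refine isPullback_of_locally w ?_ ?_
    · intro T a b e₁ e₂
      obtain ⟨g, rfl⟩ := X.isTorsor.exists_div e₂
      rw [Category.assoc, h, ← Y.isTorsor.isAction.one_act (a ≫ total),
        Y.isTorsor.isAction.one_act (a ≫ total)] at e₁
      have : g = 1 := Y.isTorsor.free (e₁.symm.trans (Y.isTorsor.isAction.one_act _).symm)
      rw [this, X.isTorsor.isAction.one_act]
    · intro T y s e
      obtain ⟨T', c, x, hc, hx⟩ := X.isTorsor.hasLocalSections.exists_lift s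
      obtain ⟨g, hg⟩ := Y.isTorsor.exists_div (x := x ≫ total) (y := c ≫ y) (by
        rw [Category.assoc, Category.assoc, w, e, reassoc_of% hx])
      exact ⟨T', c, lift g x ≫ X.act, hc, by rw [Category.assoc, h, hg], by
        rw [Category.assoc, X.isTorsor.act_proj, hx]⟩
  equivariant := hom_ext_point₂ fun g x => by rw [h, lift_whiskerLeft_assoc]

/-- A morphism of torsors over an isomorphism is an isomorphism. -/
lemma isIso_of_base {X Y : Torsor G} (f : X ⟶ Y) [IsIso f.base] : IsIso f := by
  have : IsIso f.total := f.isPullback.isIso_fst_of_isIso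
  refine ⟨homMk (inv f.base) (inv f.total) ?_ ?_, ?_, ?_⟩
  · rw [IsIso.inv_comp_eq, ← Category.assoc, f.isPullback.w]; simp
  · intro T g x
    rw [← cancel_mono f.total]
    have := lift_act_total f g (x ≫ inv f.total)
    simp only [Category.assoc, IsIso.inv_hom_id, Category.comp_id] at this ⊢
    exact this.symm
  · exact hom_ext (by simp [homMk])
  · exact hom_ext (by simp [homMk])

/-- The point `(g, t)` of the trivial torsor `G × T`. -/
def trivialPt {T R : Sch F} (g : R ⟶ G) (t : R ⟶ T) : R ⟶ (trivial G T).total := lift g t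

lemma exists_trivialPt {T R : Sch F} (y : R ⟶ (trivial G T).total) :
    ∃ (g : R ⟶ G) (t : R ⟶ T), y = trivialPt g t :=
  have key (z : R ⟶ G ⊗ T) : z = lift (z ≫ fst G T) (z ≫ snd G T) := by simp
  ⟨_, _, key y⟩

lemma comp_trivialPt {T R R' : Sch F} (a : R' ⟶ R) (g : R ⟶ G) (t : R ⟶ T) :
    a ≫ trivialPt g t = trivialPt (a ≫ g) (a ≫ t) :=
  comp_lift a g t

lemma trivialPt_proj {T R : Sch F} (g : R ⟶ G) (t : R ⟶ T) :
    trivialPt g t ≫ (trivial G T).proj = t :=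
  lift_snd g t

lemma lift_trivialPt_act {T R : Sch F} (k g : R ⟶ G) (t : R ⟶ T) :
    lift k (trivialPt g t) ≫ (trivial G T).act = trivialPt (k * g) t :=
  lift_trivialAct k g t

lemma trivialPt_hom_ext {T Z : Sch F} {f f' : (trivial G T).total ⟶ Z}
    (h : ∀ {R : Sch F} (g : R ⟶ G) (t : R ⟶ T), trivialPt g t ≫ f = trivialPt g t ≫ f') :
    f = f' := by
  obtain ⟨g, t, e⟩ := exists_trivialPt (𝟙 (trivial G T).total)
  rw [← Category.id_comp f, ← Category.id_comp f', e, h]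

/-- The morphism `(g, t) ↦ g • x(t)`. -/
def orbitMap {X : Torsor G} {T : Sch F} (x : T ⟶ X.total) : (trivial G T).total ⟶ X.total :=
  lift (fst G T) (snd G T ≫ x) ≫ X.act

lemma trivialPt_orbitMap {X : Torsor G} {T R : Sch F} (x : T ⟶ X.total) (g : R ⟶ G) (t : R ⟶ T) :
    trivialPt g t ≫ orbitMap x = lift g (t ≫ x) ≫ X.act := by
  change lift g t ≫ lift (fst G T) (snd G T ≫ x) ≫ X.act = _
  rw [comp_lift_assoc, lift_fst, lift_snd_assoc]

/-- The orbit morphism of a point `x` of a torsor: the morphism `(g, t) ↦ g • x(t)` from the trivial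
torsor. -/
def orbit {X : Torsor G} {T : Sch F} (x : T ⟶ X.total) : trivial G T ⟶ X :=
  homMk (X := trivial G T) (x ≫ X.proj) (orbitMap x)
    (trivialPt_hom_ext fun g t => by
      rw [← Category.assoc, trivialPt_orbitMap, Category.assoc, X.isTorsor.act_proj,
        ← Category.assoc, trivialPt_proj, Category.assoc]
      rfl)
    (fun {R} g y => by
      obtain ⟨k, t, rfl⟩ := exists_trivialPt y
      rw [← Category.assoc, lift_trivialPt_act, trivialPt_orbitMap, trivialPt_orbitMap,
        X.isTorsor.isAction.mul_act])

lemma trivialPt_orbit {X : Torsor G} {T R : Sch F} (x : T ⟶ X.total) (g : R ⟶ G) (t : R ⟶ T) :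
    trivialPt g t ≫ (orbit x).total = lift g (t ≫ x) ≫ X.act :=
  trivialPt_orbitMap x g t

lemma trivialPt_one_orbit {X : Torsor G} {T R : Sch F} (x : T ⟶ X.total) (t : R ⟶ T) :
    trivialPt 1 t ≫ (orbit x).total = t ≫ x := by
  rw [trivialPt_orbit, X.isTorsor.isAction.one_act]

@[simp] lemma orbit_base {X : Torsor G} {T : Sch F} (x : T ⟶ X.total) :
    (orbit x).base = x ≫ X.proj := rfl

lemma orbit_comp {X Y : Torsor G} {T : Sch F} (x : T ⟶ X.total) (f : X ⟶ Y) :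
    orbit x ≫ f = orbit (x ≫ f.total) := by
  refine hom_ext (trivialPt_hom_ext fun g t => ?_)
  rw [comp_total, ← Category.assoc, trivialPt_orbit, Category.assoc, lift_act_total,
    trivialPt_orbit, Category.assoc]

lemma eq_orbit {X : Torsor G} {T : Sch F} (f : trivial G T ⟶ X) :
    f = orbit (trivialPt 1 (𝟙 T) ≫ f.total) := by
  refine hom_ext (trivialPt_hom_ext fun g t => ?_)
  have h := lift_act_total f g (trivialPt 1 t)
  rw [trivialPt_orbit, ← Category.assoc, comp_trivialPt, comp_one, Category.comp_id, ← h,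
    ← Category.assoc, lift_trivialPt_act, _root_.mul_one]

lemma translate_eq_orbit {T : Sch F} (g : T ⟶ G) :
    translate g = orbit (X := trivial G (𝟙_ (Sch F))) (trivialPt g (toUnit T)) := by
  rw [eq_orbit (translate g)]
  congr 1
  change lift 1 (𝟙 T) ≫ translateMap g = lift g (toUnit T)
  rw [translateMap, comp_lift, comp_mul, lift_fst, lift_snd_assoc, Category.id_comp,
    _root_.one_mul]
  exact congrArg _ (toUnit_unique _ _)

/-- Two morphisms of torsors agree if they agree on one point of each fibre. -/
lemma hom_ext_of_section {X Y : Torsor G} {f g : X ⟶ Y} {T : Sch F} (x : T ⟶ X.total)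
    [h' : IsIso (x ≫ X.proj)] (h : x ≫ f.total = x ≫ g.total) : f = g := by
  have : IsIso (orbit x).base := h'
  have := isIso_of_base (orbit x)
  rw [← cancel_epi (orbit x), orbit_comp, orbit_comp, h]

end Torsor

/-- The left action `g • x = x g⁻¹` attached to a right action. -/
def leftOfRight {P : Sch F} (act : P ⊗ G ⟶ P) : G ⊗ P ⟶ P :=
  lift (snd G P) (fst G P)⁻¹ ≫ act

lemma lift_leftOfRight {P : Sch F} (act : P ⊗ G ⟶ P) {T : Sch F} (g : T ⟶ G) (x : T ⟶ P) :
    lift g x ≫ leftOfRight act = lift x g⁻¹ ≫ act := by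
  simp [leftOfRight, comp_lift_assoc, GrpObj.comp_inv]

/-- The right action `x • g = g⁻¹ x` attached to a left action. -/
def rightOfLeft {P : Sch F} (act : G ⊗ P ⟶ P) : P ⊗ G ⟶ P :=
  lift (snd P G)⁻¹ (fst P G) ≫ act

lemma lift_rightOfLeft {P : Sch F} (act : G ⊗ P ⟶ P) {T : Sch F} (g : T ⟶ G) (x : T ⟶ P) :
    lift x g ≫ rightOfLeft act = lift g⁻¹ x ≫ act := by
  simp [rightOfLeft, comp_lift_assoc, GrpObj.comp_inv]

namespace IsRightTorsor

variable {P S : Sch F} {act : P ⊗ G ⟶ P} {p : P ⟶ S}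

lemma act_proj (h : IsRightTorsor act p) {T : Sch F} (x : T ⟶ P) (g : T ⟶ G) :
    lift x g ≫ act ≫ p = x ≫ p := by
  rw [h.isPullback.w, lift_fst_assoc]

lemma free (h : IsRightTorsor act p) {T : Sch F} {g k : T ⟶ G} {x : T ⟶ P}
    (e : lift x g ≫ act = lift x k ≫ act) : g = k := by
  have := h.isPullback.hom_ext e (by simp)
  simpa using this =≫ snd P G

lemma exists_div (h : IsRightTorsor act p) {T : Sch F} {x y : T ⟶ P} (e : x ≫ p = y ≫ p) :
    ∃ g : T ⟶ G, lift x g ≫ act = y := by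
  obtain ⟨z, h₁, h₂⟩ := h.isPullback.exists_lift y x e.symm
  refine ⟨z ≫ snd P G, ?_⟩
  rw [← h₂, ← comp_lift, lift_fst_snd, Category.comp_id, h₁]

lemma hasLocalSections (h : IsRightTorsor act p) : HasLocalSections p := by
  obtain ⟨S', c, t, h₁, h₂, h₃, -⟩ := h.locallyTrivial
  exact ⟨S', c, lift (𝟙 S') 1 ≫ t, ⟨h₁, h₂⟩, by rw [Category.assoc, h₃.w, lift_fst_assoc,
    Category.id_comp]⟩

/-- Right torsors in terms of points. -/
lemma of_points (hact : IsRightAction act)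
    (hp : ∀ {T : Sch F} (g : T ⟶ G) (x : T ⟶ P), lift x g ≫ act ≫ p = x ≫ p)
    (hfree : ∀ {T : Sch F} (g k : T ⟶ G) (x : T ⟶ P), lift x g ≫ act = lift x k ≫ act → g = k)
    (htrans : ∀ {T : Sch F} (x y : T ⟶ P), x ≫ p = y ≫ p →
      ∃ (T' : Sch F) (c : T' ⟶ T) (g : T' ⟶ G), IsCov c ∧ lift (c ≫ x) g ≫ act = c ≫ y)
    (hloc : HasLocalSections p) : IsRightTorsor act p := by
  refine ⟨hact, ?_, ?_⟩
  · refine isPullback_of_locally (hom_ext_point₂ fun x g => ?_) ?_ ?_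
    · rw [hp, lift_fst_assoc]
    · intro T a b e₁ e₂
      obtain ⟨x, g, rfl⟩ : ∃ u x, a = lift u x := ⟨a ≫ fst _ _, a ≫ snd _ _, by simp⟩
      obtain ⟨y, k, rfl⟩ : ∃ u x, b = lift u x := ⟨b ≫ fst _ _, b ≫ snd _ _, by simp⟩
      obtain rfl : x = y := by simpa using e₂
      rw [hfree g k x e₁]
    · intro T y x e
      obtain ⟨T', c, g, hc, hg⟩ := htrans x y e.symm
      exact ⟨T', c, lift (c ≫ x) g, hc, hg, lift_fst _ _⟩
  · obtain ⟨S', c, s, hc, hs⟩ := hloc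
    refine ⟨S', c, lift (fst S' G ≫ s) (snd S' G) ≫ act, hc.1, hc.2, ?_, fun s' g k => ?_⟩
    · refine isPullback_of_locally ?_ ?_ ?_
      · rw [Category.assoc, hp, Category.assoc, hs]
      · intro T a b e₁ e₂
        obtain ⟨x, g, rfl⟩ : ∃ u x, a = lift u x := ⟨a ≫ fst _ _, a ≫ snd _ _, by simp⟩
        obtain ⟨y, k, rfl⟩ : ∃ u x, b = lift u x := ⟨b ≫ fst _ _, b ≫ snd _ _, by simp⟩
        obtain rfl : x = y := by simpa using e₂
        simp only [comp_lift_assoc, lift_snd, lift_fst_assoc] at e₁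
        rw [hfree g k _ e₁]
      · intro T y x e
        obtain ⟨T', d, g, hd, hg⟩ := htrans (x ≫ s) y (by rw [Category.assoc, hs, e])
        exact ⟨T', d, lift (d ≫ x) g, hd, by simpa [comp_lift_assoc] using hg, lift_fst _ _⟩
    · simp only [comp_lift_assoc, lift_snd, lift_fst_assoc, hact.act_mul]

lemma leftOfRight (h : IsRightTorsor act p) : IsTorsor (leftOfRight act) p := by
  refine IsTorsor.of_points ⟨fun x => ?_, fun g k x => ?_⟩ (fun g x => ?_) (fun g k x e => ?_)
    (fun {T} x y e => ?_) h.hasLocalSections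
  · rw [lift_leftOfRight, inv_one, h.isRightAction.act_one]
  · rw [lift_leftOfRight, lift_leftOfRight, lift_leftOfRight, mul_inv_rev, h.isRightAction.act_mul]
  · rw [← Category.assoc, lift_leftOfRight, Category.assoc, h.act_proj]
  · rw [lift_leftOfRight, lift_leftOfRight] at e
    exact inv_injective (h.free e)
  · obtain ⟨g, hg⟩ := h.exists_div e
    exact ⟨T, 𝟙 T, g⁻¹, IsCov.of_isIso _, by
      rw [lift_leftOfRight, inv_inv, Category.id_comp, Category.id_comp, hg]⟩

end IsRightTorsor

lemma IsTorsor.rightOfLeft {P S : Sch F} {act : G ⊗ P ⟶ P} {p : P ⟶ S} (h : IsTorsor act p) :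
    IsRightTorsor (rightOfLeft act) p := by
  refine .of_points ⟨fun x => ?_, fun x g k => ?_⟩ (fun g x => ?_) (fun g k x e => ?_)
    (fun {T} x y e => ?_) h.hasLocalSections
  · rw [lift_rightOfLeft, inv_one, h.isAction.one_act]
  · rw [lift_rightOfLeft, lift_rightOfLeft, lift_rightOfLeft, mul_inv_rev, h.isAction.mul_act]
  · rw [← Category.assoc, lift_rightOfLeft, Category.assoc, h.act_proj]
  · rw [lift_rightOfLeft, lift_rightOfLeft] at e
    exact inv_injective (h.free e)
  · obtain ⟨g, hg⟩ := h.exists_div e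
    exact ⟨T, 𝟙 T, g⁻¹, IsCov.of_isIso _, by
      rw [lift_rightOfLeft, inv_inv, Category.id_comp, Category.id_comp, hg]⟩

end TorsorBasics

/-! ### Morphisms of classifying stacks -/

noncomputable section StackMorphisms

open AlgebraicGeometry Limits

variable {F : Type u} [Field F] {G H : Sch F} [GrpObj G] [GrpObj H]

/-- Morphisms of stacks `[G\pt] ⟶ [H\pt]`. -/
abbrev StackMap (G H : Sch F) [GrpObj G] [GrpObj H] :=
  BasedFunctor (classifyingStack G) (classifyingStack H)

namespace StackMap

/-- The `H`-torsor `Φ(X)`. -/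
def objT (Φ : StackMap G H) (X : Torsor G) : Torsor H := Φ.toFunctor.obj X

/-- The morphism of `H`-torsors `Φ(f)`. -/
def mapT (Φ : StackMap G H) {X Y : Torsor G} (f : X ⟶ Y) : Φ.objT X ⟶ Φ.objT Y :=
  Φ.toFunctor.map f

lemma objT_base (Φ : StackMap G H) (X : Torsor G) : (Φ.objT X).base = X.base := Φ.w_obj X

/-- The projection of `Φ(X)` to the base of `X`. -/
def pr (Φ : StackMap G H) (X : Torsor G) : (Φ.objT X).total ⟶ X.base :=
  (Φ.objT X).proj ≫ eqToHom (Φ.objT_base X)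

lemma mapT_comp (Φ : StackMap G H) {X Y Z : Torsor G} (f : X ⟶ Y) (g : Y ⟶ Z) :
    Φ.mapT (f ≫ g) = Φ.mapT f ≫ Φ.mapT g :=
  Φ.toFunctor.map_comp f g

lemma mapT_base (Φ : StackMap G H) {X Y : Torsor G} (f : X ⟶ Y) :
    (Φ.mapT f).base = eqToHom (Φ.objT_base X) ≫ f.base ≫ eqToHom (Φ.objT_base Y).symm :=
  Functor.congr_hom Φ.w (X := X) (Y := Y) f

lemma isTorsor_pr (Φ : StackMap G H) (X : Torsor G) : IsTorsor (Φ.objT X).act (Φ.pr X) := by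
  have key : ∀ {S : Sch F} (h : (Φ.objT X).base = S),
      IsTorsor (Φ.objT X).act ((Φ.objT X).proj ≫ eqToHom h) := by
    rintro S rfl
    simpa using (Φ.objT X).isTorsor
  exact key _

lemma isPullback_mapT (Φ : StackMap G H) {X Y : Torsor G} (f : X ⟶ Y) :
    IsPullback (Φ.mapT f).total (Φ.pr X) (Φ.pr Y) f.base := by
  have sq : IsPullback (Φ.mapT f).base (eqToHom (Φ.objT_base X)) (eqToHom (Φ.objT_base Y))
      f.base := IsPullback.of_vert_isIso ⟨by rw [mapT_base]; simp⟩
  exact (Φ.mapT f).isPullback.paste_vert sq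

/-- A morphism of stacks from an assignment on torsors that preserves the base and an equivariant
assignment on morphisms. -/
def mkOfTotal (Y : Torsor G → Torsor H) (hY : ∀ X, (Y X).base = X.base)
    (m : ∀ {X X' : Torsor G} (_ : X ⟶ X'), (Y X).total ⟶ (Y X').total)
    (w : ∀ {X X' : Torsor G} (f : X ⟶ X'), m f ≫ (Y X').proj ≫ eqToHom (hY X') =
      (Y X).proj ≫ eqToHom (hY X) ≫ f.base)
    (h : ∀ {X X' : Torsor G} (f : X ⟶ X') {T : Sch F} (g : T ⟶ H) (y : T ⟶ (Y X).total),
      lift g y ≫ (Y X).act ≫ m f = lift g (y ≫ m f) ≫ (Y X').act)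
    (m_id : ∀ X, m (𝟙 X) = 𝟙 _)
    (m_comp : ∀ {X X' X'' : Torsor G} (f : X ⟶ X') (f' : X' ⟶ X''), m (f ≫ f') = m f ≫ m f') :
    StackMap G H where
  obj (X : Torsor G) := (Y X : Torsor H)
  map {X X'} f := Torsor.homMk (X := Y X) (Y := Y X')
    (eqToHom (hY X) ≫ Torsor.Hom.base f ≫ eqToHom (hY X').symm) (m f)
    (by simpa using w f =≫ eqToHom (hY X').symm) (h f)
  map_id X := Torsor.hom_ext (m_id X)
  map_comp f g := Torsor.hom_ext (m_comp f g)
  w := CategoryTheory.Functor.ext hY fun X X' f => rfl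

/-- The component at `X` of a natural transformation. -/
def natApp {Φ Φ' : StackMap G H} (α : Φ ⟶ Φ') (X : Torsor G) : Φ.objT X ⟶ Φ'.objT X :=
  α.toNatTrans.app X

lemma natApp_pr {Φ Φ' : StackMap G H} (α : Φ ⟶ Φ') (X : Torsor G) :
    (natApp α X).total ≫ Φ'.pr X = Φ.pr X := by
  have h := @IsHomLift.fac' _ _ _ _ (classifyingStack H).p _ _ _ _ _ _ (α.isHomLift' X)
  have h' : (natApp α X).base =
    eqToHom (Φ.objT_base X) ≫ 𝟙 _ ≫ eqToHom (Φ'.objT_base X).symm := h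
  have := (natApp α X).isPullback.w
  rw [pr, reassoc_of% this, h', pr]
  simp

lemma natApp_naturality {Φ Φ' : StackMap G H} (α : Φ ⟶ Φ') {X Y : Torsor G} (f : X ⟶ Y) :
    (Φ.mapT f).total ≫ (natApp α Y).total = (natApp α X).total ≫ (Φ'.mapT f).total :=
  congrArg Torsor.Hom.total (α.toNatTrans.naturality (X := X) (Y := Y) f)

lemma nat_ext {Φ Φ' : StackMap G H} {α β : Φ ⟶ Φ'}
    (h : ∀ X, (natApp α X).total = (natApp β X).total) : α = β := by
  apply BasedNatTrans.ext
  apply NatTrans.ext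
  funext X
  exact Torsor.hom_ext (h X)

/-- A natural transformation from its components on total spaces. -/
def natMk {Φ Φ' : StackMap G H} (a : ∀ X, (Φ.objT X).total ⟶ (Φ'.objT X).total)
    (w : ∀ X, a X ≫ Φ'.pr X = Φ.pr X)
    (h : ∀ X {T : Sch F} (g : T ⟶ H) (y : T ⟶ (Φ.objT X).total),
      lift g y ≫ (Φ.objT X).act ≫ a X = lift g (y ≫ a X) ≫ (Φ'.objT X).act)
    (nat : ∀ {X Y : Torsor G} (f : X ⟶ Y),
      (Φ.mapT f).total ≫ a Y = a X ≫ (Φ'.mapT f).total) : Φ ⟶ Φ' where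
  app X := Torsor.homMk (X := Φ.objT X) (Y := Φ'.objT X)
    (eqToHom ((Φ.objT_base X).trans (Φ'.objT_base X).symm)) (a X)
    (by
      have := w X =≫ eqToHom (Φ'.objT_base X).symm
      simpa [pr] using this) (h X)
  naturality X Y f := Torsor.hom_ext (nat f)
  isHomLift' X := by
    refine IsHomLift.of_fac' _ _ _ (Φ.objT_base X) (Φ'.objT_base X) ?_
    change eqToHom ((Φ.objT_base X).trans (Φ'.objT_base X).symm) =
      eqToHom (Φ.objT_base X) ≫ 𝟙 _ ≫ eqToHom (Φ'.objT_base X).symm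
    simp

lemma isIso_natApp {Φ Φ' : StackMap G H} (α : Φ ⟶ Φ') (X : Torsor G) : IsIso (natApp α X) := by
  have h : (natApp α X).base =
    eqToHom (Φ.objT_base X) ≫ 𝟙 _ ≫ eqToHom (Φ'.objT_base X).symm :=
    @IsHomLift.fac' _ _ _ _ (classifyingStack H).p _ _ _ _ _ _ (α.isHomLift' X)
  have : IsIso (natApp α X).base := by rw [h]; infer_instance
  exact Torsor.isIso_of_base _

lemma isIso_natApp_total {Φ Φ' : StackMap G H} (α : Φ ⟶ Φ') (X : Torsor G) :
    IsIso (natApp α X).total := by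
  have := isIso_natApp α X
  refine ⟨Torsor.Hom.total (inv (natApp α X)), ?_, ?_⟩
  · rw [← Torsor.comp_total, IsIso.hom_inv_id, Torsor.id_total]
  · rw [← Torsor.comp_total, IsIso.inv_hom_id, Torsor.id_total]

/-- Natural transformations of morphisms of stacks `[G\pt] ⟶ [H\pt]` are invertible. -/
lemma isIso_nat {Φ Φ' : StackMap G H} (α : Φ ⟶ Φ') : IsIso α := by
  have h (X) : IsIso (α.toNatTrans.app X) := isIso_natApp α X
  have : IsIso (X := Φ.toFunctor) α.toNatTrans := NatIso.isIso_of_isIso_app _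
  exact BasedNatIso.isIso_of_toNatTrans_isIso α

lemma _root_.StrongInner.IsStackEquivalence.fullyFaithful {Φ : StackMap G H}
    (h : IsStackEquivalence Φ) : Φ.toFunctor.Full ∧ Φ.toFunctor.Faithful := by
  obtain ⟨Ψ, ⟨e₁⟩, ⟨e₂⟩⟩ := h
  let e : (classifyingStack G).obj ≌ (classifyingStack H).obj :=
    CategoryTheory.Equivalence.mk Φ.toFunctor Ψ.toFunctor
      ((BasedNatTrans.forgetful _ _).mapIso e₁).symm ((BasedNatTrans.forgetful _ _).mapIso e₂)
  exact ⟨inferInstanceAs e.functor.Full, inferInstanceAs e.functor.Faithful⟩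

end StackMap

end StackMorphisms

/-! ### The pairing of the value at the trivial torsor with a torsor -/

noncomputable section Pairing

open AlgebraicGeometry Limits StrongInner.Torsor

variable {F : Type u} [Field F] {G H : Sch F} [GrpObj G] [GrpObj H]

namespace StackMap

variable (Φ : StackMap G H)

/-- The scheme `Φ(G_l)`. -/
abbrev fiber : Sch F := (Φ.objT (trivial G (𝟙_ (Sch F)))).total

lemma isPullback_translate_one (T : Sch F) :
    IsPullback (Φ.mapT (translate (1 : T ⟶ G))).total (Φ.pr (trivial G T))
      (Φ.pr (trivial G (𝟙_ (Sch F)))) (toUnit T) :=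
  Φ.isPullback_mapT (translate (1 : T ⟶ G))

variable {Φ} {T : Sch F}

/-- The point of `Φ(G × T)` over the identity of `T` that corresponds to a point `p` of `Φ(G_l)`
with values in `T`. -/
def sec (p : T ⟶ Φ.fiber) : T ⟶ (Φ.objT (trivial G T)).total :=
  (Φ.isPullback_translate_one T).lift p (𝟙 T) (toUnit_unique _ _)

lemma sec_translate_one (p : T ⟶ Φ.fiber) : sec p ≫ (Φ.mapT (translate (1 : T ⟶ G))).total = p :=
  (Φ.isPullback_translate_one T).lift_fst _ _ _

lemma sec_pr (p : T ⟶ Φ.fiber) : sec p ≫ Φ.pr (trivial G T) = 𝟙 T :=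
  (Φ.isPullback_translate_one T).lift_snd _ _ _

lemma eq_sec {p : T ⟶ Φ.fiber} {z : T ⟶ (Φ.objT (trivial G T)).total}
    (h₁ : z ≫ (Φ.mapT (translate (1 : T ⟶ G))).total = p) (h₂ : z ≫ Φ.pr (trivial G T) = 𝟙 T) :
    z = sec p :=
  (Φ.isPullback_translate_one T).hom_ext (by rw [h₁, sec_translate_one]) (h₂.trans (sec_pr p).symm)

/-- The pairing `P × X ⟶ Φ(X)` of `P = Φ(G_l)` with a torsor `X`: a point `x` of `X` defines a
morphism from the trivial torsor to `X`, hence a morphism from (the restriction of) `P` to `Φ(X)`,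
which is applied to the point `p`. -/
def pair {X : Torsor G} (p : T ⟶ Φ.fiber) (x : T ⟶ X.total) : T ⟶ (Φ.objT X).total :=
  sec p ≫ (Φ.mapT (orbit x)).total

lemma mapT_total_comp {X Y Z : Torsor G} (f : X ⟶ Y) (g : Y ⟶ Z) :
    (Φ.mapT (f ≫ g)).total = (Φ.mapT f).total ≫ (Φ.mapT g).total := by
  rw [mapT_comp, comp_total]

lemma pair_mapT {X Y : Torsor G} (p : T ⟶ Φ.fiber) (x : T ⟶ X.total) (f : X ⟶ Y) :
    pair p x ≫ (Φ.mapT f).total = pair p (x ≫ f.total) := by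
  rw [pair, Category.assoc, ← mapT_total_comp, orbit_comp, pair]

lemma pair_pr {X : Torsor G} (p : T ⟶ Φ.fiber) (x : T ⟶ X.total) :
    pair p x ≫ Φ.pr X = x ≫ X.proj := by
  rw [pair, Category.assoc, (Φ.isPullback_mapT (orbit x)).w, ← Category.assoc, sec_pr, orbit_base]
  exact Category.id_comp _

lemma orbit_trivialPt_comp_orbit {X : Torsor G} {T' : Sch F} (g : T' ⟶ G) (f : T' ⟶ T)
    (x : T ⟶ X.total) :
    orbit (X := trivial G T) (trivialPt g f) ≫ orbit x = orbit (lift g (f ≫ x) ≫ X.act) := by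
  rw [orbit_comp, trivialPt_orbit]

lemma orbit_trivialPt_comp_translate {T' : Sch F} (g : T' ⟶ G) (f : T' ⟶ T) (k : T ⟶ G) :
    orbit (X := trivial G T) (trivialPt g f) ≫ translate k = translate (g * (f ≫ k)) := by
  rw [translate_eq_orbit, translate_eq_orbit, orbit_comp, trivialPt_orbit, comp_trivialPt,
    lift_trivialPt_act, toUnit_unique (f ≫ toUnit T) (toUnit T')]

lemma orbit_trivialPt_base {T' : Sch F} (g : T' ⟶ G) (f : T' ⟶ T) :
    (orbit (X := trivial G T) (trivialPt g f)).base = f :=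
  trivialPt_proj g f

/-- A point of `Φ(G × T)` is determined by its images in `Φ(G_l)` and in `T`. -/
lemma eq_sec_orbit {T' : Sch F} {w : T' ⟶ (Φ.objT (trivial G T)).total} {p : T' ⟶ Φ.fiber}
    {t : T' ⟶ T} (h₁ : w ≫ (Φ.mapT (translate (1 : T ⟶ G))).total = p)
    (h₂ : w ≫ Φ.pr (trivial G T) = t) :
    w = sec p ≫ (Φ.mapT (orbit (X := trivial G T) (trivialPt 1 t))).total := by
  refine (Φ.isPullback_translate_one T).hom_ext ?_ ?_
  · rw [Category.assoc, ← mapT_total_comp, orbit_trivialPt_comp_translate, comp_one,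
      _root_.mul_one, sec_translate_one, h₁]
  · rw [Category.assoc, (Φ.isPullback_mapT (orbit _)).w, ← Category.assoc, sec_pr,
      orbit_trivialPt_base]
    exact h₂.trans (Category.id_comp _).symm

lemma comp_sec {T' : Sch F} (f : T' ⟶ T) (p : T ⟶ Φ.fiber) :
    f ≫ sec p = sec (f ≫ p) ≫ (Φ.mapT (orbit (X := trivial G T) (trivialPt 1 f))).total := by
  have e : (f ≫ sec p) ≫ Φ.pr (trivial G T) = f :=
    (Category.assoc _ _ _).trans ((congrArg (f ≫ ·) (sec_pr p)).trans (Category.comp_id f))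
  exact eq_sec_orbit (by rw [Category.assoc, sec_translate_one]) e

lemma comp_pair {X : Torsor G} {T' : Sch F} (f : T' ⟶ T) (p : T ⟶ Φ.fiber) (x : T ⟶ X.total) :
    f ≫ pair p x = pair (f ≫ p) (f ≫ x) := by
  rw [pair, ← Category.assoc, comp_sec, Category.assoc, ← mapT_total_comp,
    orbit_trivialPt_comp_orbit, X.isTorsor.isAction.one_act, pair]

/-- The right translation of a point `p` of `Φ(G_l)` by a point `g` of `G`. -/
def actPt (p : T ⟶ Φ.fiber) (g : T ⟶ G) : T ⟶ Φ.fiber :=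
  pair (X := trivial G (𝟙_ (Sch F))) p (trivialPt g (toUnit T))

lemma actPt_eq (p : T ⟶ Φ.fiber) (g : T ⟶ G) :
    actPt p g = sec p ≫ (Φ.mapT (translate g)).total := by
  rw [actPt, pair, translate_eq_orbit]

lemma sec_actPt (p : T ⟶ Φ.fiber) (g : T ⟶ G) :
    sec (actPt p g) = sec p ≫ (Φ.mapT (orbit (X := trivial G T) (trivialPt g (𝟙 T)))).total := by
  refine (eq_sec ?_ ?_).symm
  · rw [Category.assoc, ← mapT_total_comp, orbit_trivialPt_comp_translate, comp_one,
      _root_.mul_one, actPt_eq]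
  · rw [Category.assoc, (Φ.isPullback_mapT (orbit _)).w, ← Category.assoc, sec_pr,
      orbit_trivialPt_base]
    exact Category.id_comp _

/-- The pairing is balanced. -/
lemma pair_actPt {X : Torsor G} (p : T ⟶ Φ.fiber) (g : T ⟶ G) (x : T ⟶ X.total) :
    pair (actPt p g) x = pair p (lift g x ≫ X.act) := by
  rw [pair, sec_actPt, Category.assoc, ← mapT_total_comp, orbit_trivialPt_comp_orbit,
    Category.id_comp, pair]

lemma actPt_one (p : T ⟶ Φ.fiber) : actPt p 1 = p := by
  rw [actPt_eq, sec_translate_one]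

lemma actPt_mul (p : T ⟶ Φ.fiber) (g k : T ⟶ G) : actPt p (g * k) = actPt (actPt p g) k := by
  conv_rhs => rw [actPt, pair_actPt, lift_trivialPt_act]
  rfl

lemma lift_act_pair {X : Torsor G} (h : T ⟶ H) (p : T ⟶ Φ.fiber) (x : T ⟶ X.total) :
    pair (lift h p ≫ Torsor.act _) x = lift h (pair p x) ≫ (Φ.objT X).act := by
  have : lift h (sec p) ≫ Torsor.act _ = sec (lift h p ≫ Torsor.act _) := by
    refine eq_sec ?_ ?_
    · rw [Category.assoc, lift_act_total, sec_translate_one]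
    · rw [Category.assoc, (Φ.isTorsor_pr _).act_proj, sec_pr]
  rw [pair, ← this, Category.assoc, lift_act_total, pair]

lemma pair_injective {X : Torsor G} {p p' : T ⟶ Φ.fiber} {x : T ⟶ X.total}
    (h : pair p x = pair p' x) : p = p' := by
  have := (Φ.isPullback_mapT (orbit x)).hom_ext h ((sec_pr p).trans (sec_pr p').symm)
  rw [← sec_translate_one p, this, sec_translate_one]

lemma exists_pair {X : Torsor G} {y : T ⟶ (Φ.objT X).total} {x : T ⟶ X.total}
    (h : y ≫ Φ.pr X = x ≫ X.proj) : ∃ p : T ⟶ Φ.fiber, pair p x = y := by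
  obtain ⟨z, h₁, h₂⟩ := (Φ.isPullback_mapT (orbit x)).exists_lift y (𝟙 T)
    (h.trans (Category.id_comp _).symm)
  exact ⟨_, by rw [pair, ← eq_sec (z := z) rfl h₂, h₁]⟩

lemma sec_natApp {Φ' : StackMap G H} (α : Φ ⟶ Φ') (p : T ⟶ Φ.fiber) :
    sec p ≫ (natApp α _).total = sec (p ≫ (natApp α _).total) := by
  refine eq_sec ?_ ?_
  · rw [Category.assoc, ← natApp_naturality, ← Category.assoc, sec_translate_one]
  · rw [Category.assoc, natApp_pr, sec_pr]

lemma pair_natApp {Φ' : StackMap G H} (α : Φ ⟶ Φ') {X : Torsor G} (p : T ⟶ Φ.fiber)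
    (x : T ⟶ X.total) :
    pair p x ≫ (natApp α X).total = pair (p ≫ (natApp α _).total) x := by
  rw [pair, Category.assoc, natApp_naturality, ← Category.assoc, sec_natApp, pair]

variable (Φ) in
/-- The universal pairing `P × X ⟶ Φ(X)`. -/
def pairing (X : Torsor G) : Φ.fiber ⊗ X.total ⟶ (Φ.objT X).total :=
  pair (fst _ _) (snd _ _)

lemma lift_pairing {X : Torsor G} (p : T ⟶ Φ.fiber) (x : T ⟶ X.total) :
    lift p x ≫ Φ.pairing X = pair p x := by
  rw [pairing, comp_pair, lift_fst, lift_snd]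

variable (Φ) in
/-- The right action of `G` on `Φ(G_l)` which is induced by the right translations of `G_l`. -/
def rightAct : Φ.fiber ⊗ G ⟶ Φ.fiber := actPt (fst _ _) (snd _ _)

lemma lift_rightAct (p : T ⟶ Φ.fiber) (g : T ⟶ G) : lift p g ≫ Φ.rightAct = actPt p g := by
  rw [rightAct, actPt, comp_pair, comp_trivialPt, lift_fst, lift_snd, actPt,
    toUnit_unique (lift p g ≫ toUnit _) (toUnit T)]

variable (Φ) in
lemma isRightAction_rightAct : IsRightAction Φ.rightAct where
  act_one p := by rw [lift_rightAct, actPt_one]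
  act_mul p g k := by rw [lift_rightAct, lift_rightAct, lift_rightAct, actPt_mul]

/-- The pairing exhibits `Φ(X)` as the quotient of `P × X` by the diagonal action of `G`, for a
right action `right` on a scheme `P` which corresponds to the one on `Φ(G_l)` under `e : P ≅ Φ(G_l)`.
-/
lemma isTorsor_pairing {P : Sch F} {right : P ⊗ G ⟶ P} (e : P ≅ Φ.fiber)
    (he : ∀ {T : Sch F} (p : T ⟶ P) (g : T ⟶ G), lift p g ≫ right ≫ e.hom = actPt (p ≫ e.hom) g)
    (X : Torsor G) {act : G ⊗ (P ⊗ X.total) ⟶ P ⊗ X.total}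
    (hact : ∀ {T : Sch F} (g : T ⟶ G) (p : T ⟶ P) (x : T ⟶ X.total),
      lift g (lift p x) ≫ act = lift (lift p g⁻¹ ≫ right) (lift g x ≫ X.act)) :
    IsTorsor act ((e.hom ▷ X.total) ≫ Φ.pairing X) := by
  have hq {T : Sch F} (p : T ⟶ P) (x : T ⟶ X.total) :
      lift p x ≫ (e.hom ▷ X.total) ≫ Φ.pairing X = pair (p ≫ e.hom) x := by
    rw [lift_whiskerRight_assoc, lift_pairing]
  have act_one {T : Sch F} (p : T ⟶ P) : lift p 1 ≫ right = p := by
    rw [← cancel_mono e.hom, Category.assoc, he, actPt_one]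
  have act_mul {T : Sch F} (p : T ⟶ P) (g k : T ⟶ G) :
      lift p (g * k) ≫ right = lift (lift p g ≫ right) k ≫ right := by
    rw [← cancel_mono e.hom, Category.assoc, he, Category.assoc, he, Category.assoc, he, actPt_mul]
  refine IsTorsor.of_points ⟨fun y => ?_, fun g k y => ?_⟩ (fun g y => ?_) (fun g k y e => ?_)
      (fun {T} y y' e' => ?_) (.of_exists_lift fun {T} y => ?_)
  · obtain ⟨p, x, rfl⟩ : ∃ p x, y = lift p x := ⟨y ≫ fst _ _, y ≫ snd _ _, by simp⟩
    rw [hact, inv_one, act_one, X.isTorsor.isAction.one_act]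
  · obtain ⟨p, x, rfl⟩ : ∃ p x, y = lift p x := ⟨y ≫ fst _ _, y ≫ snd _ _, by simp⟩
    rw [hact, hact, hact, mul_inv_rev, act_mul, X.isTorsor.isAction.mul_act]
  · obtain ⟨p, x, rfl⟩ : ∃ p x, y = lift p x := ⟨y ≫ fst _ _, y ≫ snd _ _, by simp⟩
    rw [← Category.assoc, hact, hq, hq, Category.assoc, he, pair_actPt,
      X.isTorsor.isAction.inv_act]
  · obtain ⟨p, x, rfl⟩ : ∃ p x, y = lift p x := ⟨y ≫ fst _ _, y ≫ snd _ _, by simp⟩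
    rw [hact, hact] at e
    exact X.isTorsor.free (x := x) (by simpa using e =≫ snd _ _)
  · obtain ⟨p, x, rfl⟩ : ∃ p x, y = lift p x := ⟨y ≫ fst _ _, y ≫ snd _ _, by simp⟩
    obtain ⟨p', x', rfl⟩ : ∃ p x, y' = lift p x := ⟨y' ≫ fst _ _, y' ≫ snd _ _, by simp⟩
    rw [hq, hq] at e'
    obtain ⟨g, rfl⟩ := X.isTorsor.exists_div (x := x) (y := x') (by
      rw [← pair_pr (p ≫ e.hom) x, e', pair_pr])
    refine ⟨_, 𝟙 T, g, IsCov.of_isIso _, ?_⟩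
    rw [← pair_actPt] at e'
    have := pair_injective e'
    rw [Category.id_comp, Category.id_comp, hact]
    congr 1
    rw [← cancel_mono e.hom, Category.assoc, he, this, ← actPt_mul, mul_inv_cancel, actPt_one]
  · obtain ⟨T', c, x, hc, hx⟩ := X.isTorsor.hasLocalSections.exists_lift (y ≫ Φ.pr X)
    obtain ⟨p, hp⟩ := exists_pair (y := c ≫ y) (x := x) (by rw [Category.assoc, hx])
    exact ⟨T', c, lift (p ≫ e.inv) x, hc, by rw [hq, Category.assoc, e.inv_hom_id,
      Category.comp_id, hp]⟩

end StackMap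

end Pairing

/-! ### Evaluation at the trivial torsor -/

noncomputable section Evaluation

open AlgebraicGeometry Limits StrongInner.Torsor

variable {F : Type u} [Field F] {G H : Sch F} [GrpObj G] [GrpObj H]

/-- A torsor is the quotient of its total space by the group: invariant morphisms descend. -/
lemma IsTorsor.exists_desc {P S Z : Sch F} {act : G ⊗ P ⟶ P} {p : P ⟶ S} (h : IsTorsor act p)
    (f : P ⟶ Z) (hf : ∀ {T : Sch F} (g : T ⟶ G) (x : T ⟶ P), lift g x ≫ act ≫ f = x ≫ f) :
    ∃ k : S ⟶ Z, p ≫ k = f := by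
  refine h.hasLocalSections.exists_desc f fun a b hab => ?_
  obtain ⟨g, rfl⟩ := h.exists_div hab
  rw [Category.assoc, hf]

lemma Bitorsor.lift_diagonalAct (P : Bitorsor H G) (X : Torsor G) {T : Sch F} (g : T ⟶ G)
    (p : T ⟶ P.carrier) (x : T ⟶ X.total) :
    lift g (lift p x) ≫ P.diagonalAct X =
      lift (lift p g⁻¹ ≫ P.right) (lift g x ≫ X.act) := by
  simp [diagonalAct, comp_lift_assoc, GrpObj.comp_inv]

namespace StackMap

variable {Φ : StackMap G H} {T : Sch F}

lemma isIso_sec_proj (p : T ⟶ Φ.fiber) :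
    IsIso (sec p ≫ (Φ.objT (trivial G T)).proj) := by
  have key {B S : Sch F} (h : B = S) (f : S ⟶ B) (e : f ≫ eqToHom h = 𝟙 S) : IsIso f := by
    subst h
    obtain rfl : f = 𝟙 B := by simpa using e
    infer_instance
  exact key (S := T) (Φ.objT_base _) _ ((Category.assoc _ _ _).trans (sec_pr p))

lemma actPt_free [Φ.toFunctor.Faithful] {p : T ⟶ Φ.fiber} {g k : T ⟶ G}
    (e : actPt p g = actPt p k) : g = k := by
  have := isIso_sec_proj p
  rw [actPt_eq, actPt_eq] at e
  have e' : translate g = translate k := Φ.toFunctor.map_injective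
    (hom_ext_of_section (X := Φ.objT _) (Y := Φ.objT _) (f := Φ.mapT _) (g := Φ.mapT _) (sec p) e)
  rw [translate_eq_orbit, translate_eq_orbit] at e'
  have e'' := trivialPt 1 (𝟙 T) ≫= congrArg Hom.total e'
  rw [trivialPt_one_orbit, trivialPt_one_orbit] at e''
  have e₃ : lift g (toUnit T) = lift k (toUnit T) :=
    (Category.id_comp _).symm.trans (e''.trans (Category.id_comp _))
  simpa using e₃ =≫ fst _ _

lemma exists_actPt [Φ.toFunctor.Full] (p p' : T ⟶ Φ.fiber) : ∃ g : T ⟶ G, actPt p g = p' := by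
  have : IsIso (orbit (sec p)).base := isIso_sec_proj p
  have := isIso_of_base (orbit (sec p))
  obtain ⟨k, hk⟩ : ∃ k : trivial G T ⟶ trivial G T,
      Φ.mapT k = inv (orbit (sec p)) ≫ orbit (sec p') :=
    Φ.toFunctor.map_surjective _
  rw [IsIso.eq_inv_comp, orbit_comp] at hk
  have hk' := trivialPt 1 (𝟙 T) ≫= congrArg Hom.total hk
  rw [trivialPt_one_orbit, trivialPt_one_orbit, Category.id_comp, Category.id_comp] at hk'
  obtain ⟨g, t, e⟩ := exists_trivialPt (trivialPt 1 (𝟙 T) ≫ k.total)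
  have hk₂ := eq_orbit k
  rw [e] at hk₂
  have ht : t = 𝟙 T := by
    have h := hk' =≫ Φ.pr _
    rw [sec_pr, Category.assoc, (Φ.isPullback_mapT k).w, ← Category.assoc, sec_pr, hk₂,
      orbit_trivialPt_base] at h
    exact (Category.id_comp _).symm.trans h
  rw [ht] at hk₂
  refine ⟨g, ?_⟩
  rw [← sec_translate_one (actPt p g), sec_actPt, ← hk₂, hk', sec_translate_one]

lemma isRightTorsor_rightAct [Φ.toFunctor.Full] [Φ.toFunctor.Faithful] :
    IsRightTorsor Φ.rightAct (toUnit Φ.fiber) := by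
  refine .of_points Φ.isRightAction_rightAct (fun _ _ => toUnit_unique _ _) (fun g k x e => ?_)
    (fun {T} x y _ => ?_) ?_
  · rw [lift_rightAct, lift_rightAct] at e
    exact actPt_free e
  · obtain ⟨g, hg⟩ := exists_actPt x y
    exact ⟨T, 𝟙 T, g, IsCov.of_isIso _, by rw [Category.id_comp, Category.id_comp, lift_rightAct, hg]⟩
  · rw [toUnit_unique (toUnit Φ.fiber) (Φ.pr (trivial G (𝟙_ (Sch F))))]
    exact (Φ.isTorsor_pr _).hasLocalSections

lemma right_action_translate (Φ : StackMap G H) (g : T ⟶ G) :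
    lift ((Φ.mapT (translate (1 : T ⟶ G))).total ≫ 𝟙 _)
      ((Φ.objT (trivial G T)).proj ≫ eqToHom (Φ.objT_base (trivial G T)) ≫ g) ≫ Φ.rightAct =
      (Φ.mapT (translate g)).total ≫ 𝟙 _ := by
  obtain ⟨t, ht⟩ : ∃ t : (Φ.objT (trivial G T)).total ⟶ T, t = Φ.pr (trivial G T) := ⟨_, rfl⟩
  have e₁ : (Φ.objT (trivial G T)).proj ≫ eqToHom (Φ.objT_base (trivial G T)) ≫ g = t ≫ g := by
    rw [ht]
    exact (Category.assoc _ _ _).symm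
  have e₂ := eq_sec_orbit (Φ := Φ) (w := 𝟙 (Φ.objT (trivial G T)).total) rfl
    ((Category.id_comp _).trans ht.symm)
  rw [e₁, Category.comp_id, Category.comp_id, lift_rightAct, actPt_eq]
  have e₃ := e₂ =≫ (Φ.mapT (translate g)).total
  rw [Category.id_comp, Category.assoc, ← mapT_total_comp, orbit_trivialPt_comp_translate,
    Category.id_comp, _root_.one_mul] at e₃
  exact e₃.symm

/-- The `(H, G)`-bitorsor `Φ(G_l)` of an invertible morphism of stacks `Φ`. -/
abbrev bitorsor (Φ : StackMap G H) (hΦ : IsStackEquivalence Φ) : Bitorsor H G where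
  carrier := Φ.fiber
  left := (Φ.objT _).act
  right := Φ.rightAct
  isTorsor := by
    rw [toUnit_unique (toUnit Φ.fiber) (Φ.pr (trivial G (𝟙_ (Sch F))))]
    exact Φ.isTorsor_pr _
  isRightTorsor := by
    have := hΦ.fullyFaithful.1
    have := hΦ.fullyFaithful.2
    exact isRightTorsor_rightAct
  comm h x g := by
    rw [lift_rightAct, lift_rightAct, actPt, lift_act_pair, actPt]

lemma actPt_natApp {Φ' : StackMap G H} (α : Φ ⟶ Φ') (p : T ⟶ Φ.fiber) (g : T ⟶ G) :
    actPt p g ≫ (natApp α _).total = actPt (p ≫ (natApp α _).total) g := by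
  rw [actPt, pair_natApp, actPt]

/-- The isomorphism of bitorsors induced by a natural transformation. -/
def bitorsorMap {Φ Φ' : StackMap G H} (hΦ : IsStackEquivalence Φ) (hΦ' : IsStackEquivalence Φ')
    (α : Φ ⟶ Φ') : Φ.bitorsor hΦ ⟶ Φ'.bitorsor hΦ' where
  iso := @asIso _ _ _ _ (natApp α (trivial G (𝟙_ (Sch F)))).total (isIso_natApp_total α _)
  left_equivariant := (natApp α (trivial G (𝟙_ (Sch F)))).equivariant
  right_equivariant := hom_ext_point₂ fun p g => by
    change lift p g ≫ Φ.rightAct ≫ (natApp α _).total =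
      lift p g ≫ ((natApp α _).total ▷ G) ≫ Φ'.rightAct
    rw [← Category.assoc, lift_rightAct, lift_whiskerRight_assoc, lift_rightAct, actPt_natApp]

lemma isTorsor_pairing_bitorsor (hΦ : IsStackEquivalence Φ) (X : Torsor G) :
    IsTorsor ((Φ.bitorsor hΦ).diagonalAct X) (Φ.pairing X) := by
  have := isTorsor_pairing (Φ := Φ) (right := Φ.rightAct) (Iso.refl _)
    (fun p g => by simp [lift_rightAct]) X ((Φ.bitorsor hΦ).lift_diagonalAct X)
  simpa using this

/-- Every isomorphism of the bitorsors of `Φ` and `Φ'` comes from a natural transformation, obtained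
by descent along the pairings. -/
lemma exists_nat {Φ' : StackMap G H} (hΦ : IsStackEquivalence Φ) (hΦ' : IsStackEquivalence Φ')
    (f : Φ.bitorsor hΦ ⟶ Φ'.bitorsor hΦ') : ∃ α : Φ ⟶ Φ', bitorsorMap hΦ hΦ' α = f := by
  obtain ⟨k, hk⟩ : ∃ k : Φ.fiber ⟶ Φ'.fiber, k = f.iso.hom := ⟨_, rfl⟩
  have hl {T : Sch F} (h : T ⟶ H) (p : T ⟶ Φ.fiber) :
      (lift h p ≫ Torsor.act _) ≫ k = lift h (p ≫ k) ≫ Torsor.act _ := by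
    have := lift h p ≫= f.left_equivariant
    rw [← hk, lift_whiskerLeft_assoc, ← Category.assoc] at this
    exact this
  have hr {T : Sch F} (p : T ⟶ Φ.fiber) (g : T ⟶ G) : actPt p g ≫ k = actPt (p ≫ k) g := by
    have := lift p g ≫= f.right_equivariant
    rw [← hk, lift_whiskerRight_assoc, ← Category.assoc] at this
    change (lift p g ≫ Φ.rightAct) ≫ k = lift _ _ ≫ Φ'.rightAct at this
    rwa [lift_rightAct, lift_rightAct] at this
  have key (X : Torsor G) : ∃ a : (Φ.objT X).total ⟶ (Φ'.objT X).total,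
      ∀ {T : Sch F} (p : T ⟶ Φ.fiber) (x : T ⟶ X.total), pair p x ≫ a = pair (p ≫ k) x := by
    have hq := isTorsor_pairing_bitorsor hΦ X
    obtain ⟨a, ha⟩ := hq.exists_desc ((k ▷ X.total) ≫ Φ'.pairing X) (fun {T} g y => by
      obtain ⟨p, x, rfl⟩ : ∃ p x, y = lift p x := ⟨y ≫ fst _ _, y ≫ snd _ _, by simp⟩
      rw [← Category.assoc, Bitorsor.lift_diagonalAct, lift_whiskerRight_assoc, lift_pairing,
        lift_whiskerRight_assoc, lift_pairing]
      change pair ((lift p g⁻¹ ≫ Φ.rightAct) ≫ k) _ = _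
      rw [lift_rightAct, hr, pair_actPt, X.isTorsor.isAction.inv_act])
    refine ⟨a, fun p x => ?_⟩
    rw [← lift_pairing, Category.assoc, ha, lift_whiskerRight_assoc, lift_pairing]
  choose a ha using key
  have ext {X : Torsor G} {Z : Sch F} {b c : (Φ.objT X).total ⟶ Z}
      (h : ∀ {T : Sch F} (p : T ⟶ Φ.fiber) (x : T ⟶ X.total), pair p x ≫ b = pair p x ≫ c) :
      b = c :=
    (isTorsor_pairing_bitorsor hΦ X).hasLocalSections.hom_ext (h _ _)
  let α : Φ ⟶ Φ' := natMk a
    (fun X => ext fun p x => by rw [← Category.assoc, ha, pair_pr, pair_pr])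
    (fun X {T} h y => by
      obtain ⟨T', c, z, hc, hz⟩ :=
        (isTorsor_pairing_bitorsor hΦ X).hasLocalSections.exists_lift y
      obtain ⟨p, x, rfl⟩ : ∃ p x, z = lift p x := ⟨z ≫ fst _ _, z ≫ snd _ _, by simp⟩
      refine hc.hom_ext ?_
      rw [comp_lift_assoc, comp_lift_assoc, ← Category.assoc c y, ← hz, lift_pairing,
        ← Category.assoc, ← lift_act_pair, ha, ha, hl, lift_act_pair])
    (fun f => ext fun p x => by
      rw [← Category.assoc, pair_mapT, ha, ← Category.assoc, ha, pair_mapT])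
  refine ⟨α, Bitorsor.Hom.ext (Iso.ext ?_)⟩
  change a _ = _
  have := ha (trivial G (𝟙_ (Sch F))) (𝟙 Φ.fiber) (trivialPt 1 (toUnit _))
  change actPt _ _ ≫ _ = actPt _ _ at this
  rw [actPt_one, actPt_one, Category.id_comp, Category.id_comp] at this
  exact this.trans hk

/-- The pairing, composed with an isomorphism `P ≅ Φ(G_l)`, exhibits `Φ(X)` as a balanced product. -/
lemma isBalancedProduct_pairing (hΦ : IsStackEquivalence Φ) {P : Bitorsor H G}
    (e : P ⟶ Φ.bitorsor hΦ) (X : Torsor G) :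
    P.IsBalancedProduct X (Φ.objT X) (Φ.objT_base X) ((e.iso.hom ▷ X.total) ≫ Φ.pairing X) where
  quotient := isTorsor_pairing e.iso (fun p g => by
    have := lift p g ≫= e.right_equivariant
    rw [lift_whiskerRight_assoc] at this
    exact this.trans (lift_rightAct _ _)) X (P.lift_diagonalAct X)
  proj := by
    change ((e.iso.hom ▷ X.total) ≫ Φ.pairing X) ≫ Φ.pr X = _
    rw [pairing, Category.assoc, pair_pr, whiskerRight_snd_assoc]
  equivariant := by
    refine hom_ext_point₂ fun y x => ?_
    obtain ⟨h, p, rfl⟩ : ∃ h p, y = lift h p := ⟨y ≫ fst _ _, y ≫ snd _ _, by simp⟩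
    have he := lift h p ≫= e.left_equivariant
    rw [lift_whiskerLeft_assoc] at he
    rw [lift_whiskerRight_assoc, lift_whiskerRight_assoc, lift_lift_associator_hom_assoc,
      lift_whiskerLeft_assoc, lift_whiskerRight_assoc, lift_pairing, lift_pairing,
      Category.assoc, he, lift_act_pair]

lemma whiskerLeft_pairing (Φ : StackMap G H) {P : Sch F} (k : P ⟶ Φ.fiber) {X X' : Torsor G}
    (f : X ⟶ X') : (P ◁ f.total) ≫ (k ▷ X'.total) ≫ Φ.pairing X' =
      ((k ▷ X.total) ≫ Φ.pairing X) ≫ (Φ.mapT f).total := by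
  refine hom_ext_point₂ fun p x => ?_
  rw [lift_whiskerLeft_assoc, lift_whiskerRight_assoc, lift_pairing, Category.assoc,
    lift_whiskerRight_assoc, ← Category.assoc, lift_pairing, pair_mapT]

lemma whiskerRight_pairing {Φ' : StackMap G H} (α : Φ ⟶ Φ') {P P' : Sch F} (f : P ⟶ P')
    (k : P ⟶ Φ.fiber) (k' : P' ⟶ Φ'.fiber) (h : f ≫ k' = k ≫ (natApp α _).total) (X : Torsor G) :
    (f ▷ X.total) ≫ (k' ▷ X.total) ≫ Φ'.pairing X =
      ((k ▷ X.total) ≫ Φ.pairing X) ≫ (natApp α X).total := by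
  refine hom_ext_point₂ fun p x => ?_
  rw [lift_whiskerRight_assoc, lift_whiskerRight_assoc, lift_pairing, Category.assoc, h,
    Category.assoc, lift_whiskerRight_assoc, ← Category.assoc (lift _ _), lift_pairing,
    pair_natApp, Category.assoc]

end StackMap

variable (G H) in
/-- The functor `Φ ↦ Φ(G_l)` from invertible morphisms of stacks to bitorsors. -/
def evaluation :
    InvertibleMorphisms (classifyingStack G) (classifyingStack H) ⥤ Bitorsor H G where
  obj Φ := StackMap.bitorsor Φ.obj Φ.property
  map α := StackMap.bitorsorMap _ _ α.hom
  map_id _ := Bitorsor.Hom.ext (Iso.ext rfl)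
  map_comp _ _ := Bitorsor.Hom.ext (Iso.ext rfl)

instance : (evaluation G H).Faithful where
  map_injective {Φ Φ'} α β h := by
    have h' : (StackMap.natApp α.hom (trivial G (𝟙_ (Sch F)))).total =
      (StackMap.natApp β.hom _).total := congrArg (fun f => f.iso.hom) h
    refine ObjectProperty.hom_ext _ (StackMap.nat_ext fun X => ?_)
    refine (StackMap.isTorsor_pairing_bitorsor Φ.property X).hasLocalSections.hom_ext ?_
    rw [StackMap.pairing, StackMap.pair_natApp, StackMap.pair_natApp, h']

instance : (evaluation G H).Full where
  map_surjective {Φ Φ'} f := by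
    obtain ⟨α, hα⟩ := StackMap.exists_nat Φ.property Φ'.property f
    exact ⟨ObjectProperty.homMk α, hα⟩

variable (G H) in
/-- The functor `evaluation` evaluates morphisms of stacks at the trivial torsor, with the right
action coming from right translations. -/
def evaluationAtTrivialTorsor : EvaluationAtTrivialTorsor (evaluation G H) where
  iso Φ := Iso.refl _
  left_equivariant Φ := by
    have key {A : Sch F} (f : H ⊗ A ⟶ A) : f ≫ 𝟙 A = (H ◁ 𝟙 A) ≫ f := by simp
    exact key _
  right_action Φ {T} g := by
    exact StackMap.right_action_translate Φ.obj g
  naturality f := by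
    exact (Category.comp_id _).trans (Category.id_comp _).symm

/-- A quasi-inverse of `evaluation` is given by balanced products, because for every `Φ` the pairing
`Φ(G_l) × X ⟶ Φ(X)` is a quotient by `G`. -/
def balancedProductFunctor [(evaluation G H).IsEquivalence] :
    BalancedProductFunctor (evaluation G H).asEquivalence.inverse where
  quot P X := (((evaluation G H).asEquivalence.counitIso.inv.app P).iso.hom ▷ X.total) ≫
    StackMap.pairing (((evaluation G H).asEquivalence.inverse.obj P).obj) X
  isBalancedProduct P X :=
    StackMap.isBalancedProduct_pairing
      ((evaluation G H).asEquivalence.inverse.obj P).property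
      ((evaluation G H).asEquivalence.counitIso.inv.app P) X
  naturality_right P {X X'} f := by
    exact StackMap.whiskerLeft_pairing
      ((evaluation G H).asEquivalence.inverse.obj P).obj
      ((evaluation G H).asEquivalence.counitIso.inv.app P).iso.hom f
  naturality_left {P P'} f X := by
    have h := (evaluation G H).asEquivalence.counitIso.inv.naturality f
    have h' : f.iso.hom ≫ ((evaluation G H).asEquivalence.counitIso.inv.app P').iso.hom =
      ((evaluation G H).asEquivalence.counitIso.inv.app P).iso.hom ≫
        (StackMap.natApp ((evaluation G H).asEquivalence.inverse.map f).hom _).total :=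
      congrArg (fun k => k.iso.hom) h
    exact StackMap.whiskerRight_pairing _ _ _ _ h' X

end Evaluation

/-! ### Existence of balanced products -/

noncomputable section BalancedProduct

open AlgebraicGeometry Limits

variable {F : Type u} [Field F]

/-- The transport `(u, v, x) ↦ ρ(u, v) x`. -/
def twistTransport {G U X : Sch F} (ρ : U ⊗ U ⟶ G) (act : G ⊗ X ⟶ X) : U ⊗ (U ⊗ X) ⟶ X :=
  lift (lift (fst _ _) (snd _ _ ≫ fst _ _) ≫ ρ) (snd _ _ ≫ snd _ _) ≫ act

lemma lift_twistTransport {G U X : Sch F} (ρ : U ⊗ U ⟶ G) (act : G ⊗ X ⟶ X) {T : Sch F}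
    (u v : T ⟶ U) (x : T ⟶ X) :
    lift u (lift v x) ≫ twistTransport ρ act = lift (lift u v ≫ ρ) x ≫ act := by
  simp [twistTransport, comp_lift_assoc]

variable {G H : Sch F} [GrpObj G] [GrpObj H]

/-- The twist of a torsor by a cocycle `ρ` exists. -/
theorem exists_twist [hG : IsAffineHom G.hom] {U : Sch F} [IsAffine U.left]
    (hU : IsCov (toUnit U)) (ρ : U ⊗ U ⟶ G)
    (hρ : ∀ {T : Sch F} (u v w : T ⟶ U), (lift u v ≫ ρ) * (lift v w ≫ ρ) = lift u w ≫ ρ)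
    {X S : Sch F} {act : G ⊗ X ⟶ X} {f : X ⟶ S} (h : IsTorsor act f) :
    ∃ (Y : Sch F) (π : U ⊗ X ⟶ Y) (p : Y ⟶ S),
      IsDescent (twistTransport ρ act) π ∧ π ≫ p = snd U X ≫ f := by
  have := h.isAffineHom
  refine exists_isDescent hU f ⟨fun u x => ?_, fun u v w x => ?_⟩ (hom_ext_point₃ fun u v x => ?_)
  · have : lift u u ≫ ρ = 1 := by simpa using hρ u u u
    rw [lift_twistTransport, this, h.isAction.one_act]
  · rw [lift_twistTransport, lift_twistTransport, lift_twistTransport, ← h.isAction.mul_act, hρ]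
  · rw [← Category.assoc, lift_twistTransport, Category.assoc, h.act_proj, lift_snd_assoc,
      lift_snd_assoc]

namespace Bitorsor

variable (P : Bitorsor H G)

/-- A bitorsor has a point over an affine étale covering. -/
lemma exists_affine_section : ∃ (U : Sch F) (_ : U ⟶ P.carrier),
    IsAffine U.left ∧ IsCov (toUnit U) := by
  obtain ⟨B, c, s, hc, -⟩ := P.isTorsor.hasLocalSections
  obtain ⟨V, i, hV, hV'⟩ := IsCov.exists_affine (U := B) (by rwa [toUnit_unique (toUnit B) c])
  exact ⟨V, i ≫ s, hV, hV'⟩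

variable {P} in
lemma right_injective {T : Sch F} {p : T ⟶ P.carrier} {g k : T ⟶ G}
    (h : lift p g ≫ P.right = lift p k ≫ P.right) : g = k := P.isRightTorsor.free h

lemma exists_right {T : Sch F} (p p' : T ⟶ P.carrier) : ∃ g : T ⟶ G, lift p g ≫ P.right = p' :=
  P.isRightTorsor.exists_div (toUnit_unique _ _)

lemma exists_left {T : Sch F} (p p' : T ⟶ P.carrier) : ∃ h : T ⟶ H, lift h p ≫ P.left = p' :=
  P.isTorsor.exists_div (toUnit_unique _ _)

lemma right_mul {T : Sch F} (p : T ⟶ P.carrier) (g k : T ⟶ G) :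
    lift (lift p g ≫ P.right) k ≫ P.right = lift p (g * k) ≫ P.right :=
  (P.isRightTorsor.isRightAction.act_mul p g k).symm

lemma right_one {T : Sch F} (p : T ⟶ P.carrier) : lift p (1 : T ⟶ G) ≫ P.right = p :=
  P.isRightTorsor.isRightAction.act_one p

/-- The cocycle `ρ(u, v)` with `σ(v) = σ(u) ρ(u, v)` that measures how a section `σ` over `U` of a
bitorsor varies. -/
lemma exists_cocycle {U : Sch F} (σ : U ⟶ P.carrier) : ∃ ρ : U ⊗ U ⟶ G,
    (∀ {T : Sch F} (u v : T ⟶ U), lift (u ≫ σ) (lift u v ≫ ρ) ≫ P.right = v ≫ σ) ∧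
    ∀ {T : Sch F} (u v w : T ⟶ U), (lift u v ≫ ρ) * (lift v w ≫ ρ) = lift u w ≫ ρ := by
  obtain ⟨ρ, hρ⟩ := P.exists_right (fst U U ≫ σ) (snd U U ≫ σ)
  have key {T : Sch F} (u v : T ⟶ U) : lift (u ≫ σ) (lift u v ≫ ρ) ≫ P.right = v ≫ σ := by
    simpa [comp_lift_assoc] using lift u v ≫= hρ
  refine ⟨ρ, key, fun u v w => right_injective (p := u ≫ σ) ?_⟩
  rw [← right_mul, key, key, key]

/-- The quotient of `P × X` by the diagonal action: in terms of a local section `σ` of `P` it is the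
twist of `X` by the cocycle of `σ`, the class of `(σ(u) k, x)` being that of `(u, k x)`. -/
theorem exists_quotient [IsAffineHom G.hom] (X : Torsor G) :
    ∃ (Y : Sch F) (p : Y ⟶ X.base) (q : P.carrier ⊗ X.total ⟶ Y),
      IsTorsor (P.diagonalAct X) q ∧ q ≫ p = snd _ _ ≫ X.proj := by
  obtain ⟨U, σ, hU, hU'⟩ := P.exists_affine_section
  obtain ⟨ρ, hσ, hρ⟩ := P.exists_cocycle σ
  obtain ⟨Y, π, p, hπ, hp⟩ := exists_twist hU' ρ hρ X.isTorsor
  have hX := X.isTorsor.isAction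
  -- `q` sends `(p, x)` to the class of `(u, κ x)` with `p = σ(u) κ`, for any `u`
  obtain ⟨q, hq⟩ : ∃ q : P.carrier ⊗ X.total ⟶ Y, ∀ {T : Sch F} (u : T ⟶ U) (k : T ⟶ G)
      (x : T ⟶ X.total), lift (lift (u ≫ σ) k ≫ P.right) x ≫ q = lift u (lift k x ≫ X.act) ≫ π := by
    obtain ⟨κ, hκ⟩ := P.exists_right (fst U _ ≫ σ) (snd U (P.carrier ⊗ X.total) ≫ fst _ _)
    have hκ' {T : Sch F} (u : T ⟶ U) (p : T ⟶ P.carrier) (x : T ⟶ X.total) :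
        lift (u ≫ σ) (lift u (lift p x) ≫ κ) ≫ P.right = p := by
      simpa [comp_lift_assoc] using lift u (lift p x) ≫= hκ
    obtain ⟨q, hq⟩ := (hU'.hasLocalSections.snd (P.carrier ⊗ X.total)).exists_desc
      (lift (fst _ _) (lift κ (snd _ _ ≫ snd _ _) ≫ X.act) ≫ π) (fun {T} a b hab => by
        obtain ⟨u, y, rfl⟩ : ∃ p x, a = lift p x := ⟨a ≫ fst _ _, a ≫ snd _ _, by simp⟩
        obtain ⟨v, z, rfl⟩ : ∃ p x, b = lift p x := ⟨b ≫ fst _ _, b ≫ snd _ _, by simp⟩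
        obtain rfl : y = z := by simpa using hab
        obtain ⟨p, x, rfl⟩ : ∃ p x, y = lift p x := ⟨y ≫ fst _ _, y ≫ snd _ _, by simp⟩
        have e : lift u (lift p x) ≫ κ = (lift u v ≫ ρ) * (lift v (lift p x) ≫ κ) :=
          right_injective (p := u ≫ σ) (by rw [hκ', ← right_mul, hσ, hκ'])
        simp only [comp_lift_assoc, lift_fst, lift_snd_assoc, lift_snd]
        rw [e, hX.mul_act, ← lift_twistTransport, hπ.transport])
    refine ⟨q, fun {T} u k x => ?_⟩
    have e : lift u (lift (lift (u ≫ σ) k ≫ P.right) x) ≫ κ = k :=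
      right_injective (p := u ≫ σ) (by rw [hκ'])
    have := lift u (lift (lift (u ≫ σ) k ≫ P.right) x) ≫= hq
    simp only [comp_lift_assoc, lift_fst, lift_snd_assoc, lift_snd] at this
    rw [this, e]
  have hq₁ {T : Sch F} (u : T ⟶ U) (x : T ⟶ X.total) :
      lift (u ≫ σ) x ≫ q = lift u x ≫ π := by
    rw [← P.right_one (u ≫ σ), hq, hX.one_act]
  have loc (T : Sch F) : ∃ (T' : Sch F) (c : T' ⟶ T) (_ : T' ⟶ U), IsCov c :=
    ⟨T ⊗ U, fst T U, snd T U, hU'.fst T⟩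
  refine ⟨Y, p, q, .of_points ⟨fun y => ?_, fun g k y => ?_⟩ (fun {T} g y => ?_) (fun g k y e => ?_)
    (fun {T} y y' e => ?_) (.of_exists_lift fun {T} y => ?_), ?_⟩
  · obtain ⟨p, x, rfl⟩ : ∃ p x, y = lift p x := ⟨y ≫ fst _ _, y ≫ snd _ _, by simp⟩
    rw [lift_diagonalAct, inv_one, right_one, hX.one_act]
  · obtain ⟨p, x, rfl⟩ : ∃ p x, y = lift p x := ⟨y ≫ fst _ _, y ≫ snd _ _, by simp⟩
    rw [lift_diagonalAct, lift_diagonalAct, lift_diagonalAct, mul_inv_rev, right_mul, hX.mul_act]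
  · obtain ⟨p, x, rfl⟩ : ∃ p x, y = lift p x := ⟨y ≫ fst _ _, y ≫ snd _ _, by simp⟩
    obtain ⟨T', c, u, hc⟩ := loc T
    obtain ⟨k, hk⟩ := P.exists_right (u ≫ σ) (c ≫ p)
    refine hc.hom_ext ?_
    rw [← Category.assoc _ _ q, lift_diagonalAct]
    simp only [comp_lift_assoc, GrpObj.comp_inv]
    rw [← hk, right_mul, hq, hq, ← hX.mul_act, inv_mul_cancel_right]
  · obtain ⟨p, x, rfl⟩ : ∃ p x, y = lift p x := ⟨y ≫ fst _ _, y ≫ snd _ _, by simp⟩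
    rw [lift_diagonalAct, lift_diagonalAct] at e
    exact X.isTorsor.free (x := x) (by simpa using e =≫ snd _ _)
  · obtain ⟨p, x, rfl⟩ : ∃ p x, y = lift p x := ⟨y ≫ fst _ _, y ≫ snd _ _, by simp⟩
    obtain ⟨p', x', rfl⟩ : ∃ p x, y' = lift p x := ⟨y' ≫ fst _ _, y' ≫ snd _ _, by simp⟩
    obtain ⟨T', c, u, hc⟩ := loc T
    obtain ⟨k, hk⟩ := P.exists_right (u ≫ σ) (c ≫ p)
    obtain ⟨k', hk'⟩ := P.exists_right (u ≫ σ) (c ≫ p')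
    have e' := c ≫= e
    rw [comp_lift_assoc, comp_lift_assoc, ← hk, ← hk', hq, hq] at e'
    have e'' := hπ.inj e'
    refine ⟨T', c, k'⁻¹ * k, hc, ?_⟩
    rw [comp_lift, comp_lift, lift_diagonalAct, hX.mul_act, e'', hX.inv_act, ← hk, right_mul,
      mul_inv_rev, inv_inv, mul_inv_cancel_left, hk']
  · obtain ⟨T', c, u, hc⟩ := loc T
    obtain ⟨x, hx⟩ := hπ.exists_lift u (c ≫ y)
    exact ⟨T', c, lift (u ≫ σ) x, hc, by rw [hq₁, hx]⟩
  · refine hom_ext_point₂ fun {T} y x => ?_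
    obtain ⟨T', c, u, hc⟩ := loc T
    obtain ⟨k, hk⟩ := P.exists_right (u ≫ σ) (c ≫ y)
    refine hc.hom_ext ?_
    rw [comp_lift_assoc, comp_lift_assoc, ← hk, ← Category.assoc, hq, Category.assoc, hp,
      lift_snd_assoc, lift_snd_assoc, Category.assoc, X.isTorsor.act_proj]

/-- The balanced product `P ×_{/G} X` exists: the quotient of `P × X` inherits an action of `H`, for
which it is an `H`-torsor over the base of `X`. -/
theorem exists_isBalancedProduct [IsAffineHom G.hom] (X : Torsor G) :
    ∃ (Y : Torsor H) (hb : Y.base = X.base) (q : P.carrier ⊗ X.total ⟶ Y.total),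
      P.IsBalancedProduct X Y hb q := by
  obtain ⟨Y, r, q, hq, hr⟩ := P.exists_quotient X
  have hX := X.isTorsor.isAction
  have hP := P.isTorsor.isAction
  -- two pairs have the same class if and only if they are conjugate under the diagonal action
  have q_eq {T : Sch F} {p p' : T ⟶ P.carrier} {x x' : T ⟶ X.total}
      (e : lift p x ≫ q = lift p' x' ≫ q) :
      ∃ g : T ⟶ G, lift p g⁻¹ ≫ P.right = p' ∧ lift g x ≫ X.act = x' := by
    obtain ⟨g, hg⟩ := hq.exists_div e
    rw [lift_diagonalAct] at hg
    exact ⟨g, by simpa using hg =≫ fst _ _, by simpa using hg =≫ snd _ _⟩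
  have q_act {T : Sch F} (p : T ⟶ P.carrier) (g : T ⟶ G) (x : T ⟶ X.total) :
      lift (lift p g⁻¹ ≫ P.right) (lift g x ≫ X.act) ≫ q = lift p x ≫ q := by
    rw [← lift_diagonalAct, Category.assoc, hq.act_proj]
  have loc {T : Sch F} (y : T ⟶ Y) : ∃ (T' : Sch F) (c : T' ⟶ T) (p : T' ⟶ P.carrier)
      (x : T' ⟶ X.total), IsCov c ∧ lift p x ≫ q = c ≫ y := by
    obtain ⟨T', c, z, hc, hz⟩ := hq.hasLocalSections.exists_lift y
    exact ⟨T', c, z ≫ fst _ _, z ≫ snd _ _, hc, by rw [← hz, ← comp_lift]; simp⟩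
  -- `h • [p, x] = [h p, x]` is well defined because the two actions on `P` commute
  obtain ⟨act, hact⟩ : ∃ act : H ⊗ Y ⟶ Y, ∀ {T : Sch F} (h : T ⟶ H) (p : T ⟶ P.carrier)
      (x : T ⟶ X.total), lift h (lift p x ≫ q) ≫ act = lift (lift h p ≫ P.left) x ≫ q := by
    obtain ⟨act, hact⟩ := (hq.hasLocalSections.whiskerLeft H).exists_desc
      ((α_ H P.carrier X.total).inv ≫ (P.left ▷ X.total) ≫ q) (fun {T} a b hab => by
        obtain ⟨h, y, rfl⟩ : ∃ p x, a = lift p x := ⟨a ≫ fst _ _, a ≫ snd _ _, by simp⟩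
        obtain ⟨h', z, rfl⟩ : ∃ p x, b = lift p x := ⟨b ≫ fst _ _, b ≫ snd _ _, by simp⟩
        rw [lift_whiskerLeft, lift_whiskerLeft] at hab
        obtain rfl : h = h' := by simpa using hab =≫ fst _ _
        obtain ⟨p, x, rfl⟩ : ∃ p x, y = lift p x := ⟨y ≫ fst _ _, y ≫ snd _ _, by simp⟩
        obtain ⟨p', x', rfl⟩ : ∃ p x, z = lift p x := ⟨z ≫ fst _ _, z ≫ snd _ _, by simp⟩
        obtain ⟨g, rfl, rfl⟩ := q_eq (by simpa using hab =≫ snd _ _)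
        rw [lift_lift_associator_inv_assoc, lift_lift_associator_inv_assoc,
          lift_whiskerRight_assoc, lift_whiskerRight_assoc, ← P.comm, q_act])
    refine ⟨act, fun h p x => ?_⟩
    have := lift h (lift p x) ≫= hact
    rwa [lift_whiskerLeft_assoc, lift_lift_associator_inv_assoc, lift_whiskerRight_assoc] at this
  have hY : IsTorsor act r := by
    refine .of_points ⟨fun {T} y => ?_, fun {T} g k y => ?_⟩ (fun {T} g y => ?_)
      (fun {T} g k y e => ?_) (fun {T} y y' e => ?_) ?_
    · obtain ⟨T', c, p, x, hc, hy⟩ := loc y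
      refine hc.hom_ext ?_
      rw [comp_lift_assoc, ← hy, comp_one, hact, hP.one_act]
    · obtain ⟨T', c, p, x, hc, hy⟩ := loc y
      refine hc.hom_ext ?_
      rw [comp_lift_assoc, comp_lift_assoc, comp_lift_assoc, ← hy, comp_mul, hact, hact, hact,
        hP.mul_act]
    · obtain ⟨T', c, p, x, hc, hy⟩ := loc y
      refine hc.hom_ext ?_
      rw [comp_lift_assoc, ← Category.assoc c y, ← hy, ← Category.assoc, hact, Category.assoc,
        Category.assoc, hr, lift_snd_assoc, lift_snd_assoc]
    · obtain ⟨T', c, p, x, hc, hy⟩ := loc y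
      refine hc.hom_ext ?_
      have e' := c ≫= e
      rw [comp_lift_assoc, comp_lift_assoc, ← hy, hact, hact] at e'
      obtain ⟨a, ha, ha'⟩ := q_eq e'
      obtain rfl : a = 1 := X.isTorsor.free (ha'.trans (hX.one_act x).symm)
      rw [inv_one, right_one] at ha
      exact P.isTorsor.free ha
    · obtain ⟨T', c, p, x, hc, hy⟩ := loc y
      obtain ⟨T'', d, p', x', hd, hy'⟩ := loc (c ≫ y')
      have e' := d ≫= c ≫= e
      rw [← Category.assoc c y, ← hy, ← Category.assoc c y', ← Category.assoc d (c ≫ y'), ← hy',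
        Category.assoc, Category.assoc, hr, lift_snd_assoc, lift_snd_assoc,
        ← Category.assoc d] at e'
      obtain ⟨g, rfl⟩ := X.isTorsor.exists_div e'
      obtain ⟨h, hh⟩ := P.exists_left (d ≫ p) (lift p' g ≫ P.right)
      refine ⟨T'', d ≫ c, h, hd.comp hc, ?_⟩
      rw [Category.assoc, Category.assoc, ← hy, ← hy', comp_lift_assoc, hact, hh,
        ← q_act _ g (d ≫ x), right_mul, mul_inv_cancel, right_one]
    · refine HasLocalSections.of_comp_eq ?_ q hr
      exact (HasLocalSections.snd P.isTorsor.hasLocalSections _).comp X.isTorsor.hasLocalSections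
  refine ⟨⟨X.base, Y, r, act, hY⟩, rfl, q, hq, by simpa using hr, ?_⟩
  refine hom_ext_point₂ fun y x => ?_
  obtain ⟨h, p, rfl⟩ : ∃ h p, y = lift h p := ⟨y ≫ fst _ _, y ≫ snd _ _, by simp⟩
  rw [lift_whiskerRight_assoc, lift_lift_associator_hom_assoc, lift_whiskerLeft_assoc, hact]

end Bitorsor

end BalancedProduct

/-! ### The morphism of stacks attached to a bitorsor -/

noncomputable section BalancedProductMorphism

open AlgebraicGeometry Limits StrongInner.Torsor

variable {F : Type u} [Field F] {G H : Sch F} [GrpObj G] [GrpObj H]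

lemma StackMap.id_pr (X : Torsor G) :
    StackMap.pr (BasedFunctor.id (classifyingStack G)) X = X.proj := by
  exact Category.comp_id _

lemma StackMap.comp_pr {K : Sch F} [GrpObj K] (Φ : StackMap G H) (Ψ : StackMap H K)
    (X : Torsor G) : StackMap.pr (BasedFunctor.comp Φ Ψ) X =
      Ψ.pr (Φ.objT X) ≫ eqToHom (Φ.objT_base X) := by
  rw [pr, pr, Category.assoc, eqToHom_trans]
  rfl

instance Bitorsor.isIso (P P' : Bitorsor H G) (f : P ⟶ P') : IsIso f := by
  refine ⟨⟨f.iso.symm, ?_, ?_⟩, Hom.ext (Iso.self_symm_id _), Hom.ext (Iso.symm_self_id _)⟩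
  · rw [Iso.symm_hom, Iso.comp_inv_eq, Category.assoc, f.left_equivariant]
    simp
  · rw [Iso.symm_hom, Iso.comp_inv_eq, Category.assoc, f.right_equivariant]
    simp

namespace Bitorsor

section

variable (P : Bitorsor H G) [IsAffineHom G.hom]

/-- A balanced product `P ×_{/G} X`. -/
def prod (X : Torsor G) : Torsor H := (P.exists_isBalancedProduct X).choose

lemma prod_base (X : Torsor G) : (P.prod X).base = X.base :=
  (P.exists_isBalancedProduct X).choose_spec.choose

/-- The quotient morphism `P × X ⟶ P ×_{/G} X`. -/
def quot (X : Torsor G) : P.carrier ⊗ X.total ⟶ (P.prod X).total :=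
  (P.exists_isBalancedProduct X).choose_spec.choose_spec.choose

lemma isBalancedProduct_prod (X : Torsor G) :
    P.IsBalancedProduct X (P.prod X) (P.prod_base X) (P.quot X) :=
  (P.exists_isBalancedProduct X).choose_spec.choose_spec.choose_spec

variable {X : Torsor G} {T : Sch F}

/-- The class of `(p, x)` in the balanced product. -/
def cls (p : T ⟶ P.carrier) (x : T ⟶ X.total) : T ⟶ (P.prod X).total := lift p x ≫ P.quot X

lemma comp_cls {T' : Sch F} (a : T' ⟶ T) (p : T ⟶ P.carrier) (x : T ⟶ X.total) :
    a ≫ P.cls p x = P.cls (a ≫ p) (a ≫ x) := by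
  rw [cls, comp_lift_assoc, cls]

lemma cls_act (p : T ⟶ P.carrier) (g : T ⟶ G) (x : T ⟶ X.total) :
    P.cls (lift p g ≫ P.right) x = P.cls p (lift g x ≫ X.act) := by
  have h := (P.isBalancedProduct_prod X).quotient.act_proj g (lift (lift p g ≫ P.right) x)
  rwa [← Category.assoc, lift_diagonalAct, right_mul, mul_inv_cancel, right_one, eq_comm] at h

lemma lift_cls_act (h : T ⟶ H) (p : T ⟶ P.carrier) (x : T ⟶ X.total) :
    lift h (P.cls p x) ≫ (P.prod X).act = P.cls (lift h p ≫ P.left) x := by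
  have e := lift (lift h p) x ≫= (P.isBalancedProduct_prod X).equivariant
  rw [lift_whiskerRight_assoc, lift_lift_associator_hom_assoc, lift_whiskerLeft_assoc] at e
  exact e.symm

lemma cls_proj (p : T ⟶ P.carrier) (x : T ⟶ X.total) :
    P.cls p x ≫ (P.prod X).proj ≫ eqToHom (P.prod_base X) = x ≫ X.proj := by
  rw [cls, Category.assoc, (P.isBalancedProduct_prod X).proj, lift_snd_assoc]

variable {P} in
lemma cls_hom_ext {Z : Sch F} {f f' : (P.prod X).total ⟶ Z}
    (h : ∀ {T : Sch F} (p : T ⟶ P.carrier) (x : T ⟶ X.total), P.cls p x ≫ f = P.cls p x ≫ f') :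
    f = f' := by
  refine (P.isBalancedProduct_prod X).quotient.hasLocalSections.hom_ext (hom_ext_point₂ ?_)
  intro T p x
  rw [← Category.assoc, ← Category.assoc]
  exact h p x

lemma exists_cls (y : T ⟶ (P.prod X).total) : ∃ (T' : Sch F) (c : T' ⟶ T) (p : T' ⟶ P.carrier)
    (x : T' ⟶ X.total), IsCov c ∧ P.cls p x = c ≫ y := by
  obtain ⟨T', c, z, hc, hz⟩ :=
    (P.isBalancedProduct_prod X).quotient.hasLocalSections.exists_lift y
  refine ⟨T', c, z ≫ fst _ _, z ≫ snd _ _, hc, ?_⟩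
  rw [cls, ← hz, ← comp_lift, lift_fst_snd, Category.comp_id]

variable {P} in
lemma exists_desc_cls {Z : Sch F} (f : P.carrier ⊗ X.total ⟶ Z)
    (hf : ∀ {T : Sch F} (p : T ⟶ P.carrier) (g : T ⟶ G) (x : T ⟶ X.total),
      lift (lift p g ≫ P.right) x ≫ f = lift p (lift g x ≫ X.act) ≫ f) :
    ∃ k : (P.prod X).total ⟶ Z,
      ∀ {T : Sch F} (p : T ⟶ P.carrier) (x : T ⟶ X.total), P.cls p x ≫ k = lift p x ≫ f := by
  obtain ⟨k, hk⟩ := (P.isBalancedProduct_prod X).quotient.exists_desc f fun g y => by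
    obtain ⟨p, x, rfl⟩ : ∃ p x, y = lift p x := ⟨y ≫ fst _ _, y ≫ snd _ _, by simp⟩
    rw [← Category.assoc, lift_diagonalAct, hf, X.isTorsor.isAction.inv_act]
  exact ⟨k, fun p x => by rw [cls, Category.assoc, hk]⟩

lemma exists_prodMap {X X' : Torsor G} (f : X ⟶ X') :
    ∃ k : (P.prod X).total ⟶ (P.prod X').total,
      ∀ {T : Sch F} (p : T ⟶ P.carrier) (x : T ⟶ X.total),
        P.cls p x ≫ k = P.cls p (x ≫ f.total) := by
  obtain ⟨k, hk⟩ := exists_desc_cls ((P.carrier ◁ f.total) ≫ P.quot X') fun p g x => by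
    rw [lift_whiskerLeft_assoc, lift_whiskerLeft_assoc]
    change P.cls _ _ = P.cls _ _
    rw [cls_act, Category.assoc, lift_act_total]
  exact ⟨k, fun p x => by rw [hk, lift_whiskerLeft_assoc, cls]⟩

/-- The functoriality of the balanced product in the torsor. -/
def prodMap {X X' : Torsor G} (f : X ⟶ X') : (P.prod X).total ⟶ (P.prod X').total :=
  (P.exists_prodMap f).choose

lemma cls_prodMap {X X' : Torsor G} (f : X ⟶ X') (p : T ⟶ P.carrier) (x : T ⟶ X.total) :
    P.cls p x ≫ P.prodMap f = P.cls p (x ≫ f.total) :=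
  (P.exists_prodMap f).choose_spec p x

/-- The morphism of stacks `Φ_P = P ×_{/G} (-)`. -/
def stackMap : StackMap G H :=
  StackMap.mkOfTotal P.prod P.prod_base P.prodMap
    (fun f => cls_hom_ext fun p x => by
      rw [← Category.assoc, cls_prodMap, cls_proj, Category.assoc, f.isPullback.w,
        ← Category.assoc, ← P.cls_proj p x]
      simp only [Category.assoc])
    (fun {X X'} f {T} h y => by
      obtain ⟨T', c, p, x, hc, hy⟩ := P.exists_cls y
      refine hc.hom_ext ?_
      rw [comp_lift_assoc, comp_lift_assoc, ← Category.assoc c y, ← hy, ← Category.assoc,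
        lift_cls_act, cls_prodMap, cls_prodMap, lift_cls_act])
    (fun X => cls_hom_ext fun p x => by
      rw [cls_prodMap, id_total, Category.comp_id, Category.comp_id])
    (fun f f' => cls_hom_ext fun p x => by
      rw [cls_prodMap, ← Category.assoc, cls_prodMap, cls_prodMap, comp_total, Category.assoc])

lemma cls_pr (p : T ⟶ P.carrier) (x : T ⟶ X.total) :
    P.cls p x ≫ P.stackMap.pr X = x ≫ X.proj :=
  P.cls_proj p x

/-- The point `[p, 1]` of `Φ_P(G_l)`. -/
def clsOne (p : T ⟶ P.carrier) : T ⟶ P.stackMap.fiber :=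
  P.cls (X := trivial G (𝟙_ (Sch F))) p (trivialPt 1 (toUnit T))

lemma comp_clsOne {T' : Sch F} (a : T' ⟶ T) (p : T ⟶ P.carrier) :
    a ≫ P.clsOne p = P.clsOne (a ≫ p) := by
  refine (P.comp_cls _ _ _).trans ?_
  rw [comp_trivialPt, comp_one, clsOne, toUnit_unique (a ≫ toUnit _) (toUnit _)]

lemma sec_clsOne (p : T ⟶ P.carrier) :
    StackMap.sec (P.clsOne p) = P.cls (X := trivial G T) p (trivialPt 1 (𝟙 T)) := by
  refine (StackMap.eq_sec ?_ ((P.cls_pr _ _).trans (trivialPt_proj _ _))).symm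
  refine (P.cls_prodMap _ _ _).trans ?_
  rw [translate_eq_orbit, trivialPt_one_orbit, Category.id_comp, clsOne]

/-- Under `p ↦ [p, 1]`, the pairing of `Φ_P(G_l)` with `X` is the quotient morphism. -/
lemma pair_clsOne (p : T ⟶ P.carrier) (x : T ⟶ X.total) :
    StackMap.pair (P.clsOne p) x = P.cls p x := by
  rw [StackMap.pair, sec_clsOne]
  refine (P.cls_prodMap _ _ _).trans ?_
  rw [trivialPt_one_orbit, Category.id_comp]

lemma actPt_clsOne (p : T ⟶ P.carrier) (g : T ⟶ G) :
    StackMap.actPt (P.clsOne p) g = P.clsOne (lift p g ≫ P.right) := by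
  rw [StackMap.actPt, pair_clsOne, clsOne, cls_act, lift_trivialPt_act, _root_.mul_one]

/-- A bitorsor is isomorphic to the one attached to its balanced product, through
`p ↦ [p, 1]`. -/
lemma exists_iso_bitorsor (hP : IsStackEquivalence P.stackMap) :
    Nonempty (P ⟶ P.stackMap.bitorsor hP) := by
  let X : Torsor H := ⟨𝟙_ (Sch F), P.carrier, toUnit _, P.left, P.isTorsor⟩
  let Y := P.prod (trivial G (𝟙_ (Sch F)))
  have hb : X.base = Y.base := (P.prod_base (trivial G (𝟙_ (Sch F)))).symm
  obtain ⟨k, hk⟩ : ∃ k : P.carrier ⟶ P.stackMap.fiber, ∀ {T : Sch F} (p : T ⟶ P.carrier),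
      p ≫ k = P.clsOne p :=
    ⟨P.clsOne (𝟙 _), fun p => by rw [comp_clsOne, Category.comp_id]⟩
  have hl {T : Sch F} (h : T ⟶ H) (p : T ⟶ P.carrier) :
      lift h p ≫ P.left ≫ k = lift h (p ≫ k) ≫ Y.act := by
    rw [← Category.assoc, hk, hk]
    exact (P.lift_cls_act _ _ _).symm
  have hw : k ≫ Y.proj = toUnit _ ≫ eqToHom hb := by
    have : Mono (eqToHom hb.symm) := inferInstance
    rw [← cancel_mono (eqToHom hb.symm)]
    exact toUnit_unique _ _
  let f : X ⟶ Y := homMk (X := X) (Y := Y) (eqToHom hb) k hw hl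
  have : IsIso f.base := inferInstanceAs (IsIso (eqToHom hb))
  have : IsIso k := f.isPullback.isIso_fst_of_isIso
  refine ⟨⟨asIso k, hom_ext_point₂ fun h p => ?_, hom_ext_point₂ fun p g => ?_⟩⟩
  · rw [asIso_hom, hl, lift_whiskerLeft_assoc]
    rfl
  · rw [asIso_hom, lift_whiskerRight_assoc, ← Category.assoc, hk, hk, ← actPt_clsOne]
    exact (StackMap.lift_rightAct _ _).symm

end

/-- The opposite bitorsor, with the left action `g • p = p g⁻¹` and the right action
`p • h = h⁻¹ p`. -/
abbrev op (P : Bitorsor H G) : Bitorsor G H where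
  carrier := P.carrier
  left := leftOfRight P.right
  right := rightOfLeft P.left
  isTorsor := P.isRightTorsor.leftOfRight
  isRightTorsor := P.isTorsor.rightOfLeft
  comm h x g := by
    rw [lift_leftOfRight, lift_rightOfLeft, lift_rightOfLeft, lift_leftOfRight, P.comm]

/-- If `P'` is the inverse of the bitorsor `P`, the identity is isomorphic to `Φ_P` followed by
`Φ_{P'}`, through `x ↦ [τ p, [p, x]]`, which does not depend on `p`. -/
lemma exists_iso_comp [IsAffineHom G.hom] [IsAffineHom H.hom] (P : Bitorsor H G)
    (P' : Bitorsor G H) (τ : P.carrier ⟶ P'.carrier)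
    (hl : ∀ {T : Sch F} (h : T ⟶ H) (p : T ⟶ P.carrier),
      lift h p ≫ P.left ≫ τ = lift (p ≫ τ) h⁻¹ ≫ P'.right)
    (hr : ∀ {T : Sch F} (p : T ⟶ P.carrier) (g : T ⟶ G),
      lift p g ≫ P.right ≫ τ = lift g⁻¹ (p ≫ τ) ≫ P'.left) :
    Nonempty (BasedFunctor.comp P.stackMap P'.stackMap ≅
      BasedFunctor.id (classifyingStack G)) := by
  have key (X : Torsor G) : ∃ a : X.total ⟶ (P'.prod (P.prod X)).total,
      ∀ {T : Sch F} (p : T ⟶ P.carrier) (x : T ⟶ X.total), x ≫ a = P'.cls (p ≫ τ) (P.cls p x) := by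
    obtain ⟨a, ha⟩ := (HasLocalSections.snd P.isTorsor.hasLocalSections X.total).exists_desc
      (P'.cls (fst _ _ ≫ τ) (P.cls (fst _ _) (snd _ _))) (fun {T} y z e => by
        obtain ⟨p, x, rfl⟩ : ∃ p x, y = lift p x := ⟨y ≫ fst _ _, y ≫ snd _ _, by simp⟩
        obtain ⟨p', x', rfl⟩ : ∃ p x, z = lift p x := ⟨z ≫ fst _ _, z ≫ snd _ _, by simp⟩
        obtain rfl : x = x' := by simpa using e
        obtain ⟨h, rfl⟩ := P.exists_left p p'
        simp only [comp_cls, lift_fst, lift_snd, lift_fst_assoc]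
        rw [Category.assoc, hl, cls_act, ← P.lift_cls_act, (P.prod X).isTorsor.isAction.inv_act])
    refine ⟨a, fun p x => ?_⟩
    have := lift p x ≫= ha
    simpa only [comp_cls, lift_fst, lift_snd, lift_fst_assoc, lift_snd_assoc] using this
  choose a ha using key
  have loc (T : Sch F) : ∃ (T' : Sch F) (c : T' ⟶ T) (_ : T' ⟶ P.carrier), IsCov c := by
    obtain ⟨T', c, p, hc, -⟩ := P.isTorsor.hasLocalSections.exists_lift (toUnit T)
    exact ⟨T', c, p, hc⟩
  have hp (X : Torsor G) : a X ≫ ((P'.prod (P.prod X)).proj ≫ eqToHom (P'.prod_base _)) ≫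
      eqToHom (P.prod_base X) = X.proj := by
    obtain ⟨T', c, p, hc⟩ := loc X.total
    refine hc.hom_ext ?_
    rw [← Category.assoc, ha X p c, ← Category.assoc, cls_proj, Category.assoc, cls_proj]
  have hact (X : Torsor G) {T : Sch F} (g : T ⟶ G) (x : T ⟶ X.total) :
      lift g x ≫ X.act ≫ a X = lift g (x ≫ a X) ≫ (P'.prod (P.prod X)).act := by
    obtain ⟨T', c, p, hc⟩ := loc T
    refine hc.hom_ext ?_
    rw [comp_lift_assoc, comp_lift_assoc, ← Category.assoc c x, ha X p, lift_cls_act,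
      ← Category.assoc, ha X (lift p (c ≫ g)⁻¹ ≫ P.right), cls_act, X.isTorsor.isAction.inv_act,
      Category.assoc, hr, inv_inv]
  have hnat {X Y : Torsor G} (f : X ⟶ Y) (k : P.prod X ⟶ P.prod Y) (hk : k.total = P.prodMap f) :
      f.total ≫ a Y = a X ≫ P'.prodMap k := by
    obtain ⟨T', c, p, hc⟩ := loc X.total
    refine hc.hom_ext ?_
    rw [← Category.assoc, ← Category.assoc, ha X p, ha Y p, cls_prodMap, hk, cls_prodMap]
  let α : BasedFunctor.id (classifyingStack G) ⟶ BasedFunctor.comp P.stackMap P'.stackMap :=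
    StackMap.natMk (Φ := BasedFunctor.id (classifyingStack G))
      (Φ' := BasedFunctor.comp P.stackMap P'.stackMap) a
      (fun X => by
        rw [StackMap.comp_pr, StackMap.id_pr]
        exact hp X)
      hact (fun f => hnat f (P.stackMap.mapT f) rfl)
  have := StackMap.isIso_nat α
  exact ⟨(asIso α).symm⟩

/-- `Φ_P` is invertible, with the inverse that is attached to the opposite bitorsor. -/
lemma isStackEquivalence_stackMap [IsAffineHom G.hom] [IsAffineHom H.hom] (P : Bitorsor H G) :
    IsStackEquivalence P.stackMap := by
  refine ⟨P.op.stackMap, exists_iso_comp P P.op (𝟙 _) (fun h p => ?_) (fun p g => ?_),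
    exists_iso_comp P.op P (𝟙 _) (fun g p => ?_) (fun p h => ?_)⟩
  · rw [Category.comp_id, Category.comp_id, lift_rightOfLeft, inv_inv]
  · rw [Category.comp_id, Category.comp_id, lift_leftOfRight, inv_inv]
  · rw [Category.comp_id, Category.comp_id, lift_leftOfRight]
  · rw [Category.comp_id, Category.comp_id, lift_rightOfLeft]

end Bitorsor

instance [IsAffineHom G.hom] [IsAffineHom H.hom] : (evaluation G H).EssSurj where
  mem_essImage P := by
    have hP := P.isStackEquivalence_stackMap
    obtain ⟨f⟩ := P.exists_iso_bitorsor hP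
    exact ⟨⟨P.stackMap, hP⟩, ⟨(asIso f).symm⟩⟩

end BalancedProductMorphism

/-! ### Strongly inner forms in terms of one covering -/

noncomputable section InnerForms

open AlgebraicGeometry PresheafOfGroups Opposite

namespace GrpIsoOver

variable {C : Type u} [Category.{v} C] [CartesianMonoidalCategory C] {G H : C} [GrpObj G] [GrpObj H]

lemma lift_conj_hom {T Z : C} (k : T ⟶ G) (x : Z ⟶ G) (t : Z ⟶ T) :
    lift x t ≫ (conj k).hom = (t ≫ k) * x * (t ≫ k)⁻¹ := by
  simp [conj, comp_mul, GrpObj.comp_inv]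

lemma lift_trans_hom {K T Z : C} [GrpObj K] (e : GrpIsoOver G H T) (f : GrpIsoOver H K T)
    (x : Z ⟶ G) (t : Z ⟶ T) :
    lift x t ≫ (e.trans f).hom = lift (lift x t ≫ e.hom) t ≫ f.hom := by
  simp [trans, comp_lift_assoc]

lemma lift_pullback_hom {T T' Z : C} (e : GrpIsoOver G H T) (f : T' ⟶ T) (x : Z ⟶ G)
    (t : Z ⟶ T') : lift x t ≫ (e.pullback f).hom = lift x (t ≫ f) ≫ e.hom := by
  simp [pullback, comp_lift_assoc]

lemma trans_symm {K T : C} [GrpObj K] (e : GrpIsoOver G H T) (f : GrpIsoOver H K T) :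
    (e.trans f).symm = f.symm.trans e.symm := rfl

lemma inv_eq {T : C} (a : GrpIsoOver G G T) : a⁻¹ = a.symm := rfl

end GrpIsoOver

variable {F : Type u} [Field F]

/-- The spectrum of a field being a point, every étale covering of it has a member that is a
covering by itself. -/
lemma EtaleCovering.exists_isCov (𝒰 : EtaleCovering F) : ∃ i, IsCov (toUnit (𝒰.U i)) := by
  obtain ⟨i, y, hy⟩ := 𝒰.surjective (IsLocalRing.closedPoint F)
  refine ⟨i, 𝒰.etale i, ⟨fun x => ⟨y, ?_⟩⟩⟩
  have : Subsingleton (Spec (CommRingCat.of F)) := inferInstanceAs (Subsingleton (PrimeSpectrum F))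
  exact Subsingleton.elim (α := Spec (CommRingCat.of F)) _ _

/-- The étale covering of the point by a single `F`-scheme. -/
def EtaleCovering.ofIsCov {U : Sch F} (hU : IsCov (toUnit U)) : EtaleCovering F where
  I := PUnit
  U _ := U
  etale _ := hU.etale
  surjective x := by
    obtain ⟨y, hy⟩ := hU.surjective.surj x
    exact ⟨⟨⟩, y, hy⟩

variable {G H : Sch F} [GrpObj G] [GrpObj H]

/-- The cocycle `w` with values in `Aut(G)` becomes, on some covering `U` of the point, the cocycle
of a form `H` of `G` that is trivialized over `U`. -/
def IsLocallyFormCocycle (G H : Sch F) [GrpObj G] [GrpObj H] (w : EtaleCocycle (autPresheaf G)) :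
    Prop :=
  ∃ (U : Sch F) (i : w.cov.I) (m : U ⟶ w.cov.U i) (φ : GrpIsoOver H G U), IsCov (toUnit U) ∧
    ∀ {T : Sch F} (a b : T ⟶ U), w.cocycle.ev i i (a ≫ m) (b ≫ m) =
      (φ.pullback b).symm.trans (φ.pullback a)

lemma isLocallyFormCocycle_formCocycle (𝒰 : EtaleCovering F) (φ : ∀ i, GrpIsoOver H G (𝒰.U i)) :
    IsLocallyFormCocycle G H ⟨𝒰, formCocycle φ⟩ := by
  obtain ⟨i, hi⟩ := 𝒰.exists_isCov
  refine ⟨𝒰.U i, i, 𝟙 _, φ i, hi, fun a b => ?_⟩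
  rw [Category.comp_id, Category.comp_id]
  rfl

/-- The cocycles of the forms that are locally isomorphic to `H` are closed under the relation which
defines the cohomology set: the local isomorphisms are composed with the coboundary. -/
lemma IsLocallyFormCocycle.of_rel {w w' : EtaleCocycle (autPresheaf G)}
    (h : IsLocallyFormCocycle G H w) (hw : EtaleCocycle.Rel w w') :
    IsLocallyFormCocycle G H w' := by
  obtain ⟨U, i, m, φ, hU, hφ⟩ := h
  obtain ⟨𝒱, r, r', α, hα⟩ := hw
  obtain ⟨k, hk⟩ := 𝒱.exists_isCov
  let V := U ⊗ 𝒱.U k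
  -- the two maps from `V` to the covering of `w` differ by a coboundary, given by `w` itself
  let β : GrpIsoOver G G V := w.cocycle.ev (r.idx k) i (snd _ _ ≫ r.map k) (fst _ _ ≫ m)
  let α' : GrpIsoOver G G V := (show GrpIsoOver G G (𝒱.U k) from α k).pullback (snd _ _)
  have hV : IsCov (toUnit V) := by
    rw [toUnit_unique (toUnit V) (fst U (𝒱.U k) ≫ toUnit U)]
    exact (hk.fst U).comp hU
  refine ⟨V, r'.idx k, snd _ _ ≫ r'.map k, (φ.pullback (fst _ _)).trans (α' * β), hV,
    fun {T} a b => ?_⟩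
  have hβ (a : T ⟶ V) : β.pullback a =
      w.cocycle.ev (r.idx k) i ((a ≫ snd _ _) ≫ r.map k) ((a ≫ fst _ _) ≫ m) := by
    rw [Category.assoc, Category.assoc]
    exact w.cocycle.ev_precomp (r.idx k) i a (snd _ _ ≫ r.map k) (fst _ _ ≫ m)
  have hV' (a : T ⟶ V) : ((φ.pullback (fst _ _)).trans (α' * β)).pullback a =
      (φ.pullback (a ≫ fst _ _)).trans (α'.pullback a * β.pullback a) := by
    rw [GrpIsoOver.pullback_trans, GrpIsoOver.mul_eq, GrpIsoOver.pullback_trans,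
      GrpIsoOver.pullback_comp, GrpIsoOver.mul_eq]
  obtain ⟨E, hE⟩ : ∃ E : GrpIsoOver G G T, E = w.cocycle.ev (r.idx k) (r.idx k)
    ((a ≫ snd _ _) ≫ r.map k) ((b ≫ snd _ _) ≫ r.map k) := ⟨_, rfl⟩
  obtain ⟨E', hE'⟩ : ∃ E' : GrpIsoOver G G T, E' = w'.cocycle.ev (r'.idx k) (r'.idx k)
    (a ≫ snd _ _ ≫ r'.map k) (b ≫ snd _ _ ≫ r'.map k) := ⟨_, rfl⟩
  have h₁ : α'.pullback a * E = E' * α'.pullback b := by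
    have := hα k k (a ≫ snd _ _) (b ≫ snd _ _)
    rw [hE, hE', ← GrpIsoOver.pullback_comp, ← GrpIsoOver.pullback_comp, ← Category.assoc,
      ← Category.assoc]
    exact this
  have h₂ : β.pullback a * ((φ.pullback (b ≫ fst _ _)).symm.trans (φ.pullback (a ≫ fst _ _))) =
      E * β.pullback b := by
    rw [← hφ, hβ, hβ, hE]
    exact (w.cocycle.ev_trans _ _ _ _ _ _).trans (w.cocycle.ev_trans _ _ _ _ _ _).symm
  refine hE'.symm.trans ?_
  rw [hV', hV', GrpIsoOver.trans_symm, GrpIsoOver.trans_assoc, ← GrpIsoOver.trans_assoc _ _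
    (α'.pullback a * β.pullback a), ← GrpIsoOver.inv_eq, ← GrpIsoOver.mul_eq,
    ← GrpIsoOver.mul_eq, eq_mul_inv_iff_mul_eq, _root_.mul_assoc (α'.pullback a), h₂,
    ← _root_.mul_assoc, ← _root_.mul_assoc, h₁]

lemma isLocallyFormCocycle_congr {w w' : EtaleCocycle (autPresheaf G)}
    (h : (Quot.mk _ w : H1et (autPresheaf G)) = Quot.mk _ w') :
    IsLocallyFormCocycle G H w ↔ IsLocallyFormCocycle G H w' := by
  have symm {w w' : EtaleCocycle (autPresheaf G)} (h : EtaleCocycle.Rel w w') :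
      EtaleCocycle.Rel w' w := by
    obtain ⟨𝒱, r, r', h⟩ := h
    exact ⟨𝒱, r', r, (OneCocycle.equivalence_isCohomologous _ _).symm h⟩
  exact iff_of_eq (congrArg (Quot.lift (IsLocallyFormCocycle G H)
    fun w w' h => propext ⟨fun hw => hw.of_rel h, fun hw => hw.of_rel (symm h)⟩) h)

/-- A strongly inner form in elementary terms: over some covering `U` of the point there is an
isomorphism `φ` from `H` to `G`, and a cocycle `ρ` of `G` such that `φ_u` and `φ_v` differ by
conjugation with `ρ (u, v)`. -/
theorem isStronglyInnerForm_iff : IsStronglyInnerForm G H ↔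
    ∃ (U : Sch F) (ρ : U ⊗ U ⟶ G) (φ : GrpIsoOver H G U), IsCov (toUnit U) ∧
      (∀ {T : Sch F} (u v w : T ⟶ U), (lift u v ≫ ρ) * (lift v w ≫ ρ) = lift u w ≫ ρ) ∧
      ∀ {T : Sch F} (u v : T ⟶ U) (h : T ⟶ H), lift h u ≫ φ.hom =
        (lift u v ≫ ρ) * (lift h v ≫ φ.hom) * (lift u v ≫ ρ)⁻¹ := by
  constructor
  · rintro ⟨c, ⟨𝒰, φ, rfl⟩, w, hw⟩
    obtain ⟨z, rfl⟩ := Quot.exists_rep w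
    have key : IsLocallyFormCocycle G H ⟨z.cov, mapCocycle (conjHom G) z.cocycle⟩ := by
      rw [isLocallyFormCocycle_congr hw]
      exact isLocallyFormCocycle_formCocycle 𝒰 φ
    obtain ⟨U, i, m, φ, hU, hφ⟩ := key
    let ρ : U ⊗ U ⟶ G := z.cocycle.ev i i (fst U U ≫ m) (snd U U ≫ m)
    have hρ {T : Sch F} (u v : T ⟶ U) : lift u v ≫ ρ = z.cocycle.ev i i (u ≫ m) (v ≫ m) := by
      refine (z.cocycle.ev_precomp i i (lift u v) (fst U U ≫ m) (snd U U ≫ m)).trans ?_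
      rw [lift_fst_assoc, lift_snd_assoc]
    refine ⟨U, ρ, φ, hU, fun u v w => ?_, fun {T} u v h => ?_⟩
    · rw [hρ, hρ, hρ]
      exact z.cocycle.ev_trans _ _ _ _ _ _
    · have e : GrpIsoOver.conj (lift u v ≫ ρ) = (φ.pullback v).symm.trans (φ.pullback u) := by
        rw [hρ]
        exact hφ u v
      have := lift (lift h v ≫ φ.hom) (𝟙 T) ≫= congrArg GrpIsoOver.hom e
      rw [GrpIsoOver.lift_conj_hom, GrpIsoOver.lift_trans_hom, GrpIsoOver.lift_pullback_hom,
        Category.id_comp, Category.id_comp] at this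
      rw [this]
      congr 2
      have e₂ := (φ.pullback v).hom_inv_apply h (𝟙 T)
      rw [GrpIsoOver.lift_pullback_hom, Category.id_comp] at e₂
      exact e₂.symm
  · rintro ⟨U, ρ, φ, hU, hρ, hφ⟩
    let z : EtaleCocycle (yonedaGrpObj G) :=
      { cov := .ofIsCov hU
        cocycle :=
          { ev _ _ _ a b := lift a b ≫ ρ
            ev_precomp _ _ _ _ f a b := comp_lift_assoc (C := Sch F) f a b ρ
            ev_trans _ _ _ _ a b c := hρ a b c } }
    refine ⟨_, ⟨.ofIsCov hU, fun _ => φ, rfl⟩, Quot.mk _ z,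
      congrArg (fun y => Quot.mk _ (EtaleCocycle.mk (A := autPresheaf G) (.ofIsCov hU) y)) ?_⟩
    have ext {y y' : OneCocycle (autPresheaf G) (fun _ : PUnit.{u + 1} => U)}
        (h : ∀ {T : Sch F} (a b : T ⟶ U), y.ev ⟨⟩ ⟨⟩ a b = y'.ev ⟨⟩ ⟨⟩ a b) : y = y' := by
      obtain ⟨⟨e, he⟩, he'⟩ := y
      obtain ⟨⟨f, hf⟩, hf'⟩ := y'
      obtain rfl : e = f := by
        funext i j T a b
        exact h a b
      rfl
    refine ext fun {T} a b => GrpIsoOver.ext (hom_ext_point₂ fun x t => ?_)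
    change lift x t ≫ (GrpIsoOver.conj (lift a b ≫ ρ)).hom =
      lift x t ≫ ((φ.pullback b).symm.trans (φ.pullback a)).hom
    rw [GrpIsoOver.lift_conj_hom, GrpIsoOver.lift_trans_hom, GrpIsoOver.lift_pullback_hom,
      hφ (t ≫ a) (t ≫ b), comp_lift_assoc, ← GrpIsoOver.lift_pullback_hom φ b]
    congr 2
    exact ((φ.pullback b).inv_hom_apply x t).symm

end InnerForms

/-! ### Strongly inner forms and bitorsors -/

noncomputable section InnerFormsAndBitorsors

open AlgebraicGeometry

variable {F : Type u} [Field F] {G H : Sch F} [GrpObj G] [GrpObj H]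

/-- A local section `σ` of a bitorsor yields the local isomorphism `φ` with `h σ = σ φ(h)`, which
changes by conjugation with the cocycle of `σ`. -/
theorem Bitorsor.isStronglyInnerForm (P : Bitorsor H G) : IsStronglyInnerForm G H := by
  obtain ⟨U, σ, -, hU⟩ := P.exists_affine_section
  obtain ⟨ρ, hσ, hρ⟩ := P.exists_cocycle σ
  obtain ⟨f, hf⟩ := P.exists_right (snd H U ≫ σ) (lift (fst H U) (snd H U ≫ σ) ≫ P.left)
  obtain ⟨k, hk⟩ := P.exists_left (snd G U ≫ σ) (lift (snd G U ≫ σ) (fst G U) ≫ P.right)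
  have hf' {T : Sch F} (h : T ⟶ H) (u : T ⟶ U) :
      lift (u ≫ σ) (lift h u ≫ f) ≫ P.right = lift h (u ≫ σ) ≫ P.left := by
    simpa [comp_lift_assoc] using lift h u ≫= hf
  have hk' {T : Sch F} (g : T ⟶ G) (u : T ⟶ U) :
      lift (lift g u ≫ k) (u ≫ σ) ≫ P.left = lift (u ≫ σ) g ≫ P.right := by
    simpa [comp_lift_assoc] using lift g u ≫= hk
  let φ : GrpIsoOver H G U :=
    { hom := f
      inv := k
      hom_inv := hom_ext_point₂ fun h u => P.isTorsor.free (x := u ≫ σ) (by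
        rw [comp_lift_assoc, lift_snd, lift_fst, hk', hf'])
      inv_hom := hom_ext_point₂ fun g u => right_injective (p := u ≫ σ) (by
        rw [comp_lift_assoc, lift_snd, lift_fst, hf', hk'])
      map_mul := fun h h' u => right_injective (p := u ≫ σ) (by
        rw [hf', ← right_mul, hf', P.comm, hf', P.isTorsor.isAction.mul_act]) }
  refine isStronglyInnerForm_iff.mpr ⟨U, ρ, φ, hU, hρ, fun u v h => ?_⟩
  refine right_injective (p := u ≫ σ) ?_
  rw [← right_mul, ← right_mul, hσ, hf', hf', P.comm, ← hσ u v, right_mul, mul_inv_cancel,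
    right_one]

/-- The bitorsor attached to a cocycle `ρ` and local isomorphisms `φ` which differ by conjugation
with `ρ`: it is the twist of `G` by `ρ`, on which `G` acts by right multiplication, and `H` by left
multiplication through `φ`. -/
theorem IsStronglyInnerForm.nonempty_bitorsor [hG : IsAffineHom G.hom]
    (h : IsStronglyInnerForm G H) : Nonempty (Bitorsor H G) := by
  obtain ⟨U', ρ', φ', hU', hρ', hφ'⟩ := isStronglyInnerForm_iff.mp h
  obtain ⟨U, ρ, φ, _, hU, hρ, hφ⟩ : ∃ (U : Sch F) (ρ : U ⊗ U ⟶ G) (φ : GrpIsoOver H G U),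
      IsAffine U.left ∧ IsCov (toUnit U) ∧
      (∀ {T : Sch F} (u v w : T ⟶ U), (lift u v ≫ ρ) * (lift v w ≫ ρ) = lift u w ≫ ρ) ∧
      ∀ {T : Sch F} (u v : T ⟶ U) (h : T ⟶ H), lift h u ≫ φ.hom =
        (lift u v ≫ ρ) * (lift h v ≫ φ.hom) * (lift u v ≫ ρ)⁻¹ := by
    obtain ⟨U, m, hU₁, hU₂⟩ := hU'.exists_affine
    refine ⟨U, (m ⊗ₘ m) ≫ ρ', φ'.pullback m, hU₁, hU₂, fun u v w => ?_, fun u v h => ?_⟩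
    · simp only [lift_map_assoc, hρ']
    · rw [lift_map_assoc, GrpIsoOver.lift_pullback_hom, GrpIsoOver.lift_pullback_hom, hφ' _ (v ≫ m)]
  -- the restriction to an affine covering makes descent effective; the torsor to be twisted is `G`
  have hμ : IsTorsor (MonObj.mul (X := G)) (toUnit G) := by
    have mul_eq {T : Sch F} (g x : T ⟶ G) : lift g x ≫ MonObj.mul (X := G) = g * x := rfl
    refine .of_points ⟨fun x => ?_, fun g k x => ?_⟩ (fun _ _ => toUnit_unique _ _)
      (fun g k x e => ?_) (fun {T} x y _ => ⟨T, 𝟙 T, y * x⁻¹, IsCov.of_isIso _, ?_⟩)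
      ⟨𝟙_ _, 𝟙 _, 1, IsCov.of_isIso _, toUnit_unique _ _⟩
    · rw [mul_eq, _root_.one_mul]
    · rw [mul_eq, mul_eq, mul_eq, _root_.mul_assoc]
    · exact mul_right_cancel e
    · rw [mul_eq, Category.id_comp, Category.id_comp, inv_mul_cancel_right]
  obtain ⟨Y, π, -, hπ, -⟩ := exists_twist hU ρ hρ hμ
  have hπ' {T : Sch F} (u v : T ⟶ U) (x : T ⟶ G) :
      lift u ((lift u v ≫ ρ) * x) ≫ π = lift v x ≫ π := by
    rw [← hπ.transport u v x, lift_twistTransport]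
    rfl
  have loc {T : Sch F} (y : T ⟶ Y) : ∃ (T' : Sch F) (c : T' ⟶ T) (u : T' ⟶ U) (x : T' ⟶ G),
      IsCov c ∧ lift u x ≫ π = c ≫ y := by
    obtain ⟨x, hx⟩ := hπ.exists_lift (snd T U) (fst T U ≫ y)
    exact ⟨_, fst T U, snd T U, x, hU.fst T, hx⟩
  have loc₂ {T : Sch F} (y y' : T ⟶ Y) : ∃ (T' : Sch F) (c : T' ⟶ T) (u : T' ⟶ U)
      (x x' : T' ⟶ G), IsCov c ∧ lift u x ≫ π = c ≫ y ∧ lift u x' ≫ π = c ≫ y' := by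
    obtain ⟨T', c, u, x, hc, hx⟩ := loc y
    obtain ⟨x', hx'⟩ := hπ.exists_lift u (c ≫ y')
    exact ⟨T', c, u, x, x', hc, hx, hx'⟩
  have hY : HasLocalSections (toUnit Y) :=
    ⟨U, toUnit U, lift (𝟙 U) 1 ≫ π, hU, toUnit_unique _ _⟩
  have hloc := (hπ.isCov hU).hasLocalSections
  -- `h • π(u, x) = π(u, φ_u(h) x)`
  obtain ⟨left, hleft⟩ : ∃ left : H ⊗ Y ⟶ Y, ∀ {T : Sch F} (h : T ⟶ H) (u : T ⟶ U) (x : T ⟶ G),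
      lift h (lift u x ≫ π) ≫ left = lift u ((lift h u ≫ φ.hom) * x) ≫ π := by
    obtain ⟨left, hl⟩ := (hloc.whiskerLeft H).exists_desc
      (lift (snd _ _ ≫ fst _ _) ((lift (fst _ _) (snd _ _ ≫ fst _ _) ≫ φ.hom) *
        (snd H (U ⊗ G) ≫ snd _ _)) ≫ π) (fun {T} a b hab => by
          obtain ⟨h, y, rfl⟩ : ∃ p x, a = lift p x := ⟨a ≫ fst _ _, a ≫ snd _ _, by simp⟩
          obtain ⟨h', z, rfl⟩ : ∃ p x, b = lift p x := ⟨b ≫ fst _ _, b ≫ snd _ _, by simp⟩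
          rw [lift_whiskerLeft, lift_whiskerLeft] at hab
          obtain rfl : h = h' := by simpa using hab =≫ fst _ _
          obtain ⟨u, x, rfl⟩ : ∃ p x, y = lift p x := ⟨y ≫ fst _ _, y ≫ snd _ _, by simp⟩
          obtain ⟨v, x', rfl⟩ : ∃ p x, z = lift p x := ⟨z ≫ fst _ _, z ≫ snd _ _, by simp⟩
          have e : x = (lift u v ≫ ρ) * x' :=
            (hπ.eq_transport (by simpa using hab =≫ snd _ _)).trans (lift_twistTransport _ _ _ _ _)
          simp only [comp_lift_assoc, comp_mul, lift_snd_assoc, lift_fst, lift_snd]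
          rw [← hπ' u v, e, hφ u v h, ← _root_.mul_assoc, ← _root_.mul_assoc,
            inv_mul_cancel_right])
    refine ⟨left, fun h u x => ?_⟩
    have := lift h (lift u x) ≫= hl
    simpa only [comp_lift_assoc, comp_mul, lift_snd_assoc, lift_fst, lift_snd,
      lift_whiskerLeft_assoc] using this
  -- `π(u, x) • g = π(u, x g)`
  obtain ⟨right, hright⟩ : ∃ right : Y ⊗ G ⟶ Y, ∀ {T : Sch F} (u : T ⟶ U) (x g : T ⟶ G),
      lift (lift u x ≫ π) g ≫ right = lift u (x * g) ≫ π := by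
    obtain ⟨right, hr⟩ := (hloc.whiskerLeft G).exists_desc
      (lift (snd _ _ ≫ fst _ _) ((snd G (U ⊗ G) ≫ snd _ _) * fst _ _) ≫ π) (fun {T} a b hab => by
          obtain ⟨h, y, rfl⟩ : ∃ p x, a = lift p x := ⟨a ≫ fst _ _, a ≫ snd _ _, by simp⟩
          obtain ⟨h', z, rfl⟩ : ∃ p x, b = lift p x := ⟨b ≫ fst _ _, b ≫ snd _ _, by simp⟩
          rw [lift_whiskerLeft, lift_whiskerLeft] at hab
          obtain rfl : h = h' := by simpa using hab =≫ fst _ _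
          obtain ⟨u, x, rfl⟩ : ∃ p x, y = lift p x := ⟨y ≫ fst _ _, y ≫ snd _ _, by simp⟩
          obtain ⟨v, x', rfl⟩ : ∃ p x, z = lift p x := ⟨z ≫ fst _ _, z ≫ snd _ _, by simp⟩
          have e : x = (lift u v ≫ ρ) * x' :=
            (hπ.eq_transport (by simpa using hab =≫ snd _ _)).trans (lift_twistTransport _ _ _ _ _)
          simp only [comp_lift_assoc, comp_mul, lift_snd_assoc, lift_fst, lift_snd]
          rw [← hπ' u v, e, _root_.mul_assoc])
    refine ⟨lift (snd _ _) (fst _ _) ≫ right, fun u x g => ?_⟩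
    have := lift g (lift u x) ≫= hr
    simpa only [comp_lift_assoc, comp_mul, lift_snd_assoc, lift_fst, lift_snd,
      lift_whiskerLeft_assoc] using this
  refine ⟨⟨Y, left, right, ?_, ?_, fun {T} h y g => ?_⟩⟩
  · refine .of_points ⟨fun y => ?_, fun g k y => ?_⟩ (fun _ _ => toUnit_unique _ _)
      (fun g k y e => ?_) (fun {T} y y' _ => ?_) hY
    · obtain ⟨T', c, u, x, hc, hx⟩ := loc y
      refine hc.hom_ext ?_
      have := φ.map_mul 1 1 u
      rw [_root_.mul_one, left_eq_mul] at this
      rw [comp_lift_assoc, ← hx, comp_one, hleft, this, _root_.one_mul]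
    · obtain ⟨T', c, u, x, hc, hx⟩ := loc y
      refine hc.hom_ext ?_
      rw [comp_lift_assoc, comp_lift_assoc, comp_lift_assoc, ← hx, comp_mul, hleft, hleft, hleft,
        φ.map_mul, _root_.mul_assoc]
    · obtain ⟨T', c, u, x, hc, hx⟩ := loc y
      refine hc.hom_ext ?_
      have e' := c ≫= e
      rw [comp_lift_assoc, comp_lift_assoc, ← hx, hleft, hleft] at e'
      rw [← φ.hom_inv_apply (c ≫ g) u, mul_right_cancel (hπ.inj e'), φ.hom_inv_apply]
    · obtain ⟨T', c, u, x, x', hc, hx, hx'⟩ := loc₂ y y'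
      refine ⟨T', c, lift (x' * x⁻¹) u ≫ φ.inv, hc, ?_⟩
      rw [← hx, ← hx', hleft, φ.inv_hom_apply, inv_mul_cancel_right]
  · refine .of_points ⟨fun y => ?_, fun y g k => ?_⟩ (fun _ _ => toUnit_unique _ _)
      (fun g k y e => ?_) (fun {T} y y' _ => ?_) hY
    · obtain ⟨T', c, u, x, hc, hx⟩ := loc y
      refine hc.hom_ext ?_
      rw [comp_lift_assoc, ← hx, comp_one, hright, _root_.mul_one]
    · obtain ⟨T', c, u, x, hc, hx⟩ := loc y
      refine hc.hom_ext ?_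
      rw [comp_lift_assoc, comp_lift_assoc, comp_lift_assoc, ← hx, comp_mul, hright, hright,
        hright, _root_.mul_assoc]
    · obtain ⟨T', c, u, x, hc, hx⟩ := loc y
      refine hc.hom_ext ?_
      have e' := c ≫= e
      rw [comp_lift_assoc, comp_lift_assoc, ← hx, hright, hright] at e'
      exact mul_left_cancel (hπ.inj e')
    · obtain ⟨T', c, u, x, x', hc, hx, hx'⟩ := loc₂ y y'
      exact ⟨T', c, x⁻¹ * x', hc, by rw [← hx, ← hx', hright, mul_inv_cancel_left]⟩
  · obtain ⟨T', c, u, x, hc, hx⟩ := loc y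
    refine hc.hom_ext ?_
    rw [comp_lift_assoc, comp_lift_assoc, comp_lift_assoc, comp_lift_assoc, ← hx, hleft, hright,
      hright, hleft, _root_.mul_assoc]

end InnerFormsAndBitorsors

end StrongInner

theorem mainTheorem5 {F : Type*} [Field F] (G H : StrongInner.Sch F) [GrpObj G] [GrpObj H]
    (hG : AlgebraicGeometry.Smooth G.hom) (hG' : AlgebraicGeometry.IsAffineHom G.hom)
    (hH : AlgebraicGeometry.Smooth H.hom) (hH' : AlgebraicGeometry.IsAffineHom H.hom) :
    (∃ E : StrongInner.InvertibleMorphisms (StrongInner.classifyingStack G)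
          (StrongInner.classifyingStack H) ≌ StrongInner.Bitorsor H G,
        Nonempty (StrongInner.EvaluationAtTrivialTorsor E.functor) ∧
          Nonempty (StrongInner.BalancedProductFunctor E.inverse)) ∧
      List.TFAE
        [∃ Φ : BasedFunctor (StrongInner.classifyingStack G) (StrongInner.classifyingStack H),
            StrongInner.IsStackEquivalence Φ,
          Nonempty (StrongInner.Bitorsor H G),
          StrongInner.IsStronglyInnerForm G H ∧ StrongInner.IsStronglyInnerForm H G] := by
  have hE : (StrongInner.evaluation G H).IsEquivalence := {}
  refine ⟨⟨(StrongInner.evaluation G H).asEquivalence,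
    ⟨StrongInner.evaluationAtTrivialTorsor G H⟩, ⟨StrongInner.balancedProductFunctor⟩⟩, ?_⟩
  tfae_have 1 → 2 := fun ⟨Φ, hΦ⟩ => ⟨StrongInner.StackMap.bitorsor Φ hΦ⟩
  tfae_have 2 → 1 := fun ⟨P⟩ => ⟨P.stackMap, P.isStackEquivalence_stackMap⟩
  tfae_have 2 → 3 := fun ⟨P⟩ => ⟨P.isStronglyInnerForm, P.op.isStronglyInnerForm⟩
  tfae_have 3 → 2 := fun h => h.1.nonempty_bitorsor
  tfae_finish
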